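/- Fix $q\in\mathbb C$ with $0<|q|<1$. Write $(a)_k=\prod_{i=0}^{k-1}(1-aq^i)$ for $k\ge 0$, $(a)_{k}=\prod_{i=1}^{-k}(1-aq^{-i})^{-1}$ for $k<0$, $(a)_\infty=\prod_{j\ge0}(1-aq^j)$ and $\theta(x)=(x)_\infty(q/x)_\infty$. Let $a_1,a_2,a_3,b_1,b_2,b_3\in\mathbb C$ satisfy $a_1a_2a_3b_1b_2b_3=q$ and be generic in the sense that $a_i/a_j,\ b_i/b_j\notin q^{\mathbb Z}$ for $i\ne j$ and $a_ib_j\notin q^{\mathbb Z}$ for all $i,j$. Put $t=a_1a_2a_3$. Let $W$ be the space of rational functions of $z$ that are regular everywhere on the Riemann sphere (including at $0$ and $\infty$), except for possible single poles at the points $a_j^{-1}q^{m}$ and $b_jq^{-m}$ with $1\le j\le3$ and $m\in\mathbb Z_{>0}$. There is a unique linear functional $\mathbf K$ on $W$ (the Al-Salam--Ismail functional) such that for all integers $k_j,l_j$ with $T:=k_1+k_2+k_3=-l_1-l_2-l_3$ the function $z^{-T}\prod_{j=1}^3(a_jz)_{k_j}(b_j/z)_{l_j}$ is in $W$ and $$\mathbf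 K\Big(z^{-T}\prod_{j=1}^3(a_jz)_{k_j}(b_j/z)_{l_j}\Big)=\frac{(-t)^Tq^{\binom T2}\prod_{i,j=1}^3(a_ib_j)_{k_i+l_j}}{\prod_{j=1}^3q^{\binom{k_j}2+\binom{l_j}2}a_j^{k_j}b_j^{l_j}}.$$ Moreover, let $\lambda_1,\lambda_2,\lambda_3\in\mathbb C\setminus\{0\}$ be generic in the sense that $\lambda_i/\lambda_j\notin q^{\mathbb Z}$ for $i\neq j$, $t\lambda_1\lambda_2\lambda_3\notin q^{\mathbb Z}$, and $a_j\lambda_k,\ \lambda_k/b_j\notin q^{\mathbb Z}$ for all $j,k$ (no balancing condition is imposed on the $\lambda_k$). Then for every $g\in W$ the three bilateral series below converge absolutely and $$\mathbf K(g)=C\sum_{k=1}^3X_k\sum_{x=-\infty}^\infty q^xg(\lambda_kq^x)\prod_{j=1}^3\frac{(a_j\lambda_k)_x}{(q\lambda_k/b_j)_x},$$ where $$C=\frac{\lambda_1\lambda_2\lambda_3}{(q)_\infty\,\theta(t\lambda_1\lambda_2\lambda_3)\prod_{i,j=1}^3(q/a_ib_j)_\infty\prod_{1\le i<j\le3}\lambda_j\theta(\lambda_i/\lambda_j)}$$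 and, with the indices of $\lambda$ read modulo $3$, $$X_k=\prod_{j=1}^3(q/a_j\lambda_k)_\infty(q\lambda_k/b_j)_\infty\left\{\frac{\lambda_{k+1}}{\lambda_{k+2}}\prod_{j=1}^3\theta(a_j\lambda_{k+2})\theta(b_j/\lambda_{k+1})-\frac{\lambda_{k+2}}{\lambda_{k+1}}\prod_{j=1}^3\theta(a_j\lambda_{k+1})\theta(b_j/\lambda_{k+2})\right\}.$$ -/

import Mathlib

noncomputable section

namespace QSeries

open Polynomial

/-- The `q`-shifted factorial `(a)_k` for `k : ℤ`, over any field: `∏_{0 ≤ i < k} (1 - a q ^ i)`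
for `k ≥ 0` and `(∏_{1 ≤ i ≤ -k} (1 - a q ^ (-i)))⁻¹` for `k < 0`. -/
def qPoch {F : Type*} [Field F] (q a : F) : ℤ → F
  | Int.ofNat n => ∏ i ∈ Finset.range n, (1 - a * q ^ i)
  | Int.negSucc n => (∏ i ∈ Finset.range (n + 1), (1 - a * (q ^ (i + 1))⁻¹))⁻¹

/-- `(a)_∞ = ∏_{j ≥ 0} (1 - a q ^ j)`. -/
def qPochInf (q a : ℂ) : ℂ := ∏' j : ℕ, (1 - a * q ^ j)

/-- `θ(x) = (x)_∞ (q / x)_∞`. -/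
def qTheta (q x : ℂ) : ℂ := qPochInf q x * qPochInf q (q / x)

/-- The binomial coefficient `n (n - 1) / 2` of an integer `n` (the division is exact). -/
def choose2 (n : ℤ) : ℤ := n * (n - 1) / 2

/-- The admissible poles: `z ∈ a_j⁻¹ q ^ m` or `z ∈ b_j q ^ (-m)`, with `m > 0`. -/
def poleSet (q : ℂ) (a b : Fin 3 → ℂ) : Set ℂ :=
  {z | ∃ j : Fin 3, ∃ m : ℕ, 0 < m ∧ (z = (a j)⁻¹ * q ^ m ∨ z = b j * (q ^ m)⁻¹)}

/-- `f` is regular on the Riemann sphere, except for possible single poles in `P` (a subset of the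
finite plane). As `f.num` and `f.denom` are coprime, the multiplicity of `z` as a root of `f.denom`
is the order of the pole at `z`; the degree condition is regularity at infinity. -/
def HasOnlySimplePolesIn (P : Set ℂ) (f : RatFunc ℂ) : Prop :=
  (∀ z ∈ P, f.denom.rootMultiplicity z ≤ 1) ∧
  (∀ z ∉ P, f.denom.rootMultiplicity z = 0) ∧
  f.num.natDegree ≤ f.denom.natDegree

theorem hasOnlySimplePolesIn_iff (P : Set ℂ) (f : RatFunc ℂ) :
    HasOnlySimplePolesIn P f ↔ ∃ S : Finset ℂ, (S : Set ℂ) ⊆ P ∧ ∃ p : ℂ[X],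
      p.natDegree ≤ S.card ∧
      f * algebraMap ℂ[X] (RatFunc ℂ) (∏ s ∈ S, (X - C s)) = algebraMap ℂ[X] (RatFunc ℂ) p := by
  classical
  constructor
  · rintro ⟨h1, h2, h3⟩
    have hle : ∀ z, f.denom.rootMultiplicity z ≤ 1 := fun z => by
      by_cases hz : z ∈ P
      · exact h1 z hz
      · exact (h2 z hz).le.trans zero_le_one
    have hsp : f.denom.Splits := IsAlgClosed.splits _
    have hnd : f.denom.roots.Nodup := by
      rw [Multiset.nodup_iff_count_le_one]
      intro z
      rw [count_roots]
      exact hle z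
    have hprod : (∏ s ∈ f.denom.roots.toFinset, (X - C s)) = f.denom := by
      have := hsp.eq_prod_roots_of_monic (RatFunc.monic_denom f)
      rw [Finset.prod_eq_multiset_prod, Multiset.toFinset_val, hnd.dedup]
      exact this.symm
    refine ⟨f.denom.roots.toFinset, ?_, f.num, ?_, ?_⟩
    · intro z hz
      by_contra hzP
      have hz' : z ∈ f.denom.roots := by simpa using hz
      have := Multiset.count_pos.2 hz'
      rw [count_roots, h2 z hzP] at this
      exact lt_irrefl _ this
    · rw [Multiset.toFinset_card_of_nodup hnd, ← hsp.natDegree_eq_card_roots]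
      exact h3
    · rw [hprod]
      have hd : algebraMap ℂ[X] (RatFunc ℂ) f.denom ≠ 0 :=
        RatFunc.algebraMap_ne_zero f.denom_ne_zero
      conv_lhs => rw [← RatFunc.num_div_denom f]
      rw [RatFunc.num_div_denom, ← eq_div_iff hd, RatFunc.num_div_denom]
  · rintro ⟨S, hS, p, hp, hf⟩
    set D : ℂ[X] := ∏ s ∈ S, (X - C s) with hD
    have hDmon : D.Monic := monic_prod_of_monic _ _ fun s _ => monic_X_sub_C s
    have hD0 : D ≠ 0 := hDmon.ne_zero
    have hDdeg : D.natDegree = S.card := by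
      rw [hD, natDegree_prod_of_monic _ _ fun s _ => monic_X_sub_C s]
      simp
    have hDa : algebraMap ℂ[X] (RatFunc ℂ) D ≠ 0 := RatFunc.algebraMap_ne_zero hD0
    have hf' : f = algebraMap ℂ[X] (RatFunc ℂ) p / algebraMap ℂ[X] (RatFunc ℂ) D :=
      (eq_div_iff hDa).2 hf
    have hdvd : f.denom ∣ D := by rw [hf']; exact RatFunc.denom_div_dvd p D
    have hroots : D.roots = S.val := by
      rw [hD, roots_prod_X_sub_C]
    have hmul : ∀ z, f.denom.rootMultiplicity z ≤ S.val.count z := fun z => by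
      rw [← hroots, count_roots]
      exact rootMultiplicity_le_rootMultiplicity_of_dvd hD0 hdvd z
    refine ⟨fun z _ => (hmul z).trans (Multiset.nodup_iff_count_le_one.1 S.nodup z),
      fun z hz => ?_, ?_⟩
    · have h0 : S.val.count z = 0 := Multiset.count_eq_zero.2 fun h => hz (hS h)
      exact Nat.le_zero.1 (h0 ▸ hmul z)
    · have hcross : f.num * D = p * f.denom := by
        have hd : algebraMap ℂ[X] (RatFunc ℂ) f.denom ≠ 0 :=
          RatFunc.algebraMap_ne_zero f.denom_ne_zero
        apply RatFunc.algebraMap_injective ℂ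
        rw [map_mul, map_mul, ← hf, mul_right_comm]
        congr 1
        exact ((div_eq_iff hd).1 (RatFunc.num_div_denom f))
      by_cases hn : f.num = 0
      · simp [hn]
      · have hp0 : p ≠ 0 := by
          rintro rfl
          rw [zero_mul] at hcross
          exact (mul_ne_zero hn hD0) hcross
        have := congrArg natDegree hcross
        rw [natDegree_mul hn hD0, natDegree_mul hp0 f.denom_ne_zero] at this
        omega

/-- The space `W` of rational functions that are regular everywhere (including at infinity) except
for possible single poles at `poleSet q a b`. -/
def W (q : ℂ) (a b : Fin 3 → ℂ) : Submodule ℂ (RatFunc ℂ) where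
  carrier := {f | HasOnlySimplePolesIn (poleSet q a b) f}
  zero_mem' := (hasOnlySimplePolesIn_iff _ _).2 ⟨∅, by simp, 0, by simp, by simp⟩
  add_mem' := by
    classical
    intro f g hf hg
    obtain ⟨S, hS, p, hp, hfp⟩ := (hasOnlySimplePolesIn_iff _ _).1 hf
    obtain ⟨T, hT, r, hr, hgr⟩ := (hasOnlySimplePolesIn_iff _ _).1 hg
    refine (hasOnlySimplePolesIn_iff _ _).2 ⟨S ∪ T, ?_,
      p * (∏ s ∈ T \ S, (X - C s)) + r * (∏ s ∈ S \ T, (X - C s)), ?_, ?_⟩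
    · rw [Finset.coe_union]
      exact Set.union_subset hS hT
    · have key : ∀ U : Finset ℂ, (∏ s ∈ U, (X - C s) : ℂ[X]).natDegree = U.card := fun U => by
        rw [natDegree_prod_of_monic _ _ fun s _ => monic_X_sub_C s]
        simp
      refine (natDegree_add_le _ _).trans (max_le ?_ ?_)
      · refine natDegree_mul_le.trans ?_
        rw [key, ← Finset.union_sdiff_self_eq_union, Finset.card_union_of_disjoint
          Finset.disjoint_sdiff]
        omega
      · refine natDegree_mul_le.trans ?_
        rw [key, Finset.union_comm, ← Finset.union_sdiff_self_eq_union,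
          Finset.card_union_of_disjoint Finset.disjoint_sdiff]
        omega
    · have e1 : (∏ s ∈ S ∪ T, (X - C s) : ℂ[X])
          = (∏ s ∈ S, (X - C s)) * ∏ s ∈ T \ S, (X - C s) := by
        rw [← Finset.union_sdiff_self_eq_union, Finset.prod_union Finset.disjoint_sdiff]
      have e2 : (∏ s ∈ S ∪ T, (X - C s) : ℂ[X])
          = (∏ s ∈ T, (X - C s)) * ∏ s ∈ S \ T, (X - C s) := by
        rw [Finset.union_comm, ← Finset.union_sdiff_self_eq_union,
          Finset.prod_union Finset.disjoint_sdiff]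
      rw [add_mul, map_add, map_mul, map_mul, ← hfp, ← hgr]
      nth_rewrite 1 [e1]
      rw [e2, map_mul, map_mul, mul_assoc, mul_assoc]
  smul_mem' := by
    intro c f hf
    obtain ⟨S, hS, p, hp, hfp⟩ := (hasOnlySimplePolesIn_iff _ _).1 hf
    refine (hasOnlySimplePolesIn_iff _ _).2 ⟨S, hS, C c * p, (natDegree_C_mul_le c p).trans hp, ?_⟩
    rw [map_mul, ← hfp, RatFunc.algebraMap_C, RatFunc.smul_eq_C_mul, mul_assoc]

/-- The rational function `z ^ (-T) ∏_j (a_j z)_{k_j} (b_j / z)_{l_j}`, where `T = ∑_j k_j`. -/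
def spanFun (q : ℂ) (a b : Fin 3 → ℂ) (k l : Fin 3 → ℤ) : RatFunc ℂ :=
  RatFunc.X ^ (-∑ j, k j) *
    ∏ j, qPoch (RatFunc.C q) (RatFunc.C (a j) * RatFunc.X) (k j) *
      qPoch (RatFunc.C q) (RatFunc.C (b j) / RatFunc.X) (l j)

/-- The value of the Al-Salam--Ismail functional on `spanFun q a b k l`; here `t = a_1 a_2 a_3` and
`T = ∑_j k_j`. -/
def spanValue (q : ℂ) (a b : Fin 3 → ℂ) (k l : Fin 3 → ℤ) : ℂ :=
  ((-∏ j, a j) ^ (∑ j, k j) * q ^ choose2 (∑ j, k j) *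
      ∏ i, ∏ j, qPoch q (a i * b j) (k i + l j)) /
    ∏ j, q ^ (choose2 (k j) + choose2 (l j)) * a j ^ k j * b j ^ l j

/-- `K` is the Al-Salam--Ismail functional: the functions `spanFun q a b k l` with
`∑ k_j = - ∑ l_j` are in `W`, and `K` takes the prescribed values on them. -/
def IsAlSalamIsmailFunctional (q : ℂ) (a b : Fin 3 → ℂ) (K : W q a b →ₗ[ℂ] ℂ) : Prop :=
  ∀ k l : Fin 3 → ℤ, ∑ j, k j = -∑ j, l j →
    ∃ h : spanFun q a b k l ∈ W q a b, K ⟨spanFun q a b k l, h⟩ = spanValue q a b k l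

/-- The balancing condition `a_1 a_2 a_3 b_1 b_2 b_3 = q` and genericity of the parameters. -/
structure GenericParameters (q : ℂ) (a b : Fin 3 → ℂ) : Prop where
  balance : (∏ j, a j) * ∏ j, b j = q
  a_div_a : ∀ i j, i ≠ j → ∀ m : ℤ, a i / a j ≠ q ^ m
  b_div_b : ∀ i j, i ≠ j → ∀ m : ℤ, b i / b j ≠ q ^ m
  a_mul_b : ∀ i j, ∀ m : ℤ, a i * b j ≠ q ^ m

/-- Genericity of `λ_1, λ_2, λ_3`: they are nonzero, no admissible pole and no zero of a
denominator is met. There is no balancing condition. -/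
structure GenericNodes (q : ℂ) (a b lam : Fin 3 → ℂ) : Prop where
  ne_zero : ∀ k, lam k ≠ 0
  lam_div_lam : ∀ i j, i ≠ j → ∀ m : ℤ, lam i / lam j ≠ q ^ m
  t_mul_lam : ∀ m : ℤ, (∏ j, a j) * ∏ k, lam k ≠ q ^ m
  a_mul_lam : ∀ j k, ∀ m : ℤ, a j * lam k ≠ q ^ m
  lam_div_b : ∀ j k, ∀ m : ℤ, lam k / b j ≠ q ^ m

/-- The constant `C`; `t = a_1 a_2 a_3`. -/
def coeffC (q : ℂ) (a b lam : Fin 3 → ℂ) : ℂ :=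
  (∏ k, lam k) /
    (qPochInf q q * qTheta q ((∏ j, a j) * ∏ k, lam k) *
      (∏ i, ∏ j, qPochInf q (q / (a i * b j))) *
      ∏ i, ∏ j ∈ Finset.Ioi i, lam j * qTheta q (lam i / lam j))

/-- The coefficient `X_k`; the indices `k + 1`, `k + 2` are cyclic, modulo `3`. -/
def coeffX (q : ℂ) (a b lam : Fin 3 → ℂ) (k : Fin 3) : ℂ :=
  (∏ j, qPochInf q (q / (a j * lam k)) * qPochInf q (q * lam k / b j)) *
    (lam (k + 1) / lam (k + 2) *
        ∏ j, qTheta q (a j * lam (k + 2)) * qTheta q (b j / lam (k + 1)) -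
      lam (k + 2) / lam (k + 1) *
        ∏ j, qTheta q (a j * lam (k + 1)) * qTheta q (b j / lam (k + 2)))

/-- The term `q ^ x g(μ q ^ x) ∏_j (a_j μ)_x / (q μ / b_j)_x` of the bilateral sum. -/
def sumTerm (q : ℂ) (a b : Fin 3 → ℂ) (g : RatFunc ℂ) (μ : ℂ) (x : ℤ) : ℂ :=
  q ^ x * g.eval (RingHom.id ℂ) (μ * q ^ x) *
    ∏ j, qPoch q (a j * μ) x / qPoch q (q * μ / b j) x

end QSeries

end

namespace QSeries

open Filter Topology Polynomial

/-! ### The finite `q`-shifted factorial -/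

/-! The combination of bilateral series is itself shown to have the prescribed values, so no
consistency check between those values is needed. Three facts carry the proof.

(1) The formula for `g = 1`. Multiplying the bilateral series at `z` by `∏ (q/a_j z)_∞ (qz/b_j)_∞`
gives a function `G` holomorphic on `ℂ \ {0}` (`gSum`). By the balancing condition, `z G(z)`, `A(z)
= ∏ θ(a_j z)` and `z² B(z) = z² ∏ θ(b_j/z)` all satisfy `f(zq) = -(t z³)⁻¹ f(z)`. The sum `∑ X_k
(…)` is, up to the factor `λ_1 λ_2 λ_3`, the cofactor expansion of the 3 × 3 determinant of these
functions at the three nodes. An antisymmetric theta function of this kind must be a multiple of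
`θ(tλ_1λ_2λ_3) ∏ λ_j θ(λ_i/λ_j)`. The constant is found at the nodes `b_1`, `b_2`, where `B`
vanishes and the bilateral series become unilateral: what remains is the nonterminating
`q`-Saalschütz sum (`uComb_eq`). That sum is proved by iterating a contiguous relation and passing
to the limit by dominated convergence. The outcome is `detDefect_eq_zero`, hence
`coeffC_mul_sum_one`.

(2) Shifting parameters. On the lattice `μ q^x`, the function `∏ (a_j z)_{k_j} (b_j/z)_{l_j} z^(-T)`
times the weight for `(a, b)` is a multiple of the weight for `(a_j q^{k_j}, b_j q^{l_j})`, which is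
again balanced and generic (`sumTerm_spanFun`). The formula for `g = 1` with shifted parameters
therefore evaluates the series on every such function, and the prefactors combine to the prescribed
value (`coeffC_mul_shift`).

(3) These functions span `W`. By partial fractions it suffices to reach each `1/(z - s)` with `s` an
admissible pole. Taking `k = -m e_j + m e_{j+1}`, `l = 0` gives a function with genuine poles
exactly at `a_j⁻¹ q^n`, `1 ≤ n ≤ m`, so the system is triangular; the poles `b_j q^(-n)` are treated
in the same way (`W_le_spanW`).

By (3) the functional is unique. By (1) and (2) the series at any generic nodes realize it; generic
nodes exist because only countably many values are excluded, and uniqueness makes the functional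
independent of the nodes. -/

theorem choose2_zero : choose2 0 = 0 := by simp [choose2]

theorem choose2_add_one (k : ℤ) : choose2 (k + 1) = choose2 k + k := by
  unfold choose2
  rw [show (k + 1) * (k + 1 - 1) = k * (k - 1) + k * 2 by ring, Int.add_mul_ediv_right _ _ two_ne_zero]

theorem two_mul_choose2 (k : ℤ) : 2 * choose2 k = k * (k - 1) := by
  unfold choose2
  refine Int.mul_ediv_cancel' ?_
  have := Int.even_mul_succ_self (k - 1)
  rw [sub_add_cancel, mul_comm] at this
  exact this.two_dvd

theorem choose2_add (m n : ℤ) : choose2 (m + n) = choose2 m + choose2 n + m * n := by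
  have h1 := two_mul_choose2 m
  have h2 := two_mul_choose2 n
  have h3 := two_mul_choose2 (m + n)
  nlinarith

section Field

variable {F : Type*} [Field F] {q a : F}

theorem qPoch_natCast (q a : F) (n : ℕ) :
    qPoch q a n = ∏ i ∈ Finset.range n, (1 - a * q ^ i) := rfl

@[simp]
theorem qPoch_zero (q a : F) : qPoch q a 0 = 1 := by
  simpa using qPoch_natCast q a 0

theorem qPoch_natCast_succ (q a : F) (n : ℕ) :
    qPoch q a ((n : ℤ) + 1) = qPoch q a n * (1 - a * q ^ n) := by
  rw [← Nat.cast_succ, qPoch_natCast, qPoch_natCast, Finset.prod_range_succ]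

theorem qPoch_natCast_succ' (q a : F) (n : ℕ) :
    qPoch q a ((n : ℤ) + 1) = (1 - a) * qPoch q (a * q) n := by
  rw [← Nat.cast_succ, qPoch_natCast, qPoch_natCast, Finset.prod_range_succ']
  rw [mul_comm, pow_zero, mul_one]
  congr 1
  exact Finset.prod_congr rfl fun i _ => by ring

theorem qPoch_neg_natCast (q a : F) (n : ℕ) :
    qPoch q a (-(n : ℤ)) = (∏ i ∈ Finset.range n, (1 - a * (q ^ (i + 1))⁻¹))⁻¹ := by
  cases n with
  | zero => simp
  | succ n => rfl

/-- For `k < 0` the factor `1 - a q ^ k` is one of those inverted in `(a)_k`. The hypothesis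
excludes the convention `0⁻¹ = 0`, under which the recursion fails. -/
theorem qPoch_add_one (k : ℤ) (h : 1 - a * q ^ k ≠ 0) :
    qPoch q a (k + 1) = qPoch q a k * (1 - a * q ^ k) := by
  obtain ⟨n, rfl | rfl⟩ := k.eq_nat_or_neg
  · rw [qPoch_natCast_succ, zpow_natCast]
  · cases n with
    | zero => simpa using qPoch_natCast_succ q a 0
    | succ n =>
      have e : -((n + 1 : ℕ) : ℤ) + 1 = -(n : ℤ) := by push_cast; ring
      rw [e, qPoch_neg_natCast, qPoch_neg_natCast, Finset.prod_range_succ, mul_inv, mul_assoc,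
        zpow_neg, zpow_natCast, inv_mul_cancel₀, mul_one]
      rwa [zpow_neg, zpow_natCast] at h

theorem one_sub_mul_zpow_ne_zero (h : ∀ m : ℤ, a ≠ q ^ m) (k : ℤ) :
    1 - a * q ^ k ≠ 0 := by
  intro e
  refine h (-k) ?_
  rw [zpow_neg]
  exact eq_inv_of_mul_eq_one_left (sub_eq_zero.1 e).symm

theorem mul_zpow_ne_zpow (hq : q ≠ 0) (h : ∀ m : ℤ, a ≠ q ^ m) (k m : ℤ) : a * q ^ k ≠ q ^ m := by
  intro e
  refine h (m - k) ?_
  rw [zpow_sub₀ hq, ← e, mul_div_cancel_right₀ _ (zpow_ne_zero _ hq)]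

theorem qPoch_ne_zero (h : ∀ m : ℤ, a ≠ q ^ m) (k : ℤ) : qPoch q a k ≠ 0 := by
  obtain ⟨n, rfl | rfl⟩ := k.eq_nat_or_neg
  · rw [qPoch_natCast, Finset.prod_ne_zero_iff]
    intro i _
    simpa using one_sub_mul_zpow_ne_zero h i
  · rw [qPoch_neg_natCast]
    refine inv_ne_zero (Finset.prod_ne_zero_iff.2 fun i _ => ?_)
    have := one_sub_mul_zpow_ne_zero h (-((i + 1 : ℕ) : ℤ))
    rwa [zpow_neg, zpow_natCast] at this

/-- A function on `ℤ` is determined by its value at `0` and its successive ratios. -/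
theorem int_eq_of_ratio {f g r : ℤ → F} (h0 : f 0 = g 0) (hr : ∀ k, r k ≠ 0)
    (hf : ∀ k, f (k + 1) = f k * r k) (hg : ∀ k, g (k + 1) = g k * r k) (k : ℤ) : f k = g k := by
  induction k using Int.induction_on with
  | zero => exact h0
  | succ n ih => rw [hf, hg, ih]
  | pred n ih =>
    have h1 := hf (-(n : ℤ) - 1)
    have h2 := hg (-(n : ℤ) - 1)
    rw [sub_add_cancel] at h1 h2
    exact mul_right_cancel₀ (hr (-(n : ℤ) - 1)) (by rw [← h1, ← h2, ih])

theorem qPoch_add (hq : q ≠ 0) (h : ∀ m : ℤ, a ≠ q ^ m) (m n : ℤ) :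
    qPoch q a (m + n) = qPoch q a m * qPoch q (a * q ^ m) n := by
  refine int_eq_of_ratio (f := fun n => qPoch q a (m + n))
    (g := fun n => qPoch q a m * qPoch q (a * q ^ m) n)
    (r := fun n => 1 - a * q ^ (m + n)) (by simp)
    (fun k => one_sub_mul_zpow_ne_zero h _) (fun k => ?_) (fun k => ?_) n
  · rw [← add_assoc, qPoch_add_one _ (one_sub_mul_zpow_ne_zero h _)]
  · rw [qPoch_add_one _ (one_sub_mul_zpow_ne_zero (mul_zpow_ne_zpow hq h m) _), mul_assoc,
      mul_assoc, zpow_add₀ hq]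

end Field

/-! ### The infinite product -/

variable {q : ℂ}

theorem summable_mul_pow (hq1 : ‖q‖ < 1) (a : ℂ) : Summable fun j : ℕ => ‖-(a * q ^ j)‖ := by
  simpa [norm_mul, norm_pow] using (summable_geometric_of_lt_one (norm_nonneg q) hq1).mul_left ‖a‖

theorem multipliable_qPochInf (hq1 : ‖q‖ < 1) (a : ℂ) :
    Multipliable fun j : ℕ => 1 - a * q ^ j := by
  simpa [sub_eq_add_neg] using multipliable_one_add_of_summable (summable_mul_pow hq1 a)

theorem tendsto_prod_qPochInf (hq1 : ‖q‖ < 1) (a : ℂ) :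
    Tendsto (fun n : ℕ => ∏ i ∈ Finset.range n, (1 - a * q ^ i)) atTop (𝓝 (qPochInf q a)) :=
  (multipliable_qPochInf hq1 a).hasProd.tendsto_prod_nat

theorem qPochInf_ne_zero (hq1 : ‖q‖ < 1) {a : ℂ} (h : ∀ n : ℕ, 1 - a * q ^ n ≠ 0) :
    qPochInf q a ≠ 0 := by
  have := tprod_one_add_ne_zero_of_summable (f := fun j : ℕ => -(a * q ^ j))
    (fun i => by simpa [sub_eq_add_neg] using h i) (summable_mul_pow hq1 a)
  simpa [qPochInf, sub_eq_add_neg] using this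

theorem qPochInf_eq_prod_mul (hq1 : ‖q‖ < 1) (a : ℂ) (n : ℕ) :
    qPochInf q a = (∏ i ∈ Finset.range n, (1 - a * q ^ i)) * qPochInf q (a * q ^ n) := by
  have h1 := (tendsto_prod_qPochInf hq1 a).comp (tendsto_add_atTop_nat n)
  have h2 := (tendsto_prod_qPochInf hq1 (a * q ^ n)).const_mul
    (∏ i ∈ Finset.range n, (1 - a * q ^ i))
  refine tendsto_nhds_unique h1 (h2.congr fun k => ?_)
  simp only [Function.comp_apply]
  rw [add_comm k n, Finset.prod_range_add]
  congr 1
  exact Finset.prod_congr rfl fun i _ => by ring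

theorem qPochInf_eq_qPoch_mul_nat (hq1 : ‖q‖ < 1) (a : ℂ) (n : ℕ) :
    qPochInf q a = qPoch q a n * qPochInf q (a * q ^ n) := qPochInf_eq_prod_mul hq1 a n

theorem qPochInf_succ (hq1 : ‖q‖ < 1) (a : ℂ) :
    qPochInf q a = (1 - a) * qPochInf q (a * q) := by
  simpa using qPochInf_eq_prod_mul hq1 a 1

theorem qPochInf_one (hq1 : ‖q‖ < 1) : qPochInf q 1 = 0 := by
  rw [qPochInf_succ hq1]; simp

theorem qPochInf_zero (q : ℂ) : qPochInf q 0 = 1 := by simp [qPochInf]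

theorem qPochInf_eq_zero_iff (hq1 : ‖q‖ < 1) {a : ℂ} :
    qPochInf q a = 0 ↔ ∃ n : ℕ, a * q ^ n = 1 := by
  constructor
  · intro h
    by_contra! hn
    exact qPochInf_ne_zero hq1 (fun n e => hn n (sub_eq_zero.1 e).symm) h
  · rintro ⟨n, hn⟩
    rw [qPochInf_eq_prod_mul hq1 a (n + 1), Finset.prod_range_succ, hn]
    simp

theorem qPochInf_ne_zero' (hq1 : ‖q‖ < 1) {a : ℂ} (h : ∀ m : ℤ, a ≠ q ^ m) :
    qPochInf q a ≠ 0 :=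
  qPochInf_ne_zero hq1 fun n => by simpa using one_sub_mul_zpow_ne_zero h n

theorem qPochInf_self_ne_zero (hq1 : ‖q‖ < 1) : qPochInf q q ≠ 0 := by
  refine qPochInf_ne_zero hq1 fun n e => ?_
  have h : ‖q ^ (n + 1)‖ = 1 := by
    rw [pow_succ', ← sub_eq_zero.1 e, norm_one]
  rw [norm_pow] at h
  exact (pow_lt_one₀ (norm_nonneg q) hq1 n.succ_ne_zero).ne h

/-- For `k = -n` this is the natural case at base point `a q ^ (-n)`, since `(a)_{-n} (a q ^ (-n))_n
= (a)_0 = 1`. -/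
theorem qPochInf_eq_qPoch_mul (hq0 : q ≠ 0) (hq1 : ‖q‖ < 1) {a : ℂ} (h : ∀ m : ℤ, a ≠ q ^ m)
    (k : ℤ) : qPochInf q a = qPoch q a k * qPochInf q (a * q ^ k) := by
  obtain ⟨n, rfl | rfl⟩ := k.eq_nat_or_neg
  · rw [zpow_natCast]; exact qPochInf_eq_qPoch_mul_nat hq1 a n
  · have e := qPochInf_eq_qPoch_mul_nat hq1 (a * q ^ (-(n : ℤ))) n
    have e2 := qPoch_add hq0 h (-(n : ℤ)) n
    rw [neg_add_cancel, qPoch_zero] at e2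
    have e3 : a * q ^ (-(n : ℤ)) * q ^ n = a := by
      rw [zpow_neg, zpow_natCast, mul_assoc, inv_mul_cancel₀ (pow_ne_zero _ hq0), mul_one]
    rw [e, e3, ← mul_assoc, ← e2, one_mul]

/-- A bound for the partial products of `(a)_∞` with `‖a‖ ≤ R`. -/
noncomputable def qBound (q : ℂ) (R : ℝ) : ℝ := Real.exp (R * (1 - ‖q‖)⁻¹)

theorem qBound_pos (q : ℂ) (R : ℝ) : 0 < qBound q R := Real.exp_pos _

/-- By `1 + x ≤ exp x` and the geometric series. The bound is independent of `n`; it supplies the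
domination in every later limit and sum. -/
theorem prod_one_add_le_qBound (hq1 : ‖q‖ < 1) {R : ℝ} (h0 : 0 ≤ R) (n : ℕ) :
    ∏ i ∈ Finset.range n, (1 + R * ‖q‖ ^ i) ≤ qBound q R := by
  calc ∏ i ∈ Finset.range n, (1 + R * ‖q‖ ^ i)
      ≤ ∏ i ∈ Finset.range n, Real.exp (R * ‖q‖ ^ i) := by
        refine Finset.prod_le_prod (fun _ _ => by positivity) fun i _ => ?_
        rw [add_comm]
        exact Real.add_one_le_exp _
    _ = Real.exp (R * ∑ i ∈ Finset.range n, ‖q‖ ^ i) := by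
        rw [← Real.exp_sum, Finset.mul_sum]
    _ ≤ _ := by
        refine Real.exp_le_exp.2 (mul_le_mul_of_nonneg_left ?_ h0)
        rw [← tsum_geometric_of_lt_one (norm_nonneg q) hq1]
        exact (summable_geometric_of_lt_one (norm_nonneg q) hq1).sum_le_tsum _
          fun i _ => pow_nonneg (norm_nonneg q) i

theorem norm_prod_le_qBound (hq1 : ‖q‖ < 1) {a : ℂ} {R : ℝ} (ha : ‖a‖ ≤ R) (n : ℕ) :
    ‖∏ i ∈ Finset.range n, (1 - a * q ^ i)‖ ≤ qBound q R := by
  refine le_trans ?_ (prod_one_add_le_qBound hq1 ((norm_nonneg a).trans ha) n)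
  rw [norm_prod]
  refine Finset.prod_le_prod (fun _ _ => norm_nonneg _) fun i _ => ?_
  refine (norm_sub_le _ _).trans ?_
  rw [norm_one, norm_mul, norm_pow]
  gcongr

theorem norm_qPoch_le_qBound (hq1 : ‖q‖ < 1) {a : ℂ} {R : ℝ} (ha : ‖a‖ ≤ R) (n : ℕ) :
    ‖qPoch q a n‖ ≤ qBound q R := norm_prod_le_qBound hq1 ha n

theorem norm_qPochInf_le_qBound (hq1 : ‖q‖ < 1) {a : ℂ} {R : ℝ} (ha : ‖a‖ ≤ R) :
    ‖qPochInf q a‖ ≤ qBound q R :=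
  le_of_tendsto' (tendsto_prod_qPochInf hq1 a).norm fun n => norm_prod_le_qBound hq1 ha n

/-- The partial products converge locally uniformly on the ball of radius `‖a‖ + 1`, the factors
there being `1 + O(‖q‖ ^ n)`. -/
theorem differentiable_qPochInf (hq1 : ‖q‖ < 1) : Differentiable ℂ (qPochInf q) := by
  intro a
  have hu : Summable fun n : ℕ => (‖a‖ + 1) * ‖q‖ ^ n :=
    (summable_geometric_of_lt_one (norm_nonneg q) hq1).mul_left _
  have hlu := hu.hasProdLocallyUniformlyOn_nat_one_add (f := fun (n : ℕ) (x : ℂ) => -(x * q ^ n))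
    (K := Metric.ball 0 (‖a‖ + 1)) Metric.isOpen_ball
    (.of_forall fun n x hx => by
      rw [norm_neg, norm_mul, norm_pow]
      have : ‖x‖ ≤ ‖a‖ + 1 := by simpa using (Metric.mem_ball.1 hx).le
      gcongr)
    (fun n => by fun_prop)
  have hd := hlu.differentiableOn
    (.of_forall fun s => by
      simpa [Finset.prod_fn] using DifferentiableOn.finsetProd (fun _ _ => by fun_prop))
    Metric.isOpen_ball
  have := hd.differentiableAt (Metric.isOpen_ball.mem_nhds (by simp : a ∈ Metric.ball 0 (‖a‖ + 1)))
  refine this.congr_of_eventuallyEq (.of_forall fun x => ?_)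
  simp [qPochInf, sub_eq_add_neg]

theorem continuous_qPochInf (hq1 : ‖q‖ < 1) : Continuous (qPochInf q) :=
  (differentiable_qPochInf hq1).continuous

theorem tendsto_qPochInf_mul_pow (hq1 : ‖q‖ < 1) (a : ℂ) :
    Tendsto (fun n : ℕ => qPochInf q (a * q ^ n)) atTop (𝓝 1) := by
  have h : Tendsto (fun n : ℕ => a * q ^ n) atTop (𝓝 0) := by
    simpa using (tendsto_pow_atTop_nhds_zero_of_norm_lt_one hq1).const_mul a
  have := ((continuous_qPochInf hq1).tendsto 0).comp h
  rwa [qPochInf_zero] at this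

/-! ### The theta function -/

theorem differentiableOn_qTheta (hq1 : ‖q‖ < 1) : DifferentiableOn ℂ (qTheta q) {0}ᶜ := by
  intro x hx
  have hx' : x ≠ 0 := hx
  refine DifferentiableAt.differentiableWithinAt ?_
  refine (differentiable_qPochInf hq1 x).mul ?_
  exact (differentiable_qPochInf hq1 _).comp x ((differentiableAt_const q).div differentiableAt_id hx')

theorem qTheta_q_div (hq0 : q ≠ 0) (x : ℂ) : qTheta q (q / x) = qTheta q x := by
  unfold qTheta
  rw [div_div_cancel₀ hq0, mul_comm]

theorem qTheta_mul_q (hq0 : q ≠ 0) (hq1 : ‖q‖ < 1) {x : ℂ} (hx : x ≠ 0) :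
    qTheta q (x * q) = -x⁻¹ * qTheta q x := by
  unfold qTheta
  have e : q / (x * q) = x⁻¹ := by field_simp
  rw [e, qPochInf_succ hq1 x, qPochInf_succ hq1 x⁻¹, show x⁻¹ * q = q / x by ring]
  field_simp
  ring

theorem qTheta_inv (hq0 : q ≠ 0) (hq1 : ‖q‖ < 1) {x : ℂ} (hx : x ≠ 0) :
    qTheta q x⁻¹ = -x⁻¹ * qTheta q x := by
  rw [← qTheta_mul_q hq0 hq1 hx, ← qTheta_q_div hq0 (x * q)]
  congr 1
  field_simp

theorem qTheta_mul_zpow (hq0 : q ≠ 0) (hq1 : ‖q‖ < 1) {x : ℂ} (hx : x ≠ 0) (k : ℤ) :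
    qTheta q (x * q ^ k) = (-x) ^ (-k) * q ^ (-choose2 k) * qTheta q x := by
  have hx' : -x ≠ 0 := neg_ne_zero.2 hx
  refine int_eq_of_ratio (f := fun k => qTheta q (x * q ^ k))
    (g := fun k => (-x) ^ (-k) * q ^ (-choose2 k) * qTheta q x)
    (r := fun k => -(x * q ^ k)⁻¹) (by simp [choose2_zero])
    (fun k => neg_ne_zero.2 (inv_ne_zero (mul_ne_zero hx (zpow_ne_zero _ hq0))))
    (fun k => ?_) (fun k => ?_) k
  · rw [zpow_add_one₀ hq0, ← mul_assoc, qTheta_mul_q hq0 hq1 (mul_ne_zero hx (zpow_ne_zero _ hq0)),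
      mul_comm]
  · rw [choose2_add_one, neg_add, neg_add, zpow_add₀ hx', zpow_add₀ hq0, zpow_neg_one, mul_inv,
      ← zpow_neg, inv_neg]
    ring

theorem qTheta_eq_zero_iff (hq0 : q ≠ 0) (hq1 : ‖q‖ < 1) {x : ℂ} (hx : x ≠ 0) :
    qTheta q x = 0 ↔ ∃ m : ℤ, x = q ^ m := by
  constructor
  · intro h
    rcases mul_eq_zero.1 h with h | h
    · obtain ⟨n, hn⟩ := (qPochInf_eq_zero_iff hq1).1 h
      refine ⟨-n, ?_⟩
      rw [zpow_neg, zpow_natCast]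
      exact eq_inv_of_mul_eq_one_left hn
    · obtain ⟨n, hn⟩ := (qPochInf_eq_zero_iff hq1).1 h
      refine ⟨n + 1, ?_⟩
      rw [zpow_add_one₀ hq0, zpow_natCast]
      field_simp at hn
      rw [← hn, mul_comm]
  · rintro ⟨m, rfl⟩
    have := qTheta_mul_zpow hq0 hq1 one_ne_zero m
    rw [one_mul] at this
    rw [this]
    simp [qTheta, qPochInf_one hq1]

theorem qTheta_ne_zero (hq0 : q ≠ 0) (hq1 : ‖q‖ < 1) {x : ℂ} (hx : x ≠ 0)
    (h : ∀ m : ℤ, x ≠ q ^ m) : qTheta q x ≠ 0 := fun e => by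
  obtain ⟨m, hm⟩ := (qTheta_eq_zero_iff hq0 hq1 hx).1 e
  exact h m hm

/-- Reflection of the shifted factorial through `q / x`. -/
theorem qPoch_mul_qPochInf_div (hq0 : q ≠ 0) (hq1 : ‖q‖ < 1) {x : ℂ} (hx : x ≠ 0)
    (h : ∀ m : ℤ, x ≠ q ^ m) (k : ℤ) :
    qPoch q x k * qPochInf q (q / x) =
      (-x) ^ k * q ^ choose2 k * qPochInf q (q / (x * q ^ k)) := by
  have hx' : -x ≠ 0 := neg_ne_zero.2 hx
  have e1 := qPochInf_eq_qPoch_mul hq0 hq1 h k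
  have e2 := qTheta_mul_zpow hq0 hq1 hx k
  unfold qTheta at e2
  have hne : qPochInf q (x * q ^ k) ≠ 0 :=
    qPochInf_ne_zero' hq1 (mul_zpow_ne_zpow hq0 h k)
  rw [e1, zpow_neg, zpow_neg] at e2
  have h1 := zpow_ne_zero k hx'
  have h2 := zpow_ne_zero (choose2 k) hq0
  refine mul_left_cancel₀ hne ?_
  rw [show qPochInf q (x * q ^ k) * ((-x) ^ k * q ^ choose2 k * qPochInf q (q / (x * q ^ k))) =
    (-x) ^ k * q ^ choose2 k * (qPochInf q (x * q ^ k) * qPochInf q (q / (x * q ^ k))) by ring, e2]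
  field_simp

end QSeries

namespace QSeries

open Filter Topology Polynomial

/-! ### Holomorphic functions on the punctured plane -/

/-- Division of holomorphic functions, the divisor having simple zeros. -/
theorem exists_differentiableOn_mul_eq {f g : ℂ → ℂ} {U : Set ℂ} (hU : IsOpen U)
    (hf : DifferentiableOn ℂ f U) (hg : DifferentiableOn ℂ g U)
    (h : ∀ z ∈ U, g z = 0 → f z = 0 ∧ deriv g z ≠ 0) :
    ∃ P : ℂ → ℂ, DifferentiableOn ℂ P U ∧ ∀ z ∈ U, f z = P z * g z := by
  classical
  -- At a zero of `g` the value `f' / g'` is the quotient of the difference quotients `dslope f z`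
  -- and `dslope g z`, which are holomorphic, the second being nonzero at `z`.
  refine ⟨fun z => if g z = 0 then deriv f z / deriv g z else f z / g z, ?_, ?_⟩
  · intro z hz
    refine DifferentiableAt.differentiableWithinAt ?_
    have hUz := hU.mem_nhds hz
    by_cases hgz : g z = 0
    · obtain ⟨hfz, hd⟩ := h z hz hgz
      have df : DifferentiableAt ℂ (dslope f z) z :=
        ((Complex.differentiableOn_dslope hUz).2 hf).differentiableAt hUz
      have dg : DifferentiableAt ℂ (dslope g z) z :=
        ((Complex.differentiableOn_dslope hUz).2 hg).differentiableAt hUz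
      have hne : dslope g z z ≠ 0 := by rwa [dslope_same]
      refine (df.div dg hne).congr_of_eventuallyEq ?_
      filter_upwards [dg.continuousAt.eventually_ne hne] with w hw
      have ef := sub_smul_dslope f z w
      have eg := sub_smul_dslope g z w
      rw [hfz, sub_zero, smul_eq_mul] at ef
      rw [hgz, sub_zero, smul_eq_mul] at eg
      by_cases hwz : w = z
      · subst hwz
        simp [hgz]
      · have hs : w - z ≠ 0 := sub_ne_zero.2 hwz
        have hgw : g w ≠ 0 := by rw [← eg]; exact mul_ne_zero hs hw
        simp only [hgw, if_false, Pi.div_apply]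
        rw [← ef, ← eg, mul_div_mul_left _ _ hs]
    · have cg := (hg.differentiableAt hUz).continuousAt
      refine ((hf.differentiableAt hUz).div (hg.differentiableAt hUz) hgz).congr_of_eventuallyEq ?_
      filter_upwards [cg.eventually_ne hgz] with w hw
      simp [hw]
  · intro z hz
    by_cases hgz : g z = 0
    · simp [hgz, (h z hz hgz).1]
    · simp [hgz]

variable {q : ℂ}

/-- Split off the factor vanishing at `1`: `θ(x) = (1 - x) ψ(x)`, so `θ'(1) = -ψ(1) = -(q)_∞²`. -/
theorem deriv_qTheta_one_ne_zero (hq1 : ‖q‖ < 1) : deriv (qTheta q) 1 ≠ 0 := by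
  set ψ : ℂ → ℂ := fun x => qPochInf q (x * q) * qPochInf q (q / x) with hψ
  have e : qTheta q = fun x => (1 - x) * ψ x := by
    funext x
    rw [qTheta, qPochInf_succ hq1 x, mul_assoc]
  have hψd : DifferentiableAt ℂ ψ 1 := by
    refine DifferentiableAt.mul ?_ ?_
    · exact (differentiable_qPochInf hq1 _).comp 1 (differentiableAt_id.mul_const q)
    · exact (differentiable_qPochInf hq1 _).comp 1
        ((differentiableAt_const q).div differentiableAt_id one_ne_zero)
  have h1 : HasDerivAt (fun x : ℂ => 1 - x) (-1) 1 := by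
    simpa using (hasDerivAt_id (1 : ℂ)).const_sub 1
  have h2 := h1.mul hψd.hasDerivAt
  have h3 : deriv (qTheta q) 1 = -ψ 1 := by
    rw [e]
    refine h2.deriv.trans ?_
    simp
  rw [h3, neg_ne_zero]
  simp only [hψ, one_mul, div_one]
  exact mul_ne_zero (qPochInf_self_ne_zero hq1) (qPochInf_self_ne_zero hq1)

/-- Quasi-periodicity writes `θ(y)` near `1` as a differentiable multiple of `θ(y q ^ m)`, and `θ`
vanishes at `q ^ m`. A vanishing derivative at `q ^ m` would thus give one at `1`. -/
theorem deriv_qTheta_zpow_ne_zero (hq0 : q ≠ 0) (hq1 : ‖q‖ < 1) (m : ℤ) :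
    deriv (qTheta q) (q ^ m) ≠ 0 := by
  intro h0
  have hqm : q ^ m ≠ 0 := zpow_ne_zero m hq0
  have hz : qTheta q (q ^ m) = 0 := (qTheta_eq_zero_iff hq0 hq1 hqm).2 ⟨m, rfl⟩
  have hdq : HasDerivAt (qTheta q) 0 (q ^ m) := by
    rw [← h0]
    exact ((differentiableOn_qTheta hq1).differentiableAt
      (isOpen_compl_singleton.mem_nhds hqm)).hasDerivAt
  have h1 : HasDerivAt (fun y : ℂ => qTheta q (y * q ^ m)) 0 1 := by
    have := (HasDerivAt.comp (1 : ℂ) (h₂ := qTheta q) (h := fun y : ℂ => y * q ^ m)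
      (by simpa using hdq) ((hasDerivAt_id (1 : ℂ)).mul_const (q ^ m)))
    simpa [Function.comp_def] using this
  have hu : DifferentiableAt ℂ (fun y : ℂ => (-y) ^ m * q ^ choose2 m) 1 := by
    refine DifferentiableAt.mul_const ?_ _
    exact differentiableAt_id.neg.zpow (Or.inl (by simp))
  have h2 := hu.hasDerivAt.mul h1
  simp only [one_mul, hz, mul_zero, add_zero] at h2
  refine deriv_qTheta_one_ne_zero hq1 ?_
  have h3 : qTheta q =ᶠ[𝓝 1]
      (fun y : ℂ => (-y) ^ m * q ^ choose2 m) * fun y : ℂ => qTheta q (y * q ^ m) := by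
    filter_upwards [isOpen_compl_singleton.mem_nhds (one_ne_zero : (1 : ℂ) ≠ 0)] with y hy
    have hy' : y ≠ 0 := hy
    rw [Pi.mul_apply, qTheta_mul_zpow hq0 hq1 hy', zpow_neg, zpow_neg]
    have := zpow_ne_zero m (neg_ne_zero.2 hy')
    have := zpow_ne_zero (choose2 m) hq0
    field_simp
  exact h3.deriv_eq.trans h2.deriv

/-- The zeros of `θ(z / z0)` are exactly the points `z0 q ^ m`, and they are simple, so vanishing of
`f` there is enough for divisibility. -/
theorem exists_mul_qTheta (hq0 : q ≠ 0) (hq1 : ‖q‖ < 1) {f : ℂ → ℂ}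
    (hf : DifferentiableOn ℂ f {0}ᶜ) {z0 : ℂ} (hz0 : z0 ≠ 0)
    (hv : ∀ m : ℤ, f (z0 * q ^ m) = 0) :
    ∃ P : ℂ → ℂ, DifferentiableOn ℂ P {0}ᶜ ∧ ∀ z ≠ 0, f z = P z * qTheta q (z / z0) := by
  refine exists_differentiableOn_mul_eq isOpen_compl_singleton hf ?_ ?_
  · refine (differentiableOn_qTheta hq1).comp (by fun_prop) fun z hz => ?_
    exact div_ne_zero hz hz0
  · intro z hz h0
    have hzz : z / z0 ≠ 0 := div_ne_zero hz hz0
    obtain ⟨m, hm⟩ := (qTheta_eq_zero_iff hq0 hq1 hzz).1 h0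
    have e : z = z0 * q ^ m := by rw [← hm]; field_simp
    refine ⟨e ▸ hv m, ?_⟩
    have hd : HasDerivAt (qTheta q) (deriv (qTheta q) (q ^ m)) (z / z0) := by
      rw [← hm]
      exact ((differentiableOn_qTheta hq1).differentiableAt
        (isOpen_compl_singleton.mem_nhds hzz)).hasDerivAt
    have := (hd.comp z ((hasDerivAt_id z).div_const z0)).deriv
    simp only [Function.comp_def, id] at this
    rw [this]
    exact mul_ne_zero (deriv_qTheta_zpow_ne_zero hq0 hq1 m) (one_div_ne_zero hz0)

/-- Cancellation of a theta factor. Its zeros are countable, so their complement is dense, and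
continuity extends the equality to the zeros. -/
theorem eq_of_mul_qTheta_eq (hq0 : q ≠ 0) (hq1 : ‖q‖ < 1) {f g : ℂ → ℂ}
    (hf : ContinuousOn f {0}ᶜ) (hg : ContinuousOn g {0}ᶜ) {z0 : ℂ} (hz0 : z0 ≠ 0)
    (h : ∀ z ≠ 0, f z * qTheta q (z / z0) = g z * qTheta q (z / z0)) {z : ℂ} (hz : z ≠ 0) :
    f z = g z := by
  by_contra hne
  have hcount : (Set.range fun m : ℤ => z0 * q ^ m).Countable := Set.countable_range _
  have hev : ∀ᶠ w in 𝓝 z, w ≠ 0 ∧ f w ≠ g w := by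
    have hU := isOpen_compl_singleton.mem_nhds (show z ∈ ({0}ᶜ : Set ℂ) from hz)
    have hc := (hf.continuousAt hU).sub (hg.continuousAt hU)
    filter_upwards [hU, hc.eventually_ne (sub_ne_zero.2 hne)] with w hw hw'
    exact ⟨hw, sub_ne_zero.1 hw'⟩
  obtain ⟨V, hV, hVo, hzV⟩ := eventually_nhds_iff.1 hev
  obtain ⟨w, hwV, hwc⟩ := (hcount.dense_compl ℂ).inter_open_nonempty V hVo ⟨z, hzV⟩
  obtain ⟨hw0, hfg⟩ := hV w hwV
  refine hfg (mul_right_cancel₀ (qTheta_ne_zero hq0 hq1 (div_ne_zero hw0 hz0) fun m hm => hwc ⟨m, ?_⟩)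
    (h w hw0))
  simp only
  rw [← hm]
  field_simp

theorem zero_of_quasiperiodic {f m : ℂ → ℂ} (hq0 : q ≠ 0)
    (h : ∀ z ≠ 0, f (z * q) = m z * f z) (hm : ∀ z ≠ 0, m z ≠ 0) {z0 : ℂ} (hz0 : z0 ≠ 0)
    (h0 : f z0 = 0) (n : ℤ) : f (z0 * q ^ n) = 0 := by
  have hne : ∀ k : ℤ, z0 * q ^ k ≠ 0 := fun k => mul_ne_zero hz0 (zpow_ne_zero _ hq0)
  refine int_eq_of_ratio (f := fun n : ℤ => f (z0 * q ^ n)) (g := fun _ => 0)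
    (r := fun n => m (z0 * q ^ n)) (by simpa using h0) (fun k => hm _ (hne k)) (fun k => ?_)
    (fun k => by simp) n
  rw [zpow_add_one₀ hq0, ← mul_assoc, h _ (hne k), mul_comm]

/-- Liouville's theorem for multiplicatively quasi-periodic functions with unitary multiplier. -/
theorem eq_const_of_periodic (hq0 : q ≠ 0) (hq1 : ‖q‖ < 1) {P : ℂ → ℂ}
    (hP : DifferentiableOn ℂ P {0}ᶜ) {ε : ℂ} (hε : ‖ε‖ = 1) (h : ∀ z ≠ 0, P (z * q) = ε * P z) :
    ∃ c, ∀ z ≠ 0, P z = c := by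
  have hq : 0 < ‖q‖ := norm_pos_iff.2 hq0
  -- The closed annulus `‖q‖ ≤ ‖z‖ ≤ 1` meets every orbit of multiplication by `q`. As `‖ε‖ = 1`, a
  -- bound for `P` on it is a bound everywhere.
  set K : Set ℂ := Metric.closedBall 0 1 ∩ {z | ‖q‖ ≤ ‖z‖} with hK
  have hKc : IsCompact K := (isCompact_closedBall 0 1).inter_right
    (isClosed_le continuous_const continuous_norm)
  have hK0 : K ⊆ {0}ᶜ := by
    rintro z ⟨_, hz⟩ h0
    have h0' : z = 0 := h0
    have hz' : ‖q‖ ≤ ‖z‖ := hz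
    rw [h0', norm_zero] at hz'
    exact absurd hz' (not_le.2 hq)
  obtain ⟨M, hM⟩ := hKc.exists_bound_of_continuousOn (hP.continuousOn.mono hK0)
  have hbd : ∀ z ≠ 0, ‖P z‖ ≤ M := by
    intro z hz
    obtain ⟨n, hn1, hn2⟩ := exists_mem_Ioc_zpow (norm_pos_iff.2 hz) ((one_lt_inv₀ hq).2 hq1)
    have hnorm : ‖P (z * q ^ (n + 1))‖ = ‖P z‖ := by
      refine int_eq_of_ratio (f := fun k : ℤ => ‖P (z * q ^ k)‖) (g := fun _ => ‖P z‖)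
        (r := fun _ => 1) (by simp) (fun _ => one_ne_zero) (fun k => ?_) (fun k => by simp) (n + 1)
      rw [zpow_add_one₀ hq0, ← mul_assoc, h _ (mul_ne_zero hz (zpow_ne_zero _ hq0)), norm_mul, hε,
        one_mul, mul_one]
    rw [← hnorm]
    refine hM _ ⟨?_, ?_⟩
    · rw [mem_closedBall_zero_iff, norm_mul, norm_zpow]
      rw [inv_zpow, ← zpow_neg] at hn2
      calc ‖z‖ * ‖q‖ ^ (n + 1) ≤ ‖q‖ ^ (-(n + 1)) * ‖q‖ ^ (n + 1) := by gcongr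
        _ = 1 := by rw [← zpow_add₀ hq.ne']; simp
    · change ‖q‖ ≤ ‖z * q ^ (n + 1)‖
      rw [norm_mul, norm_zpow]
      rw [inv_zpow, ← zpow_neg] at hn1
      calc ‖q‖ = ‖q‖ ^ (-n) * ‖q‖ ^ (n + 1) := by rw [← zpow_add₀ hq.ne']; simp
        _ ≤ _ := by gcongr
  -- The exponential lifts `P` to a bounded entire function, so that the usual Liouville theorem
  -- applies.
  have hent : Differentiable ℂ fun u : ℂ => P (Complex.exp u) := fun u =>
    (hP.differentiableAt (isOpen_compl_singleton.mem_nhds (Complex.exp_ne_zero u))).comp u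
      Complex.differentiableAt_exp
  refine ⟨P 1, fun z hz => ?_⟩
  have := hent.apply_eq_apply_of_bounded
    (isBounded_iff_forall_norm_le.2 ⟨M, by rintro _ ⟨u, rfl⟩; exact hbd _ (Complex.exp_ne_zero u)⟩)
    (Complex.log z) 0
  simpa [Complex.exp_log hz] using this

/-- A zero at `1` is found by symmetry, with no Laurent expansion. The function `h(z) + z h(1/z)`
has the same multiplier as `h` and vanishes at `-1`, so it is `P(z) θ(-z)` with `P(zq) = -P(z)`.
Then `P` is a constant equal to its own negative, hence `0`. So `h(z) = -z h(1/z)`, which gives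
`h(1) = 0`; the quotient `h / θ` is then `q`-periodic and therefore constant. -/
theorem exists_eq_mul_qTheta_of_degree_one_aux (hq0 : q ≠ 0) (hq1 : ‖q‖ < 1) {h : ℂ → ℂ}
    (hd : DifferentiableOn ℂ h {0}ᶜ) (hqp : ∀ z ≠ 0, h (z * q) = -z⁻¹ * h z) :
    ∃ k, ∀ z ≠ 0, h z = k * qTheta q z := by
  have hinv : DifferentiableOn ℂ (fun z : ℂ => z * h z⁻¹) {0}ᶜ := by
    refine differentiableOn_id.mul (hd.comp (fun z hz => ?_) fun z hz => inv_ne_zero hz)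
    exact (differentiableAt_inv hz).differentiableWithinAt
  have hqpi : ∀ z ≠ 0, z * q * h (z * q)⁻¹ = -z⁻¹ * (z * h z⁻¹) := by
    intro z hz
    have hzq : (z * q)⁻¹ ≠ 0 := inv_ne_zero (mul_ne_zero hz hq0)
    have := hqp _ hzq
    rw [show (z * q)⁻¹ * q = z⁻¹ by field_simp, inv_inv] at this
    rw [this]
    field_simp
  have hm : ∀ z : ℂ, z ≠ 0 → -z⁻¹ ≠ 0 := fun z hz => neg_ne_zero.2 (inv_ne_zero hz)
  have hplus : ∀ z ≠ 0, h z + z * h z⁻¹ = 0 := by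
    have hqpp : ∀ z ≠ 0, h (z * q) + z * q * h (z * q)⁻¹ = -z⁻¹ * (h z + z * h z⁻¹) := by
      intro z hz
      rw [hqp z hz, hqpi z hz, mul_add]
    have hdp : DifferentiableOn ℂ (fun z => h z + z * h z⁻¹) {0}ᶜ := hd.add hinv
    obtain ⟨P, hP, hPe⟩ := exists_mul_qTheta hq0 hq1 hdp (neg_ne_zero.2 one_ne_zero)
      (zero_of_quasiperiodic (f := fun z => h z + z * h z⁻¹) hq0 hqpp hm
        (neg_ne_zero.2 one_ne_zero) (by norm_num))
    have hanti : ∀ z ≠ 0, P (z * q) = -1 * P z := by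
      intro z hz
      refine eq_of_mul_qTheta_eq hq0 hq1 (f := fun z => P (z * q)) (g := fun z => -1 * P z)
        (hP.continuousOn.comp (by fun_prop) fun z hz => mul_ne_zero hz hq0)
        (hP.continuousOn.const_smul (-1 : ℂ)) (neg_ne_zero.2 one_ne_zero) (fun z hz => ?_) hz
      have e1 := hPe _ (mul_ne_zero hz hq0)
      have e2 := qTheta_mul_q hq0 hq1 (div_ne_zero hz (neg_ne_zero.2 (one_ne_zero (α := ℂ))))
      rw [hqpp z hz, hPe z hz, mul_div_right_comm, e2] at e1
      have : z * (-z⁻¹ * (P z * qTheta q (z / -1))) =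
        z * (P (z * q) * (-(z / -1)⁻¹ * qTheta q (z / -1))) := by rw [e1]
      generalize qTheta q (z / -1) = T at this ⊢
      field_simp at this
      linear_combination -this
    obtain ⟨c, hc⟩ := eq_const_of_periodic hq0 hq1 hP (by simp) hanti
    have hc0 : c = 0 := by
      have := hanti 1 one_ne_zero
      rw [hc _ one_ne_zero, hc _ (mul_ne_zero one_ne_zero hq0)] at this
      linear_combination this / 2
    intro z hz
    rw [hPe z hz, hc z hz, hc0, zero_mul]
  have h1 : h 1 = 0 := by
    have := hplus 1 one_ne_zero
    simp only [inv_one, one_mul] at this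
    linear_combination this / 2
  obtain ⟨P, hP, hPe⟩ := exists_mul_qTheta hq0 hq1 hd one_ne_zero
    (zero_of_quasiperiodic hq0 hqp hm one_ne_zero h1)
  have hper : ∀ z ≠ 0, P (z * q) = 1 * P z := by
    intro z hz
    refine eq_of_mul_qTheta_eq hq0 hq1 (f := fun z => P (z * q)) (g := fun z => 1 * P z)
      (hP.continuousOn.comp (by fun_prop) fun z hz => mul_ne_zero hz hq0)
      (hP.continuousOn.const_smul (1 : ℂ)) one_ne_zero (fun z hz => ?_) hz
    have e1 := hPe _ (mul_ne_zero hz hq0)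
    have e2 := qTheta_mul_q hq0 hq1 hz
    rw [hqp z hz, hPe z hz, div_one, div_one, e2] at e1
    have : z * (-z⁻¹ * (P z * qTheta q z)) = z * (P (z * q) * (-z⁻¹ * qTheta q z)) := by rw [e1]
    field_simp at this
    rw [div_one]
    linear_combination this
  obtain ⟨c, hc⟩ := eq_const_of_periodic hq0 hq1 hP (by simp) hper
  exact ⟨c, fun z hz => by rw [hPe z hz, hc z hz, div_one]⟩

/-- Theta functions of degree one form a line. -/
theorem exists_eq_mul_qTheta_of_degree_one (hq0 : q ≠ 0) (hq1 : ‖q‖ < 1) {h : ℂ → ℂ}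
    (hd : DifferentiableOn ℂ h {0}ᶜ) {c : ℂ} (hc : c ≠ 0)
    (hqp : ∀ z ≠ 0, h (z * q) = -(c * z)⁻¹ * h z) :
    ∃ k, ∀ z ≠ 0, h z = k * qTheta q (c * z) := by
  obtain ⟨k, hk⟩ := exists_eq_mul_qTheta_of_degree_one_aux hq0 hq1 (h := fun z => h (z / c))
    (hd.comp (by fun_prop) fun z hz => div_ne_zero hz hc) (fun z hz => by
      have := hqp _ (div_ne_zero hz hc)
      rwa [mul_div_cancel₀ _ hc, ← mul_div_right_comm] at this)
  refine ⟨k, fun z hz => ?_⟩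
  have := hk _ (mul_ne_zero hc hz)
  rwa [mul_div_cancel_left₀ _ hc] at this

/-- A theta function of degree three is determined up to a scalar by two of its zeros. -/
theorem exists_eq_mul_qTheta_of_degree_three (hq0 : q ≠ 0) (hq1 : ‖q‖ < 1) {f : ℂ → ℂ}
    (hd : DifferentiableOn ℂ f {0}ᶜ) {t : ℂ} (ht : t ≠ 0)
    (hqp : ∀ z ≠ 0, f (z * q) = -(t * z ^ 3)⁻¹ * f z) {z1 z2 : ℂ} (hz1 : z1 ≠ 0) (hz2 : z2 ≠ 0)
    (h12 : ∀ m : ℤ, z2 / z1 ≠ q ^ m) (hf1 : f z1 = 0) (hf2 : f z2 = 0) :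
    ∃ k, ∀ z ≠ 0, f z = k * qTheta q (z / z1) * qTheta q (z / z2) * qTheta q (t * z1 * z2 * z) := by
  have hm : ∀ z : ℂ, z ≠ 0 → -(t * z ^ 3)⁻¹ ≠ 0 := fun z hz =>
    neg_ne_zero.2 (inv_ne_zero (mul_ne_zero ht (pow_ne_zero _ hz)))
  -- Dividing by `θ(z / z1)` and then by `θ(z / z2)` lowers the degree from three to one. The
  -- remaining multiplier `-(t z1 z2 z)⁻¹` determines the last theta factor.
  obtain ⟨P, hP, hPe⟩ := exists_mul_qTheta hq0 hq1 hd hz1 (zero_of_quasiperiodic hq0 hqp hm hz1 hf1)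
  have hPq : ∀ z ≠ 0, P (z * q) = (t * z1 * z ^ 2)⁻¹ * P z := by
    intro z hz
    refine eq_of_mul_qTheta_eq hq0 hq1 (f := fun z => P (z * q))
      (g := fun z => (t * z1 * z ^ 2)⁻¹ * P z)
      (hP.continuousOn.comp (by fun_prop) fun z hz => mul_ne_zero hz hq0)
      (ContinuousOn.mul (ContinuousOn.inv₀ (by fun_prop) fun z hz =>
        mul_ne_zero (mul_ne_zero ht hz1) (pow_ne_zero _ hz)) hP.continuousOn)
      hz1 (fun z hz => ?_) hz
    have e1 := hPe _ (mul_ne_zero hz hq0)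
    have e2 := qTheta_mul_q hq0 hq1 (div_ne_zero hz hz1)
    rw [hqp z hz, hPe z hz, mul_div_right_comm, e2] at e1
    have : z / z1 * (-(t * z ^ 3)⁻¹ * (P z * qTheta q (z / z1))) =
      z / z1 * (P (z * q) * (-(z / z1)⁻¹ * qTheta q (z / z1))) := by rw [e1]
    field_simp at this ⊢
    linear_combination this
  -- The zero at `z2` survives the first division because `z2` is not in the orbit of `z1`.
  have hP2 : P z2 = 0 := by
    have := hPe z2 hz2
    rw [hf2] at this
    exact (mul_eq_zero.1 this.symm).resolve_right
      (qTheta_ne_zero hq0 hq1 (div_ne_zero hz2 hz1) h12)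
  obtain ⟨Q, hQ, hQe⟩ := exists_mul_qTheta hq0 hq1 hP hz2 (zero_of_quasiperiodic hq0 hPq
    (fun z hz => inv_ne_zero (mul_ne_zero (mul_ne_zero ht hz1) (pow_ne_zero _ hz))) hz2 hP2)
  have hQq : ∀ z ≠ 0, Q (z * q) = -(t * z1 * z2 * z)⁻¹ * Q z := by
    intro z hz
    refine eq_of_mul_qTheta_eq hq0 hq1 (f := fun z => Q (z * q))
      (g := fun z => -(t * z1 * z2 * z)⁻¹ * Q z)
      (hQ.continuousOn.comp (by fun_prop) fun z hz => mul_ne_zero hz hq0)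
      (ContinuousOn.mul (ContinuousOn.neg (ContinuousOn.inv₀ (by fun_prop) fun z hz =>
        mul_ne_zero (mul_ne_zero (mul_ne_zero ht hz1) hz2) hz)) hQ.continuousOn)
      hz2 (fun z hz => ?_) hz
    have e1 := hQe _ (mul_ne_zero hz hq0)
    have e2 := qTheta_mul_q hq0 hq1 (div_ne_zero hz hz2)
    rw [hPq z hz, hQe z hz, mul_div_right_comm, e2] at e1
    have : z / z2 * ((t * z1 * z ^ 2)⁻¹ * (Q z * qTheta q (z / z2))) =
      z / z2 * (Q (z * q) * (-(z / z2)⁻¹ * qTheta q (z / z2))) := by rw [e1]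
    field_simp at this ⊢
    linear_combination this
  obtain ⟨k, hk⟩ := exists_eq_mul_qTheta_of_degree_one hq0 hq1 hQ
    (mul_ne_zero (mul_ne_zero ht hz1) hz2) hQq
  refine ⟨k, fun z hz => ?_⟩
  rw [hPe z hz, hQe z hz, hk z hz]
  ring

end QSeries

namespace QSeries

open Filter Topology Polynomial

/-! ### The regularized bilateral series -/

variable {q : ℂ} {a b : Fin 3 → ℂ}

theorem GenericParameters.a_ne_zero (hq0 : q ≠ 0) (h : GenericParameters q a b) (j : Fin 3) :
    a j ≠ 0 := fun e => by
  have := h.balance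
  rw [Finset.prod_eq_zero (Finset.mem_univ j) e, zero_mul] at this
  exact hq0 this.symm

theorem GenericParameters.b_ne_zero (hq0 : q ≠ 0) (h : GenericParameters q a b) (j : Fin 3) :
    b j ≠ 0 := fun e => by
  have := h.balance
  rw [Finset.prod_eq_zero (i := j) (Finset.mem_univ j) e, mul_zero] at this
  exact hq0 this.symm

/-- The term of the bilateral series, multiplied by `∏_j (q / a_j z)_∞ (q z / b_j)_∞` and written
so that it is manifestly holomorphic for `z ≠ 0`. -/
noncomputable def gTerm (q : ℂ) (a b : Fin 3 → ℂ) (z : ℂ) : ℤ → ℂ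
  | Int.ofNat n => q ^ n * ∏ j, (qPochInf q (q / (a j * z)) * qPoch q (a j * z) n *
      qPochInf q (q * z / b j * q ^ n))
  | Int.negSucc n => q ^ (n + 1) * ∏ j, (qPochInf q (q / (a j * z) * q ^ (n + 1)) *
      qPoch q (b j / z) (n + 1 : ℕ) * qPochInf q (q * z / b j))

/-- The regularized bilateral series. -/
noncomputable def gSum (q : ℂ) (a b : Fin 3 → ℂ) (z : ℂ) : ℂ := ∑' x, gTerm q a b z x

theorem gTerm_natCast (q : ℂ) (a b : Fin 3 → ℂ) (z : ℂ) (n : ℕ) :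
    gTerm q a b z n = q ^ n * ∏ j, (qPochInf q (q / (a j * z)) * qPoch q (a j * z) n *
      qPochInf q (q * z / b j * q ^ n)) := rfl

theorem gTerm_neg_natCast (q : ℂ) (a b : Fin 3 → ℂ) (z : ℂ) (n : ℕ) :
    gTerm q a b z (-(n : ℤ)) = q ^ n * ∏ j, (qPochInf q (q / (a j * z) * q ^ n) *
      qPoch q (b j / z) n * qPochInf q (q * z / b j)) := by
  cases n with
  | zero => simpa using gTerm_natCast q a b z 0
  | succ n => rfl

/-- All the arguments that occur in `gTerm q a b z` are bounded by `R`. -/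
def ArgBound (q : ℂ) (a b : Fin 3 → ℂ) (R : ℝ) (z : ℂ) : Prop :=
  ∀ j, ‖a j * z‖ ≤ R ∧ ‖q / (a j * z)‖ ≤ R ∧ ‖b j / z‖ ≤ R ∧ ‖q * z / b j‖ ≤ R

theorem norm_mul_pow_le (hq1 : ‖q‖ < 1) {x : ℂ} {R : ℝ} (hx : ‖x‖ ≤ R) (n : ℕ) :
    ‖x * q ^ n‖ ≤ R := by
  rw [norm_mul, norm_pow]
  exact (mul_le_of_le_one_right (norm_nonneg x) (pow_le_one₀ (norm_nonneg q) hq1.le)).trans hx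

/-- All shifted factorials and infinite products stay bounded uniformly in `x`; the decay in both
directions comes from the explicit power of `q` alone. -/
theorem norm_gTerm_le (hq1 : ‖q‖ < 1) {R : ℝ} {z : ℂ} (h : ArgBound q a b R z) (x : ℤ) :
    ‖gTerm q a b z x‖ ≤ ‖q‖ ^ x.natAbs * (qBound q R * qBound q R * qBound q R) ^ 3 := by
  have key : ∀ u v w : Fin 3 → ℂ, (∀ j, ‖u j‖ ≤ qBound q R) → (∀ j, ‖v j‖ ≤ qBound q R) →
      (∀ j, ‖w j‖ ≤ qBound q R) →
      ‖∏ j, (u j * v j * w j)‖ ≤ (qBound q R * qBound q R * qBound q R) ^ 3 := by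
    intro u v w hu hv hw
    rw [norm_prod]
    refine (Finset.prod_le_prod (g := fun _ => qBound q R * qBound q R * qBound q R)
      (fun _ _ => norm_nonneg _) fun j _ => ?_).trans (by simp)
    have h0 := (qBound_pos q R).le
    rw [norm_mul, norm_mul]
    exact mul_le_mul (mul_le_mul (hu j) (hv j) (norm_nonneg _) h0) (hw j) (norm_nonneg _)
      (mul_nonneg h0 h0)
  obtain ⟨n, rfl | rfl⟩ := x.eq_nat_or_neg
  · rw [gTerm_natCast, norm_mul, norm_pow, Int.natAbs_natCast]
    refine mul_le_mul_of_nonneg_left (key _ _ _ (fun j => ?_) (fun j => ?_) fun j => ?_)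
      (by positivity)
    · exact norm_qPochInf_le_qBound hq1 (h j).2.1
    · exact norm_qPoch_le_qBound hq1 (h j).1 n
    · exact norm_qPochInf_le_qBound hq1 (norm_mul_pow_le hq1 (h j).2.2.2 n)
  · rw [gTerm_neg_natCast, norm_mul, norm_pow, Int.natAbs_neg, Int.natAbs_natCast]
    refine mul_le_mul_of_nonneg_left (key _ _ _ (fun j => ?_) (fun j => ?_) fun j => ?_)
      (by positivity)
    · exact norm_qPochInf_le_qBound hq1 (norm_mul_pow_le hq1 (h j).2.1 n)
    · exact norm_qPoch_le_qBound hq1 (h j).2.2.1 n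
    · exact norm_qPochInf_le_qBound hq1 (h j).2.2.2

theorem summable_pow_natAbs (hq1 : ‖q‖ < 1) (M : ℝ) :
    Summable fun x : ℤ => ‖q‖ ^ x.natAbs * M := by
  refine Summable.mul_right M (Summable.of_nat_of_neg ?_ ?_)
  · simpa using summable_geometric_of_lt_one (norm_nonneg q) hq1
  · simpa using summable_geometric_of_lt_one (norm_nonneg q) hq1

theorem eventually_argBound (ha : ∀ j, a j ≠ 0) (hb : ∀ j, b j ≠ 0) {z : ℂ} (hz : z ≠ 0) :
    ∃ R, ∀ᶠ w in 𝓝 z, ArgBound q a b R w := by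
  have hcont : ∀ f : ℂ → ℂ, ContinuousAt f z → ∀ᶠ w in 𝓝 z, ‖f w‖ ≤ ‖f z‖ + 1 := fun f hf => by
    have := hf.norm.eventually (gt_mem_nhds (lt_add_one ‖f z‖))
    exact this.mono fun w hw => hw.le
  have hR : ∀ j, ∃ R, ∀ᶠ w in 𝓝 z,
      ‖a j * w‖ ≤ R ∧ ‖q / (a j * w)‖ ≤ R ∧ ‖b j / w‖ ≤ R ∧ ‖q * w / b j‖ ≤ R := by
    intro j
    have h1 := hcont (fun w => a j * w) (by fun_prop)
    have h2 := hcont (fun w => q / (a j * w))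
      (ContinuousAt.div (by fun_prop) (by fun_prop) (mul_ne_zero (ha j) hz))
    have h3 := hcont (fun w => b j / w) (ContinuousAt.div (by fun_prop) (by fun_prop) hz)
    have h4 := hcont (fun w => q * w / b j) (ContinuousAt.div (by fun_prop) (by fun_prop) (hb j))
    refine ⟨‖a j * z‖ + ‖q / (a j * z)‖ + ‖b j / z‖ + ‖q * z / b j‖ + 1, ?_⟩
    filter_upwards [h1, h2, h3, h4] with w w1 w2 w3 w4
    have n1 := norm_nonneg (a j * z)
    have n2 := norm_nonneg (q / (a j * z))
    have n3 := norm_nonneg (b j / z)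
    have n4 := norm_nonneg (q * z / b j)
    refine ⟨?_, ?_, ?_, ?_⟩ <;> linarith
  choose R hR using hR
  refine ⟨max (R 0) (max (R 1) (R 2)), ?_⟩
  have := eventually_all.2 hR
  filter_upwards [this] with w hw j
  have hj : R j ≤ max (R 0) (max (R 1) (R 2)) := by fin_cases j <;> simp
  obtain ⟨h1, h2, h3, h4⟩ := hw j
  exact ⟨h1.trans hj, h2.trans hj, h3.trans hj, h4.trans hj⟩

theorem summable_gTerm (hq1 : ‖q‖ < 1) (ha : ∀ j, a j ≠ 0) (hb : ∀ j, b j ≠ 0) {z : ℂ}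
    (hz : z ≠ 0) : Summable (gTerm q a b z) := by
  obtain ⟨R, hR⟩ := eventually_argBound (q := q) ha hb hz
  exact .of_norm_bounded (summable_pow_natAbs hq1 _) (norm_gTerm_le hq1 hR.self_of_nhds)

theorem differentiableAt_gTerm (hq1 : ‖q‖ < 1) (ha : ∀ j, a j ≠ 0) (x : ℤ) {z : ℂ} (hz : z ≠ 0) :
    DifferentiableAt ℂ (fun z => gTerm q a b z x) z := by
  have hI : ∀ f : ℂ → ℂ, DifferentiableAt ℂ f z → DifferentiableAt ℂ (fun z => qPochInf q (f z)) z :=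
    fun f hf => (differentiable_qPochInf hq1 _).comp z hf
  have hP : ∀ (f : ℂ → ℂ) (n : ℕ), DifferentiableAt ℂ f z →
      DifferentiableAt ℂ (fun z => qPoch q (f z) n) z := by
    intro f n hf
    simp only [qPoch_natCast]
    fun_prop
  have h1 : ∀ j, DifferentiableAt ℂ (fun z => q / (a j * z)) z := fun j =>
    DifferentiableAt.div (by fun_prop) (by fun_prop) (mul_ne_zero (ha j) hz)
  have h2 : ∀ j, DifferentiableAt ℂ (fun z => b j / z) z := fun j =>
    DifferentiableAt.div (by fun_prop) (by fun_prop) hz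
  obtain ⟨n, rfl | rfl⟩ := x.eq_nat_or_neg
  · simp only [gTerm_natCast]
    refine DifferentiableAt.const_mul (DifferentiableAt.fun_finsetProd fun j _ => ?_) _
    exact ((hI _ (h1 j)).mul (hP _ n (by fun_prop))).mul (hI _ (by fun_prop))
  · simp only [gTerm_neg_natCast]
    refine DifferentiableAt.const_mul (DifferentiableAt.fun_finsetProd fun j _ => ?_) _
    exact ((hI _ ((h1 j).mul_const _)).mul (hP _ n (h2 j))).mul (hI _ (by fun_prop))

theorem differentiableOn_gSum (hq1 : ‖q‖ < 1) (ha : ∀ j, a j ≠ 0) (hb : ∀ j, b j ≠ 0) :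
    DifferentiableOn ℂ (gSum q a b) {0}ᶜ := by
  intro z hz
  refine DifferentiableAt.differentiableWithinAt ?_
  obtain ⟨R, hR⟩ := eventually_argBound (q := q) ha hb hz
  obtain ⟨V, hV, hVo, hzV⟩ := eventually_nhds_iff.1
    (hR.and (isOpen_compl_singleton.mem_nhds hz))
  have := Complex.differentiableOn_tsum_of_summable_norm (F := fun x z => gTerm q a b z x)
    (summable_pow_natAbs hq1 _) (fun x w hw =>
      (differentiableAt_gTerm hq1 ha x (hV w hw).2).differentiableWithinAt) hVo
    (fun x w hw => norm_gTerm_le hq1 (hV w hw).1 x)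
  exact this.differentiableAt (hVo.mem_nhds hzV)

/-- Replacing `z` by `zq` amounts to moving the summation index by one. In the range `x < 0` the
multiplier comes out as `∏ (-b_j/(zq))`, and the balancing condition makes it agree with the one for
`x ≥ 0`. -/
theorem gTerm_mul_q (hq0 : q ≠ 0) (hq1 : ‖q‖ < 1) (h : GenericParameters q a b) {z : ℂ}
    (hz : z ≠ 0) (x : ℤ) :
    gTerm q a b (z * q) x = -(q * (∏ j, a j) * z ^ 3)⁻¹ * gTerm q a b z (x + 1) := by
  have ha := h.a_ne_zero hq0
  have hb := h.b_ne_zero hq0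
  -- Split so that `x` and `x + 1` always fall under the same one of the two defining formulas: both
  -- nonnegative, or both nonpositive.
  obtain ⟨n, hn⟩ : ∃ n : ℕ, x = n ∨ x = -((n + 1 : ℕ) : ℤ) := by
    rcases x with n | n
    · exact ⟨n, Or.inl rfl⟩
    · exact ⟨n, Or.inr rfl⟩
  rcases hn with rfl | rfl
  · rw [← Nat.cast_succ, gTerm_natCast, gTerm_natCast]
    have key : ∀ j, qPochInf q (q / (a j * (z * q))) * qPoch q (a j * (z * q)) n *
        qPochInf q (q * (z * q) / b j * q ^ n) = -(a j * z)⁻¹ * (qPochInf q (q / (a j * z)) *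
          qPoch q (a j * z) (n + 1 : ℕ) * qPochInf q (q * z / b j * q ^ (n + 1))) := by
      intro j
      have := ha j
      have e1 : q / (a j * (z * q)) = (a j * z)⁻¹ := by field_simp
      have e2 : q / (a j * z) = (a j * z)⁻¹ * q := by field_simp
      have e3 : q * (z * q) / b j * q ^ n = q * z / b j * q ^ (n + 1) := by ring
      rw [e1, e2, e3, qPochInf_succ hq1 (a j * z)⁻¹, Nat.cast_succ, qPoch_natCast_succ', ← mul_assoc]
      field_simp
      ring
    rw [Finset.prod_congr rfl fun j _ => key j, Finset.prod_mul_distrib]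
    simp only [Fin.prod_univ_three]
    have := ha 0
    have := ha 1
    have := ha 2
    field_simp
    ring
  · have e : -((n + 1 : ℕ) : ℤ) + 1 = -(n : ℤ) := by push_cast; ring
    rw [e, gTerm_neg_natCast, gTerm_neg_natCast]
    have key : ∀ j, qPochInf q (q / (a j * (z * q)) * q ^ (n + 1)) *
        qPoch q (b j / (z * q)) (n + 1 : ℕ) * qPochInf q (q * (z * q) / b j) =
        -(b j / (z * q)) * (qPochInf q (q / (a j * z) * q ^ n) *
          qPoch q (b j / z) n * qPochInf q (q * z / b j)) := by
      intro j
      have := ha j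
      have := hb j
      have e1 : q / (a j * (z * q)) * q ^ (n + 1) = q / (a j * z) * q ^ n := by
        rw [pow_succ]; field_simp
      have e2 : b j / (z * q) * q = b j / z := by field_simp
      rw [e1, Nat.cast_succ, qPoch_natCast_succ', e2, qPochInf_succ hq1 (q * z / b j),
        show q * z / b j * q = q * (z * q) / b j by ring]
      field_simp
      ring
    rw [Finset.prod_congr rfl fun j _ => key j, Finset.prod_mul_distrib]
    have hbal := h.balance
    simp only [Fin.prod_univ_three] at hbal ⊢
    have := ha 0
    have := ha 1
    have := ha 2
    generalize (qPochInf q (q / (a 0 * z) * q ^ n) * qPoch q (b 0 / z) n * qPochInf q (q * z / b 0)) *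
      (qPochInf q (q / (a 1 * z) * q ^ n) * qPoch q (b 1 / z) n * qPochInf q (q * z / b 1)) *
      (qPochInf q (q / (a 2 * z) * q ^ n) * qPoch q (b 2 / z) n * qPochInf q (q * z / b 2)) = G
    field_simp
    linear_combination -q * q ^ n * G * hbal

theorem gSum_mul_q (hq0 : q ≠ 0) (hq1 : ‖q‖ < 1) (h : GenericParameters q a b) {z : ℂ}
    (hz : z ≠ 0) : gSum q a b (z * q) = -(q * (∏ j, a j) * z ^ 3)⁻¹ * gSum q a b z := by
  unfold gSum
  simp_rw [gTerm_mul_q hq0 hq1 h hz]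
  rw [tsum_mul_left]
  congr 1
  exact (Equiv.addRight (1 : ℤ)).tsum_eq (gTerm q a b z)

theorem sumTerm_one (q : ℂ) (a b : Fin 3 → ℂ) (z : ℂ) (x : ℤ) :
    sumTerm q a b 1 z x = q ^ x * ∏ j, qPoch q (a j * z) x / qPoch q (q * z / b j) x := by
  simp [sumTerm]

/-- Relation of `gTerm` to the terms of the bilateral series. -/
theorem gTerm_eq_sumTerm (hq0 : q ≠ 0) (hq1 : ‖q‖ < 1) (h : GenericParameters q a b) {z : ℂ}
    (hz : z ≠ 0) (haz : ∀ j, ∀ m : ℤ, a j * z ≠ q ^ m) (hzb : ∀ j, ∀ m : ℤ, z / b j ≠ q ^ m)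
    (x : ℤ) :
    gTerm q a b z x =
      (∏ j, qPochInf q (q / (a j * z)) * qPochInf q (q * z / b j)) * sumTerm q a b 1 z x := by
  have ha := h.a_ne_zero hq0
  have hb := h.b_ne_zero hq0
  have hqzb : ∀ j, ∀ m : ℤ, q * z / b j ≠ q ^ m := fun j m e => hzb j (m - 1) (by
    rw [zpow_sub_one₀ hq0, ← e]; field_simp)
  have hbz : ∀ j, ∀ m : ℤ, b j / z ≠ q ^ m := fun j m e => hzb j (-m) (by
    rw [zpow_neg, ← e, inv_div])
  rw [sumTerm_one]
  obtain ⟨n, rfl | rfl⟩ := x.eq_nat_or_neg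
  · rw [gTerm_natCast, zpow_natCast, mul_left_comm, ← Finset.prod_mul_distrib]
    congr 1
    refine Finset.prod_congr rfl fun j _ => ?_
    rw [qPochInf_eq_qPoch_mul_nat hq1 (q * z / b j) n]
    have := qPoch_ne_zero (hqzb j) n
    field_simp
  · rw [gTerm_neg_natCast]
    -- Reflect both `(a_j z)_{-n}` and `(b_j / z)_n`: the quadratic powers of `q` cancel, leaving
    -- `(a_j b_j)^(-n) q ^ n`.
    have key : ∀ j, qPochInf q (q / (a j * z)) * qPochInf q (q * z / b j) *
        (qPoch q (a j * z) (-(n : ℤ)) / qPoch q (q * z / b j) (-(n : ℤ))) =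
        (a j * b j)⁻¹ ^ n * q ^ n * (qPochInf q (q / (a j * z) * q ^ n) *
      qPoch q (b j / z) n * qPochInf q (q * z / b j)) := by
      intro j
      have haj := ha j
      have hbj := hb j
      have e1 := qPoch_mul_qPochInf_div hq0 hq1 (mul_ne_zero haj hz) (haz j) (-(n : ℤ))
      have e2 := qPoch_mul_qPochInf_div hq0 hq1 (div_ne_zero hbj hz) (hbz j) n
      have e3 := qPochInf_eq_qPoch_mul hq0 hq1 (hqzb j) (-(n : ℤ))
      have hne := qPoch_ne_zero (hqzb j) (-(n : ℤ))
      have e4 : q / (b j / z) = q * z / b j := by field_simp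
      have e5 : q / (b j / z * q ^ (n : ℤ)) = q * z / b j * q ^ (-(n : ℤ)) := by
        rw [zpow_neg]; field_simp
      have e6 : q / (a j * z * q ^ (-(n : ℤ))) = q / (a j * z) * q ^ n := by
        rw [zpow_neg, zpow_natCast]; field_simp
      have e7 : choose2 (-(n : ℤ)) = choose2 n + n := by
        have h1 := two_mul_choose2 (n : ℤ)
        have h2 := two_mul_choose2 (-(n : ℤ))
        linarith
      rw [e4, e5] at e2
      rw [e6, e7, zpow_add₀ hq0, zpow_neg] at e1
      have e8 : qPochInf q (q * z / b j) / qPoch q (q * z / b j) (-(n : ℤ)) =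
          qPochInf q (q * z / b j * q ^ (-(n : ℤ))) := by
        exact (div_eq_iff hne).2 (e3.trans (mul_comm _ _))
      have hc := zpow_ne_zero (choose2 (n : ℤ)) hq0
      calc _ = (qPoch q (a j * z) (-(n : ℤ)) * qPochInf q (q / (a j * z))) *
            (qPochInf q (q * z / b j) / qPoch q (q * z / b j) (-(n : ℤ))) := by ring
        _ = (((-(a j * z)) ^ (n : ℤ))⁻¹ * (q ^ choose2 (n : ℤ) * q ^ (n : ℤ)) *
              qPochInf q (q / (a j * z) * q ^ n)) *
              (((-(b j / z)) ^ (n : ℤ))⁻¹ * (q ^ choose2 (n : ℤ))⁻¹ *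
                (qPoch q (b j / z) n * qPochInf q (q * z / b j))) := by
            rw [e1, e8, e2]
            have := zpow_ne_zero (n : ℤ) (neg_ne_zero.2 (div_ne_zero hbj hz))
            field_simp
        _ = (((-(a j * z)) * (-(b j / z))) ^ n)⁻¹ * q ^ n *
              (qPochInf q (q / (a j * z) * q ^ n) *
                qPoch q (b j / z) n * qPochInf q (q * z / b j)) := by
            rw [zpow_natCast, zpow_natCast, zpow_natCast, mul_pow, mul_inv]
            field_simp
        _ = _ := by
            rw [show (-(a j * z)) * (-(b j / z)) = a j * b j by field_simp, inv_pow]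
    -- By balancing the product is `q ^ (-n) q ^ (3n)`. Together with the factor `q ^ (-n)` of the
    -- series this gives the decaying `q ^ n` of `gTerm`.
    have hconst : ∏ j, ((a j * b j)⁻¹ ^ n * q ^ n) = q ^ (2 * n) := by
      rw [Finset.prod_mul_distrib, Finset.prod_pow, Finset.prod_inv_distrib,
        Finset.prod_mul_distrib, h.balance]
      simp only [Finset.prod_const, Finset.card_univ, Fintype.card_fin]
      rw [inv_pow]
      field_simp
      ring
    rw [mul_left_comm, ← Finset.prod_mul_distrib, Finset.prod_congr rfl fun j _ => key j]
    rw [Finset.prod_mul_distrib (f := fun j => (a j * b j)⁻¹ ^ n * q ^ n), hconst, ← mul_assoc]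
    congr 1
    rw [zpow_neg, zpow_natCast]
    field_simp
    ring

end QSeries

namespace QSeries

open Filter Topology Polynomial

/-! ### The nonterminating `q`-Saalschütz summation -/

variable {q : ℂ} {a : Fin 3 → ℂ}

/-- The term of the unilateral series with node `z`. -/
noncomputable def uTerm (q : ℂ) (a : Fin 3 → ℂ) (z x y : ℂ) (n : ℕ) : ℂ :=
  q ^ n * (∏ j, qPoch q (a j * z) n) * qPochInf q (q * q ^ n) * qPochInf q (q * z / x * q ^ n) *
    qPochInf q (q * z / y * q ^ n)

/-- The unilateral series with node `z`. -/
noncomputable def uSum (q : ℂ) (a : Fin 3 → ℂ) (z x y : ℂ) : ℂ := ∑' n, uTerm q a z x y n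

theorem norm_prod_three_le {u : Fin 3 → ℂ} {B : ℝ} (h : ∀ j, ‖u j‖ ≤ B) : ‖∏ j, u j‖ ≤ B ^ 3 := by
  rw [norm_prod]
  exact (Finset.prod_le_prod (fun _ _ => norm_nonneg _) fun j _ => h j).trans (by simp)

theorem norm_uTerm_le (hq1 : ‖q‖ < 1) {z x y : ℂ} {R : ℝ} (ha : ∀ j, ‖a j * z‖ ≤ R)
    (hx : ‖q * z / x‖ ≤ R) (hy : ‖q * z / y‖ ≤ R) (n : ℕ) :
    ‖uTerm q a z x y n‖ ≤ ‖q‖ ^ n * (qBound q R ^ 3 * qBound q 1 * qBound q R * qBound q R) := by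
  have h0 := (qBound_pos q R).le
  have h1 := (qBound_pos q 1).le
  have e1 := norm_prod_three_le fun j => norm_qPoch_le_qBound hq1 (ha j) n
  have e2 := norm_qPochInf_le_qBound hq1 (norm_mul_pow_le hq1 hq1.le n)
  have e3 := norm_qPochInf_le_qBound hq1 (norm_mul_pow_le hq1 hx n)
  have e4 := norm_qPochInf_le_qBound hq1 (norm_mul_pow_le hq1 hy n)
  unfold uTerm
  rw [norm_mul, norm_mul, norm_mul, norm_mul, norm_pow, mul_assoc (‖q‖ ^ n), mul_assoc (‖q‖ ^ n),
    mul_assoc (‖q‖ ^ n)]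
  gcongr

theorem summable_uTerm (hq1 : ‖q‖ < 1) (a : Fin 3 → ℂ) (z x y : ℂ) :
    Summable (uTerm q a z x y) := by
  set R := ‖a 0 * z‖ + ‖a 1 * z‖ + ‖a 2 * z‖ + ‖q * z / x‖ + ‖q * z / y‖ with hR
  have n0 := norm_nonneg (a 0 * z)
  have n1 := norm_nonneg (a 1 * z)
  have n2 := norm_nonneg (a 2 * z)
  have n3 := norm_nonneg (q * z / x)
  have n4 := norm_nonneg (q * z / y)
  refine .of_norm_bounded ((summable_geometric_of_lt_one (norm_nonneg q) hq1).mul_right _)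
    (norm_uTerm_le hq1 (R := R) (fun j => ?_) ?_ ?_)
  · fin_cases j <;> simp only [Fin.zero_eta, Fin.mk_one, Fin.reduceFinMk] <;> linarith
  · linarith
  · linarith

/-- Telescoping sums. -/
theorem tsum_eq_of_telescope {f h : ℕ → ℂ} {L : ℂ} (hf : Summable f) (h0 : h 0 = 0)
    (hL : Tendsto h atTop (𝓝 L)) (hfh : ∀ n, f n = h n - h (n + 1)) : ∑' n, f n = -L := by
  refine tendsto_nhds_unique hf.hasSum.tendsto_sum_nat (hL.neg.congr fun n => ?_)
  simp_rw [hfh]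
  rw [Finset.sum_range_sub', h0, zero_sub]

/-- The boundary term at infinity of the telescoping sums in `uComb_contiguous`. At `n = 0` the same
expression vanishes because of its factor `(1)_∞`. -/
theorem tendsto_telescope (hq1 : ‖q‖ < 1) (a : Fin 3 → ℂ) (z u v : ℂ) :
    Tendsto (fun n : ℕ => (∏ j, qPoch q (a j * z) n) * qPochInf q (q ^ n) *
      qPochInf q (u * q ^ n) * qPochInf q (v * q ^ n)) atTop
      (𝓝 (∏ j, qPochInf q (a j * z))) := by
  have h1 : Tendsto (fun n : ℕ => ∏ j, qPoch q (a j * z) n) atTop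
      (𝓝 (∏ j, qPochInf q (a j * z))) :=
    tendsto_finsetProd _ fun j _ => tendsto_prod_qPochInf hq1 (a j * z)
  have h2 := tendsto_qPochInf_mul_pow hq1 1
  simp only [one_mul] at h2
  simpa using ((h1.mul h2).mul (tendsto_qPochInf_mul_pow hq1 u)).mul (tendsto_qPochInf_mul_pow hq1 v)

/-- On the left the constant terms cancel, and the cubic terms cancel by balancing, so the left side
is `z` times a polynomial of degree at most one. That polynomial is expanded in `1 - qz/w` and `1 -
z/x`, independent because `w ≠ qx`; the coefficients are read off at `z = x` and `z = w/q`. -/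
theorem contiguous_polynomial (hq0 : q ≠ 0) {a0 a1 a2 x y w : ℂ} (hbal : a0 * a1 * a2 * (x * y * w) = q)
    (hxw : w - q * x ≠ 0) (z : ℂ) :
    (1 - z / x) * (1 - z / y) * (1 - q * z / w) - (1 - a0 * z) * (1 - a1 * z) * (1 - a2 * z) =
      z * (-(1 - a0 * x) * (1 - a1 * x) * (1 - a2 * x) * w / (x * (w - q * x)) * (1 - q * z / w) +
        q ^ 2 * x * ((1 - a0 * w / q) * (1 - a1 * w / q) * (1 - a2 * w / q)) / (w * (w - q * x)) *
          (1 - z / x)) := by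
  have hne : a0 * a1 * a2 * (x * y * w) ≠ 0 := hbal ▸ hq0
  simp only [mul_ne_zero_iff] at hne
  obtain ⟨⟨⟨h0, h1⟩, h2⟩, ⟨hx, hy⟩, hw⟩ := hne
  have hy' : y = q / (a0 * a1 * a2 * x * w) := by
    field_simp
    linear_combination hbal
  subst hy'
  obtain ⟨D, hD⟩ : ∃ D, D = w - q * x := ⟨_, rfl⟩
  rw [← hD] at hxw ⊢
  field_simp
  rw [hD]
  ring

/-- The antisymmetric combination of two unilateral series. -/
noncomputable def uComb (q : ℂ) (a : Fin 3 → ℂ) (x y w : ℂ) : ℂ :=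
  y * uSum q a y x w * ∏ j, qPochInf q (a j * x) - x * uSum q a x y w * ∏ j, qPochInf q (a j * y)

/-- Multiplied by the products common to neighbouring terms, `contiguous_polynomial` at `z = y q ^
n` and at `z = x q ^ n` turns a combination of unilateral series for `(x, w)` and `(xq, w/q)` into a
telescoping sum. The two boundary values are `-∏ (a_j y)_∞` and `-∏ (a_j x)_∞`; they drop out of the
antisymmetric combination, which leaves a two-term recursion. -/
theorem uComb_contiguous (hq0 : q ≠ 0) (hq1 : ‖q‖ < 1) {x y w : ℂ}
    (hbal : (∏ j, a j) * (x * y * w) = q) (hxw : w - q * x ≠ 0) (hax : ∀ j, 1 - a j * x ≠ 0) :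
    uComb q a x y w = -(x / y) * (∏ j, (1 - q / (a j * w))) * uComb q a (x * q) y (w / q) := by
  have hne : (∏ j, a j) * (x * y * w) ≠ 0 := hbal ▸ hq0
  simp only [mul_ne_zero_iff, Finset.prod_ne_zero_iff, Finset.mem_univ, true_implies] at hne
  obtain ⟨ha, ⟨hx, hy⟩, hw⟩ := hne
  set p : ℂ := ∏ j, (1 - a j * x) with hp
  have hp0 : p ≠ 0 := Finset.prod_ne_zero_iff.2 fun j _ => hax j
  set α : ℂ := -p * w / (x * (w - q * x)) with hα
  set β : ℂ := q ^ 2 * x * (∏ j, (1 - a j * w / q)) / (w * (w - q * x)) with hβ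
  have hpoly : ∀ z : ℂ, (1 - z / x) * (1 - z / y) * (1 - q * z / w) - ∏ j, (1 - a j * z) =
      z * (α * (1 - q * z / w) + β * (1 - z / x)) := by
    intro z
    rw [Fin.prod_univ_three] at hbal
    have := contiguous_polynomial hq0 hbal hxw z
    simp only [hα, hβ, hp, Fin.prod_univ_three]
    rw [this]
    ring
  have hY : y * (α * uSum q a y x w + β * uSum q a y (x * q) (w / q)) =
      -∏ j, qPochInf q (a j * y) := by
    have s1 := (summable_uTerm hq1 a y x w).mul_left α
    have s2 := (summable_uTerm hq1 a y (x * q) (w / q)).mul_left β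
    unfold uSum
    rw [← tsum_mul_left, ← tsum_mul_left, ← s1.tsum_add s2, ← tsum_mul_left]
    refine tsum_eq_of_telescope ((s1.add s2).mul_left y) ?_
      (tendsto_telescope hq1 a y (y / x) (q * y / w)) fun n => ?_
    · simp [qPochInf_one hq1]
    · have e1 := qPochInf_succ hq1 (q ^ n)
      have e2 := qPochInf_succ hq1 (y / x * q ^ n)
      have e3 := qPochInf_succ hq1 (q * y / w * q ^ n)
      have f1 : q * y / x * q ^ n = y / x * q ^ n * q := by ring
      have f2 : q * y / (x * q) * q ^ n = y / x * q ^ n := by field_simp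
      have f3 : q * y / (w / q) * q ^ n = q * y / w * q ^ n * q := by field_simp
      have f4 : q * q ^ n = q ^ n * q := mul_comm _ _
      have hpz := hpoly (y * q ^ n)
      simp only [uTerm, Nat.cast_succ, qPoch_natCast_succ, Finset.prod_mul_distrib]
      rw [f1, f2, f3, f4, pow_succ, ← mul_assoc (y / x), ← mul_assoc (q * y / w), e1, e2, e3]
      rw [show y * q ^ n / y = q ^ n by field_simp] at hpz
      simp only [← mul_assoc] at hpz
      rw [show y * q ^ n / x = y / x * q ^ n by ring, show q * y * q ^ n / w = q * y / w * q ^ n by ring]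
        at hpz
      linear_combination -(∏ j, qPoch q (a j * y) n) * qPochInf q (q ^ n * q) *
        qPochInf q (y / x * q ^ n * q) * qPochInf q (q * y / w * q ^ n * q) * hpz
  have hX : x * α * uSum q a x y w + β * (x * q * p) * uSum q a (x * q) y (w / q) =
      -∏ j, qPochInf q (a j * x) := by
    -- At the node `x` the shift `x ↦ xq` moves the node itself. The shifted series is therefore the
    -- series of `r` with its index moved by one, and nothing is lost since `r 0` contains `(1)_∞ =
    -- 0`.
    set r : ℕ → ℂ := fun n => x * q ^ n * (∏ j, qPoch q (a j * x) n) * qPochInf q (q ^ n) *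
      qPochInf q (q * x / y * q ^ n) * qPochInf q (q * x / w * q ^ n * q) with hr
    have hr0 : r 0 = 0 := by simp [hr, qPochInf_one hq1]
    have hrs : ∀ n, r (n + 1) = x * q * p * uTerm q a (x * q) y (w / q) n := by
      intro n
      simp only [hr, uTerm, Nat.cast_succ, qPoch_natCast_succ', Finset.prod_mul_distrib, ← mul_assoc]
      rw [show q * x / y * q ^ (n + 1) = q * x * q / y * q ^ n by ring,
        show q * x / w * q ^ (n + 1) * q = q * x * q / (w / q) * q ^ n by field_simp; ring,
        pow_succ' q n]
      ring
    have s1 := (summable_uTerm hq1 a x y w).mul_left (x * α)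
    have s2 : Summable r := by
      rw [← summable_nat_add_iff 1]
      simp only [hrs]
      exact (summable_uTerm hq1 a (x * q) y (w / q)).mul_left _
    have e : ∑' n, r n = x * q * p * uSum q a (x * q) y (w / q) := by
      rw [s2.tsum_eq_zero_add, hr0, zero_add, uSum, ← tsum_mul_left]
      exact tsum_congr hrs
    rw [mul_assoc β, ← e, ← tsum_mul_left, uSum, ← tsum_mul_left, ← s1.tsum_add (s2.mul_left β)]
    refine tsum_eq_of_telescope (s1.add (s2.mul_left β)) ?_
      (tendsto_telescope hq1 a x (x / y) (q * x / w)) fun n => ?_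
    · simp [qPochInf_one hq1]
    · have e1 := qPochInf_succ hq1 (q ^ n)
      have e2 := qPochInf_succ hq1 (x / y * q ^ n)
      have e3 := qPochInf_succ hq1 (q * x / w * q ^ n)
      have f1 : q * x / y * q ^ n = x / y * q ^ n * q := by ring
      have f4 : q * q ^ n = q ^ n * q := mul_comm _ _
      have hpz := hpoly (x * q ^ n)
      simp only [uTerm, hr, Nat.cast_succ, qPoch_natCast_succ, Finset.prod_mul_distrib]
      rw [f1, f4, pow_succ, ← mul_assoc (x / y), ← mul_assoc (q * x / w), e1, e2, e3]
      rw [show x * q ^ n / x = q ^ n by field_simp] at hpz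
      simp only [← mul_assoc] at hpz
      rw [show x * q ^ n / y = x / y * q ^ n by ring, show q * x * q ^ n / w = q * x / w * q ^ n by ring]
        at hpz
      linear_combination -(∏ j, qPoch q (a j * x) n) * qPochInf q (q ^ n * q) *
        qPochInf q (x / y * q ^ n * q) * qPochInf q (q * x / w * q ^ n * q) * hpz
  have hPx : ∏ j, qPochInf q (a j * x) = p * ∏ j, qPochInf q (a j * (x * q)) := by
    rw [hp, ← Finset.prod_mul_distrib]
    refine Finset.prod_congr rfl fun j _ => ?_
    rw [qPochInf_succ hq1, mul_assoc]
  have hmain : α * uComb q a x y w = -(β * p) * uComb q a (x * q) y (w / q) := by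
    unfold uComb
    rw [hPx] at hX ⊢
    linear_combination (p * ∏ j, qPochInf q (a j * (x * q))) * hY - (∏ j, qPochInf q (a j * y)) * hX
  have hα0 : α ≠ 0 := by
    rw [hα]
    exact div_ne_zero (mul_ne_zero (neg_ne_zero.2 hp0) hw) (mul_ne_zero hx hxw)
  refine mul_left_cancel₀ hα0 (hmain.trans ?_)
  rw [← mul_assoc]
  congr 1
  rw [hα, hβ]
  -- Each factor is reflected as `1 - a w/q = -(a w/q)(1 - q/(a w))`, and balancing removes `∏ a_j`
  -- from the prefactor.
  have hprod : ∏ j, (1 - a j * w / q) = -(w ^ 2 / (q ^ 2 * x * y)) * ∏ j, (1 - q / (a j * w)) := by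
    simp only [Fin.prod_univ_three] at hbal ⊢
    have h0 := ha 0
    have h1 := ha 1
    have h2 := ha 2
    have hy' : y = q / (a 0 * a 1 * a 2 * x * w) := by
      field_simp
      linear_combination hbal
    rw [hy']
    field_simp
    ring
  rw [hprod]
  field_simp

end QSeries

/-! ### Iteration of the contiguous relation and its limit -/

namespace QSeries

open Filter Topology Polynomial

variable {q : ℂ} {a : Fin 3 → ℂ}

/-- The recursion sends `x` to `0` and `w` to infinity. Its prefactor `∏ (-(x/y) q ^ i)` decays
quadratically in the exponent, while the factor `(q y / (x q ^ n) …)_∞` of the first series can grow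
at the same rate; `vFactor` pairs the two. -/
theorem uComb_iterate (hq0 : q ≠ 0) (hq1 : ‖q‖ < 1) {x y w : ℂ}
    (hbal : (∏ j, a j) * (x * y * w) = q) (hxw : ∀ m : ℤ, w / x ≠ q ^ m)
    (hax : ∀ j, ∀ m : ℤ, a j * x ≠ q ^ m) (n : ℕ) :
    uComb q a x y w = (∏ j, qPoch q (q / (a j * w)) n) *
      (∏ i ∈ Finset.range n, -(x / y * q ^ i)) * uComb q a (x * q ^ n) y (w / q ^ n) := by
  have hne : (∏ j, a j) * (x * y * w) ≠ 0 := hbal ▸ hq0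
  simp only [mul_ne_zero_iff, Finset.prod_ne_zero_iff, Finset.mem_univ, true_implies] at hne
  obtain ⟨ha, ⟨hx, hy⟩, hw⟩ := hne
  induction n with
  | zero => simp
  | succ n ih =>
    have hqn := pow_ne_zero n hq0
    have hbal' : (∏ j, a j) * (x * q ^ n * y * (w / q ^ n)) = q := by
      rw [show x * q ^ n * y * (w / q ^ n) = x * y * w by field_simp, hbal]
    have hxw' : w / q ^ n - q * (x * q ^ n) ≠ 0 := by
      intro e
      refine hxw (n + n + 1 : ℕ) ?_
      rw [zpow_natCast, div_eq_iff hx]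
      field_simp at e
      linear_combination e
    have hax' : ∀ j, 1 - a j * (x * q ^ n) ≠ 0 := fun j => by
      rw [← mul_assoc]
      simpa using one_sub_mul_zpow_ne_zero (hax j) n
    rw [ih, uComb_contiguous hq0 hq1 hbal' hxw' hax', Finset.prod_range_succ]
    simp only [Nat.cast_succ, qPoch_natCast_succ, Finset.prod_mul_distrib]
    have e1 : x * q ^ n * q = x * q ^ (n + 1) := by ring
    have e2 : w / q ^ n / q = w / q ^ (n + 1) := by rw [pow_succ]; field_simp
    have e3 : ∀ j, q / (a j * (w / q ^ n)) = q / (a j * w) * q ^ n := fun j => by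
      have := ha j
      field_simp
    rw [e1, e2]
    simp only [e3]
    ring

/-- The value of the divergent factor of the unilateral series after normalization. -/
noncomputable def vFactor (q X : ℂ) (n m : ℕ) : ℂ :=
  (∏ i ∈ Finset.range n, -(X * q ^ i)) * qPochInf q (q / (X * q ^ n) * q ^ m)

theorem vFactor_succ_succ (hq0 : q ≠ 0) {X : ℂ} (hX : X ≠ 0) (n m : ℕ) :
    vFactor q X (n + 1) (m + 1) = -(X * q ^ n) * vFactor q X n m := by
  unfold vFactor
  rw [Finset.prod_range_succ, show q / (X * q ^ (n + 1)) * q ^ (m + 1) = q / (X * q ^ n) * q ^ m by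
    rw [pow_succ, pow_succ]; field_simp]
  ring

/-- Each step uses `-(X q ^ n)(1 - 1/(X q ^ n)) = 1 - X q ^ n`, which exchanges a growing factor of
the infinite product for a convergent one. -/
theorem vFactor_zero (hq0 : q ≠ 0) (hq1 : ‖q‖ < 1) {X : ℂ} (hX : X ≠ 0) (n : ℕ) :
    vFactor q X n 0 = (∏ i ∈ Finset.range n, (1 - X * q ^ i)) * qPochInf q (q / X) := by
  induction n with
  | zero => simp [vFactor]
  | succ n ih =>
    rw [Finset.prod_range_succ, mul_right_comm, ← ih]
    unfold vFactor
    have hqn := pow_ne_zero n hq0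
    rw [Finset.prod_range_succ, qPochInf_succ hq1 (q / (X * q ^ (n + 1)) * q ^ 0),
      show q / (X * q ^ (n + 1)) * q ^ 0 * q = q / (X * q ^ n) * q ^ 0 by
        rw [pow_succ]; field_simp,
      show q / (X * q ^ (n + 1)) * q ^ 0 = 1 / (X * q ^ n) by rw [pow_succ]; field_simp]
    field_simp
    ring

/-- A bound uniform in both indices, as dominated convergence requires. In the induction on `n` the
case `m = 0` gains `1 - X q ^ n` and the case `m > 0` gains `-X q ^ n`; both are at most `1 + ‖X‖
‖q‖ ^ n` in norm. -/
theorem norm_vFactor_le (hq0 : q ≠ 0) (hq1 : ‖q‖ < 1) {X : ℂ} (hX : X ≠ 0) (n m : ℕ) :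
    ‖vFactor q X n m‖ ≤ qBound q ‖X‖ * qBound q ‖q / X‖ := by
  have key : ∀ n m : ℕ, ‖vFactor q X n m‖ ≤
      (∏ i ∈ Finset.range n, (1 + ‖X‖ * ‖q‖ ^ i)) * qBound q ‖q / X‖ := by
    intro n
    induction n with
    | zero =>
      intro m
      simpa [vFactor] using norm_qPochInf_le_qBound hq1 (norm_mul_pow_le hq1 (le_refl ‖q / X‖) m)
    | succ n ih =>
      intro m
      rw [Finset.prod_range_succ, mul_right_comm, mul_comm]
      have hB : 0 ≤ (∏ i ∈ Finset.range n, (1 + ‖X‖ * ‖q‖ ^ i)) * qBound q ‖q / X‖ :=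
        (norm_nonneg _).trans (ih 0)
      cases m with
      | zero =>
        rw [vFactor_zero hq0 hq1 hX, Finset.prod_range_succ, mul_right_comm, ← vFactor_zero hq0 hq1 hX,
          mul_comm, norm_mul]
        refine mul_le_mul ?_ (ih 0) (norm_nonneg _) (by positivity)
        refine (norm_sub_le _ _).trans ?_
        rw [norm_one, norm_mul, norm_pow]
      | succ m =>
        rw [vFactor_succ_succ hq0 hX, norm_mul]
        refine mul_le_mul ?_ (ih m) (norm_nonneg _) (by positivity)
        rw [norm_neg, norm_mul, norm_pow]
        linarith
  exact (key n m).trans (mul_le_mul_of_nonneg_right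
    (prod_one_add_le_qBound hq1 (norm_nonneg X) n) (qBound_pos q _).le)

theorem tendsto_vFactor_zero (hq0 : q ≠ 0) (hq1 : ‖q‖ < 1) {X : ℂ} (hX : X ≠ 0) :
    Tendsto (fun n => vFactor q X n 0) atTop (𝓝 (qTheta q X)) := by
  simp only [vFactor_zero hq0 hq1 hX]
  exact (tendsto_prod_qPochInf hq1 X).mul_const _

theorem tendsto_vFactor_succ (hq0 : q ≠ 0) (hq1 : ‖q‖ < 1) {X : ℂ} (hX : X ≠ 0) (m : ℕ) :
    Tendsto (fun n => vFactor q X n (m + 1)) atTop (𝓝 0) := by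
  rw [← tendsto_add_atTop_iff_nat 1]
  simp only [vFactor_succ_succ hq0 hX]
  have h : Tendsto (fun n : ℕ => -(X * q ^ n)) atTop (𝓝 0) := by
    simpa using ((tendsto_pow_atTop_nhds_zero_of_norm_lt_one hq1).const_mul X).neg
  exact h.zero_mul_isBoundedUnder_le
    (isBoundedUnder_of ⟨_, fun n => norm_vFactor_le hq0 hq1 hX n m⟩)

/-- Dominated convergence in the summation index `m`: by the limits of `vFactor` only the term `m =
0` survives, and it tends to `(q)_∞ θ(x/y)`. -/
theorem tendsto_uSum_first (hq0 : q ≠ 0) (hq1 : ‖q‖ < 1) {x y w : ℂ} (hx : x ≠ 0) (hy : y ≠ 0)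
    (hw : w ≠ 0) :
    Tendsto (fun n : ℕ => (∏ i ∈ Finset.range n, -(x / y * q ^ i)) *
      uSum q a y (x * q ^ n) (w / q ^ n)) atTop (𝓝 (qPochInf q q * qTheta q (x / y))) := by
  have hX : x / y ≠ 0 := div_ne_zero hx hy
  have hterm : ∀ n m : ℕ, (∏ i ∈ Finset.range n, -(x / y * q ^ i)) *
      uTerm q a y (x * q ^ n) (w / q ^ n) m =
      q ^ m * (∏ j, qPoch q (a j * y) m) * qPochInf q (q * q ^ m) * vFactor q (x / y) n m *
        qPochInf q (q * y / w * q ^ m * q ^ n) := by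
    intro n m
    have hqn := pow_ne_zero n hq0
    unfold uTerm vFactor
    rw [show q * y / (x * q ^ n) * q ^ m = q / (x / y * q ^ n) * q ^ m by field_simp,
      show q * y / (w / q ^ n) * q ^ m = q * y / w * q ^ m * q ^ n by field_simp]
    ring
  set S := ∑ j, ‖a j * y‖ with hS
  have hSj : ∀ j, ‖a j * y‖ ≤ S := fun j =>
    Finset.single_le_sum (f := fun j => ‖a j * y‖) (fun _ _ => norm_nonneg _) (Finset.mem_univ j)
  set B := qBound q S ^ 3 * qBound q 1 * (qBound q ‖x / y‖ * qBound q ‖q / (x / y)‖) *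
    qBound q ‖q * y / w‖ with hB
  have hlim := tendsto_tsum_of_dominated_convergence (𝓕 := atTop)
    (f := fun (n m : ℕ) => (∏ i ∈ Finset.range n, -(x / y * q ^ i)) *
      uTerm q a y (x * q ^ n) (w / q ^ n) m)
    (g := fun m : ℕ => if m = 0 then qPochInf q q * qTheta q (x / y) else 0)
    (bound := fun m => ‖q‖ ^ m * B)
    ((summable_geometric_of_lt_one (norm_nonneg q) hq1).mul_right _) ?_ ?_
  · rw [tsum_ite_eq] at hlim
    refine hlim.congr fun n => ?_
    rw [tsum_mul_left, uSum]
  · intro m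
    simp only [hterm]
    have h1 := tendsto_qPochInf_mul_pow hq1 (q * y / w * q ^ m)
    cases m with
    | zero =>
      have := ((tendsto_vFactor_zero hq0 hq1 hX).const_mul (qPochInf q q)).mul h1
      simpa using this
    | succ m =>
      have := ((tendsto_vFactor_succ hq0 hq1 hX m).const_mul (q ^ (m + 1) *
        (∏ j, qPoch q (a j * y) (m + 1 : ℕ)) * qPochInf q (q * q ^ (m + 1)))).mul h1
      simpa using this
  · refine .of_forall fun n m => ?_
    rw [hterm]
    have p1 := (qBound_pos q S).le
    have p2 := (qBound_pos q 1).le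
    have p3 := (qBound_pos q ‖x / y‖).le
    have p4 := (qBound_pos q ‖q / (x / y)‖).le
    have e1 := norm_prod_three_le fun j => norm_qPoch_le_qBound hq1 (hSj j) m
    have e2 := norm_qPochInf_le_qBound hq1 (norm_mul_pow_le hq1 hq1.le m)
    have e3 := norm_vFactor_le hq0 hq1 hX n m
    have e4 := norm_qPochInf_le_qBound hq1
      (norm_mul_pow_le hq1 (norm_mul_pow_le hq1 (le_refl ‖q * y / w‖) m) n)
    rw [norm_mul, norm_mul, norm_mul, norm_mul, norm_pow, mul_assoc (‖q‖ ^ m), mul_assoc (‖q‖ ^ m),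
      mul_assoc (‖q‖ ^ m), hB]
    gcongr

/-- Here all arguments shrink, so the series and the prefactor are bounded and the explicit factor
`x q ^ n` forces the limit to be zero. -/
theorem tendsto_uSum_second (hq0 : q ≠ 0) (hq1 : ‖q‖ < 1) {x y w : ℂ} (hw : w ≠ 0) :
    Tendsto (fun n : ℕ => (∏ i ∈ Finset.range n, -(x / y * q ^ i)) *
      (x * q ^ n * uSum q a (x * q ^ n) y (w / q ^ n))) atTop (𝓝 0) := by
  set R := ∑ j, ‖a j * x‖ + ‖q * x / y‖ + ‖q * x / w‖ with hR
  have hs : ∀ j, ‖a j * x‖ ≤ ∑ j, ‖a j * x‖ := fun j =>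
    Finset.single_le_sum (f := fun j => ‖a j * x‖) (fun _ _ => norm_nonneg _) (Finset.mem_univ j)
  have n0 : 0 ≤ ∑ j, ‖a j * x‖ := Finset.sum_nonneg fun _ _ => norm_nonneg _
  have n1 := norm_nonneg (q * x / y)
  have n2 := norm_nonneg (q * x / w)
  set B := qBound q R ^ 3 * qBound q 1 * qBound q R * qBound q R with hB
  have hbd : ∀ n : ℕ, ‖uSum q a (x * q ^ n) y (w / q ^ n)‖ ≤ (1 - ‖q‖)⁻¹ * B := by
    intro n
    refine tsum_of_norm_bounded ((hasSum_geometric_of_lt_one (norm_nonneg q) hq1).mul_right B)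
      (norm_uTerm_le hq1 (fun j => ?_) ?_ ?_)
    · rw [← mul_assoc]
      exact norm_mul_pow_le hq1 ((hs j).trans (by linarith)) n
    · rw [show q * (x * q ^ n) / y = q * x / y * q ^ n by ring]
      exact norm_mul_pow_le hq1 (by linarith) n
    · have hqn := pow_ne_zero n hq0
      rw [show q * (x * q ^ n) / (w / q ^ n) = q * x / w * q ^ n * q ^ n by field_simp]
      exact norm_mul_pow_le hq1 (norm_mul_pow_le hq1 (by linarith) n) n
  have hc : ∀ n : ℕ, ‖∏ i ∈ Finset.range n, -(x / y * q ^ i)‖ ≤ qBound q ‖x / y‖ := by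
    intro n
    refine le_trans ?_ (prod_one_add_le_qBound hq1 (norm_nonneg (x / y)) n)
    rw [norm_prod]
    refine Finset.prod_le_prod (fun _ _ => norm_nonneg _) fun i _ => ?_
    rw [norm_neg, norm_mul, norm_pow]
    linarith
  have h0 : Tendsto (fun n : ℕ => x * q ^ n) atTop (𝓝 0) := by
    simpa using (tendsto_pow_atTop_nhds_zero_of_norm_lt_one hq1).const_mul x
  have h1 := h0.zero_mul_isBoundedUnder_le (g := fun n : ℕ =>
    (∏ i ∈ Finset.range n, -(x / y * q ^ i)) * uSum q a (x * q ^ n) y (w / q ^ n))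
    (isBoundedUnder_of ⟨qBound q ‖x / y‖ * ((1 - ‖q‖)⁻¹ * B), fun n => by
      simp only [Function.comp_apply, norm_mul]
      exact mul_le_mul (hc n) (hbd n) (norm_nonneg _) (qBound_pos q _).le⟩)
  exact h1.congr fun n => by ring

/-- The nonterminating `q`-Saalschütz summation. -/
theorem uComb_eq (hq0 : q ≠ 0) (hq1 : ‖q‖ < 1) {x y w : ℂ}
    (hbal : (∏ j, a j) * (x * y * w) = q) (hxw : ∀ m : ℤ, w / x ≠ q ^ m)
    (hax : ∀ j, ∀ m : ℤ, a j * x ≠ q ^ m) :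
    uComb q a x y w =
      qPochInf q q * (∏ j, qPochInf q (q / (a j * w))) * (y * qTheta q (x / y)) := by
  have hne : (∏ j, a j) * (x * y * w) ≠ 0 := hbal ▸ hq0
  simp only [mul_ne_zero_iff, Finset.prod_ne_zero_iff, Finset.mem_univ, true_implies] at hne
  obtain ⟨ha, ⟨hx, hy⟩, hw⟩ := hne
  have h1 : Tendsto (fun n : ℕ => ∏ j, qPoch q (q / (a j * w)) n) atTop
      (𝓝 (∏ j, qPochInf q (q / (a j * w)))) :=
    tendsto_finsetProd _ fun j _ => tendsto_prod_qPochInf hq1 _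
  have h2 : Tendsto (fun n : ℕ => ∏ j, qPochInf q (a j * x * q ^ n)) atTop (𝓝 1) := by
    have := tendsto_finsetProd Finset.univ fun j (_ : j ∈ Finset.univ) =>
      tendsto_qPochInf_mul_pow hq1 (a j * x)
    simpa using this
  have h3 := (((tendsto_uSum_first (a := a) hq0 hq1 hx hy hw).mul h2).const_mul y).sub
    ((tendsto_uSum_second (a := a) (y := y) (x := x) hq0 hq1 hw).mul_const
      (∏ j, qPochInf q (a j * y)))
  have h4 := h1.mul h3
  have h5 : Tendsto (fun _ : ℕ => uComb q a x y w) atTop (𝓝 (uComb q a x y w)) :=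
    tendsto_const_nhds
  rw [tendsto_nhds_unique h5 (h4.congr fun n => ?_)]
  · ring
  · rw [uComb_iterate hq0 hq1 hbal hxw hax n]
    unfold uComb
    simp only [mul_assoc]
    ring

end QSeries

namespace QSeries

open Filter Topology Polynomial

/-! ### The determinant evaluation -/

variable {q : ℂ} {a b : Fin 3 → ℂ}

/-- Holomorphic theta functions of degree three with multiplier `-(t z ^ 3)⁻¹`. -/
def IsTheta3 (q t : ℂ) (f : ℂ → ℂ) : Prop :=
  DifferentiableOn ℂ f {0}ᶜ ∧ ∀ z ≠ 0, f (z * q) = -(t * z ^ 3)⁻¹ * f z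

theorem IsTheta3.const_mul {t : ℂ} {f : ℂ → ℂ} (hf : IsTheta3 q t f) (c : ℂ) :
    IsTheta3 q t fun z => c * f z :=
  ⟨hf.1.const_mul c, fun z hz => by beta_reduce; rw [hf.2 z hz]; ring⟩

theorem IsTheta3.add {t : ℂ} {f g : ℂ → ℂ} (hf : IsTheta3 q t f) (hg : IsTheta3 q t g) :
    IsTheta3 q t fun z => f z + g z :=
  ⟨hf.1.add hg.1, fun z hz => by beta_reduce; rw [hf.2 z hz, hg.2 z hz]; ring⟩

theorem differentiableOn_qTheta_const_mul (hq1 : ‖q‖ < 1) {c : ℂ} (hc : c ≠ 0) :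
    DifferentiableOn ℂ (fun z => qTheta q (c * z)) {0}ᶜ :=
  (differentiableOn_qTheta hq1).comp (by fun_prop) fun _ hz => mul_ne_zero hc hz

theorem differentiableOn_qTheta_const_div (hq1 : ‖q‖ < 1) {c : ℂ} (hc : c ≠ 0) :
    DifferentiableOn ℂ (fun z => qTheta q (c / z)) {0}ᶜ :=
  (differentiableOn_qTheta hq1).comp
    (fun _ hz => ((differentiableAt_const c).div differentiableAt_id hz).differentiableWithinAt)
    fun _ hz => div_ne_zero hc hz

theorem qTheta_div_mul_q (hq0 : q ≠ 0) (hq1 : ‖q‖ < 1) {c z : ℂ} (hc : c ≠ 0) (hz : z ≠ 0) :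
    qTheta q (c / (z * q)) = -(c / (z * q)) * qTheta q (c / z) := by
  have h : c / (z * q) ≠ 0 := div_ne_zero hc (mul_ne_zero hz hq0)
  have := qTheta_mul_q hq0 hq1 h
  rw [show c / (z * q) * q = c / z by field_simp] at this
  rw [this]
  field_simp

/-- The product `∏_j θ(a_j z)`. -/
noncomputable def thetaA (q : ℂ) (a : Fin 3 → ℂ) (z : ℂ) : ℂ := ∏ j, qTheta q (a j * z)

/-- The product `∏_j θ(b_j / z)`. -/
noncomputable def thetaB (q : ℂ) (b : Fin 3 → ℂ) (z : ℂ) : ℂ := ∏ j, qTheta q (b j / z)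

theorem isTheta3_thetaA (hq0 : q ≠ 0) (hq1 : ‖q‖ < 1) (ha : ∀ j, a j ≠ 0) :
    IsTheta3 q (∏ j, a j) (thetaA q a) := by
  refine ⟨DifferentiableOn.fun_finsetProd fun j _ => differentiableOn_qTheta_const_mul hq1 (ha j),
    fun z hz => ?_⟩
  unfold thetaA
  simp_rw [← mul_assoc]
  rw [Finset.prod_congr rfl fun j _ => qTheta_mul_q hq0 hq1 (mul_ne_zero (ha j) hz),
    Finset.prod_mul_distrib]
  simp only [Fin.prod_univ_three]
  have := ha 0
  have := ha 1
  have := ha 2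
  field_simp

/-- By balancing, `∏ θ(b_j/z)` has multiplier `-(q² t z³)⁻¹`; the factor `z²` removes the `q²`. The
single factor `z` in `isTheta3_gSum` has the same role. -/
theorem isTheta3_thetaB (hq0 : q ≠ 0) (hq1 : ‖q‖ < 1) (h : GenericParameters q a b) :
    IsTheta3 q (∏ j, a j) fun z => z ^ 2 * thetaB q b z := by
  have ha := h.a_ne_zero hq0
  have hb := h.b_ne_zero hq0
  refine ⟨DifferentiableOn.mul (by fun_prop) (DifferentiableOn.fun_finsetProd fun j _ =>
    differentiableOn_qTheta_const_div hq1 (hb j)), fun z hz => ?_⟩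
  have hbal := h.balance
  unfold thetaB
  beta_reduce
  rw [Finset.prod_congr rfl fun j _ => qTheta_div_mul_q hq0 hq1 (hb j) hz,
    Finset.prod_mul_distrib]
  simp only [Fin.prod_univ_three] at hbal ⊢
  have := ha 0
  have := ha 1
  have := ha 2
  generalize qTheta q (b 0 / z) * qTheta q (b 1 / z) * qTheta q (b 2 / z) = T
  field_simp
  linear_combination -T * hbal

theorem isTheta3_gSum (hq0 : q ≠ 0) (hq1 : ‖q‖ < 1) (h : GenericParameters q a b) :
    IsTheta3 q (∏ j, a j) fun z => z * gSum q a b z := by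
  refine ⟨differentiableOn_id.mul
    (differentiableOn_gSum hq1 (h.a_ne_zero hq0) (h.b_ne_zero hq0)), fun z hz => ?_⟩
  beta_reduce
  rw [gSum_mul_q hq0 hq1 h hz]
  have : ∏ j, a j ≠ 0 := Finset.prod_ne_zero_iff.2 fun j _ => h.a_ne_zero hq0 j
  field_simp

/-- The theta Vandermonde product. -/
noncomputable def thetaVandermonde (q t u v w : ℂ) : ℂ :=
  qTheta q (t * u * v * w) * (v * qTheta q (u / v)) * (w * qTheta q (u / w)) *
    (w * qTheta q (v / w))

theorem isTheta3_thetaVandermonde (hq0 : q ≠ 0) (hq1 : ‖q‖ < 1) {t u v : ℂ} (ht : t ≠ 0)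
    (hu : u ≠ 0) (hv : v ≠ 0) : IsTheta3 q t (thetaVandermonde q t u v) := by
  have htuv : t * u * v ≠ 0 := mul_ne_zero (mul_ne_zero ht hu) hv
  refine ⟨?_, fun z hz => ?_⟩
  · exact (((differentiableOn_qTheta_const_mul hq1 htuv).mul_const _).mul
      (differentiableOn_id.mul (differentiableOn_qTheta_const_div hq1 hu))).mul
      (differentiableOn_id.mul (differentiableOn_qTheta_const_div hq1 hv))
  · unfold thetaVandermonde
    rw [qTheta_div_mul_q hq0 hq1 hu hz, qTheta_div_mul_q hq0 hq1 hv hz, ← mul_assoc _ z q,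
      qTheta_mul_q hq0 hq1 (mul_ne_zero htuv hz)]
    field_simp

theorem mul_qTheta_div_swap (hq0 : q ≠ 0) (hq1 : ‖q‖ < 1) {u v : ℂ} (hu : u ≠ 0) (hv : v ≠ 0) :
    u * qTheta q (v / u) = -(v * qTheta q (u / v)) := by
  have := qTheta_inv hq0 hq1 (div_ne_zero hu hv)
  rw [inv_div] at this
  rw [this]
  field_simp

theorem qTheta_one (hq1 : ‖q‖ < 1) : qTheta q 1 = 0 := by simp [qTheta, qPochInf_one hq1]

/-- The three by three determinant with rows `z G(z), z ^ 2 B(z), A(z)`. -/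
noncomputable def thetaDet (q : ℂ) (a b : Fin 3 → ℂ) (u v w : ℂ) : ℂ :=
  u * gSum q a b u * (v ^ 2 * thetaB q b v * thetaA q a w - w ^ 2 * thetaB q b w * thetaA q a v) +
  v * gSum q a b v * (w ^ 2 * thetaB q b w * thetaA q a u - u ^ 2 * thetaB q b u * thetaA q a w) +
  w * gSum q a b w * (u ^ 2 * thetaB q b u * thetaA q a v - v ^ 2 * thetaB q b v * thetaA q a u)

/-- The constant of proportionality between the determinant and the Vandermonde product. -/
noncomputable def detConst (q : ℂ) (a b : Fin 3 → ℂ) : ℂ :=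
  qPochInf q q * ∏ i, ∏ j, qPochInf q (q / (a i * b j))

/-- The difference of the two sides of the determinant evaluation. -/
noncomputable def detDefect (q : ℂ) (a b : Fin 3 → ℂ) (u v w : ℂ) : ℂ :=
  thetaDet q a b u v w - detConst q a b * thetaVandermonde q (∏ j, a j) u v w

theorem detDefect_self_right (hq1 : ‖q‖ < 1) {u v : ℂ} (hv : v ≠ 0) :
    detDefect q a b u v v = 0 := by
  unfold detDefect thetaDet thetaVandermonde
  rw [div_self hv, qTheta_one hq1]
  ring

theorem detDefect_self_outer (hq1 : ‖q‖ < 1) {u v : ℂ} (hu : u ≠ 0) :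
    detDefect q a b u v u = 0 := by
  unfold detDefect thetaDet thetaVandermonde
  rw [div_self hu, qTheta_one hq1]
  ring

theorem detDefect_swap_left (hq0 : q ≠ 0) (hq1 : ‖q‖ < 1) {u v w : ℂ} (hu : u ≠ 0) (hv : v ≠ 0) :
    detDefect q a b v u w = -detDefect q a b u v w := by
  unfold detDefect thetaDet thetaVandermonde
  rw [mul_qTheta_div_swap hq0 hq1 hu hv, mul_right_comm _ v u]
  ring

theorem detDefect_swap_right (hq0 : q ≠ 0) (hq1 : ‖q‖ < 1) {u v w : ℂ} (hv : v ≠ 0) (hw : w ≠ 0) :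
    detDefect q a b u w v = -detDefect q a b u v w := by
  unfold detDefect thetaDet thetaVandermonde
  rw [mul_qTheta_div_swap hq0 hq1 hv hw, mul_right_comm _ w v]
  ring

/-- In its last variable the defect is a linear combination of `A`, `z² B`, `z G` and the
Vandermonde product, all with the same multiplier. -/
theorem isTheta3_detDefect (hq0 : q ≠ 0) (hq1 : ‖q‖ < 1) (h : GenericParameters q a b) {u v : ℂ}
    (hu : u ≠ 0) (hv : v ≠ 0) : IsTheta3 q (∏ j, a j) (detDefect q a b u v) := by
  have ha := h.a_ne_zero hq0
  have hA := isTheta3_thetaA hq0 hq1 ha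
  have hB := isTheta3_thetaB hq0 hq1 h
  have hG := isTheta3_gSum hq0 hq1 h
  have hV := isTheta3_thetaVandermonde (t := ∏ j, a j) hq0 hq1
    (Finset.prod_ne_zero_iff.2 fun j _ => ha j) hu hv
  have := ((hA.const_mul (u * gSum q a b u * (v ^ 2 * thetaB q b v) -
      v * gSum q a b v * (u ^ 2 * thetaB q b u))).add
    (hB.const_mul (v * gSum q a b v * thetaA q a u - u * gSum q a b u * thetaA q a v))).add
    ((hG.const_mul (u ^ 2 * thetaB q b u * thetaA q a v - v ^ 2 * thetaB q b v * thetaA q a u)).add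
    (hV.const_mul (-detConst q a b)))
  convert! this using 1
  funext w
  unfold detDefect thetaDet
  ring

/-- Every term of negative index contains `(b_i / b_i)_n = (1)_n` with `n > 0`, which is zero. -/
theorem gSum_at_b (hb : ∀ j, b j ≠ 0) (i : Fin 3) :
    gSum q a b (b i) = ∑' n : ℕ, gTerm q a b (b i) n := by
  refine (Function.Injective.tsum_eq Nat.cast_injective fun x hx => ?_).symm
  obtain ⟨n, rfl | rfl⟩ := x.eq_nat_or_neg
  · exact ⟨n, rfl⟩
  · cases n with
    | zero => exact ⟨0, by simp⟩
    | succ n =>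
      refine absurd ?_ hx
      rw [gTerm_neg_natCast, Finset.prod_eq_zero (Finset.mem_univ i), mul_zero]
      rw [div_self (hb i), Nat.cast_succ, qPoch_natCast_succ']
      simp

theorem gSum_b0 (hb : ∀ j, b j ≠ 0) :
    gSum q a b (b 0) = (∏ j, qPochInf q (q / (a j * b 0))) * uSum q a (b 0) (b 1) (b 2) := by
  rw [gSum_at_b hb, uSum, ← tsum_mul_left]
  refine tsum_congr fun n => ?_
  have := hb 0
  rw [gTerm_natCast, uTerm, Finset.prod_mul_distrib, Finset.prod_mul_distrib,
    Fin.prod_univ_three fun j => qPochInf q (q * b 0 / b j * q ^ n), mul_div_cancel_right₀ _ this]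
  ring

theorem gSum_b1 (hb : ∀ j, b j ≠ 0) :
    gSum q a b (b 1) = (∏ j, qPochInf q (q / (a j * b 1))) * uSum q a (b 1) (b 0) (b 2) := by
  rw [gSum_at_b hb, uSum, ← tsum_mul_left]
  refine tsum_congr fun n => ?_
  have := hb 1
  rw [gTerm_natCast, uTerm, Finset.prod_mul_distrib, Finset.prod_mul_distrib,
    Fin.prod_univ_three fun j => qPochInf q (q * b 1 / b j * q ^ n), mul_div_cancel_right₀ _ this]
  ring

theorem thetaB_b (hq1 : ‖q‖ < 1) (hb : ∀ j, b j ≠ 0) (i : Fin 3) : thetaB q b (b i) = 0 :=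
  Finset.prod_eq_zero (Finset.mem_univ i) (by rw [div_self (hb i), qTheta_one hq1])

/-- Since `B(b_0) = B(b_1) = 0`, only the two products containing `w² B(w)` survive in the
determinant. In the Vandermonde product `t b_0 b_1 w = q w / b_2`, so its theta factors also
assemble into `w² B(w)`. The cofactor of `w² B(w)` is the `q`-Saalschütz sum with `(x, y, w) = (b_0,
b_1, b_2)`. -/
theorem detDefect_b0_b1 (hq0 : q ≠ 0) (hq1 : ‖q‖ < 1) (h : GenericParameters q a b) {w : ℂ}
    (hw : w ≠ 0) : detDefect q a b (b 0) (b 1) w = 0 := by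
  have hb := h.b_ne_zero hq0
  have hbal := h.balance
  rw [Fin.prod_univ_three b] at hbal
  have hS := uComb_eq hq0 hq1 hbal (h.b_div_b 2 0 (by decide)) (fun j => h.a_mul_b j 0)
  unfold uComb at hS
  have hA : ∀ z, thetaA q a z =
      (∏ j, qPochInf q (a j * z)) * ∏ j, qPochInf q (q / (a j * z)) := fun z => by
    rw [thetaA, ← Finset.prod_mul_distrib]; rfl
  have e1 : qTheta q ((∏ j, a j) * b 0 * b 1 * w) = qTheta q (b 2 / w) := by
    rw [← qTheta_q_div hq0 (b 2 / w)]
    congr 1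
    have := hb 2
    field_simp
    linear_combination hbal
  have e2 : thetaB q b w = qTheta q (b 0 / w) * qTheta q (b 1 / w) * qTheta q (b 2 / w) := by
    rw [thetaB, Fin.prod_univ_three]
  have e3 : ∏ i, ∏ j, qPochInf q (q / (a i * b j)) = (∏ i, qPochInf q (q / (a i * b 0))) *
      (∏ i, qPochInf q (q / (a i * b 1))) * ∏ i, qPochInf q (q / (a i * b 2)) := by
    rw [← Finset.prod_mul_distrib, ← Finset.prod_mul_distrib]
    exact Finset.prod_congr rfl fun i _ => Fin.prod_univ_three _
  unfold detDefect thetaDet detConst thetaVandermonde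
  rw [thetaB_b hq1 hb, thetaB_b hq1 hb, gSum_b0 hb, gSum_b1 hb, hA (b 0), hA (b 1), e1, e2, e3]
  linear_combination (w ^ 2 * qTheta q (b 0 / w) * qTheta q (b 1 / w) * qTheta q (b 2 / w)) *
    ((∏ i, qPochInf q (q / (a i * b 0))) * ∏ i, qPochInf q (q / (a i * b 1))) * hS

theorem div_ne_zpow_symm {x y : ℂ} (h : ∀ m : ℤ, x / y ≠ q ^ m) (m : ℤ) : y / x ≠ q ^ m := by
  intro e
  refine h (-m) ?_
  rw [zpow_neg, ← e, inv_div]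

/-- As a function of the last variable the defect vanishes at `u` and at `b_i`, so it is `k` times
an explicit product of three theta functions. At the further zero `b_i'` none of the three vanishes,
so `k = 0`. -/
theorem detDefect_b_right (hq0 : q ≠ 0) (hq1 : ‖q‖ < 1) (h : GenericParameters q a b) {u w : ℂ}
    (hu : u ≠ 0) (hw : w ≠ 0) (hub : ∀ j, ∀ m : ℤ, u / b j ≠ q ^ m) {i i' : Fin 3}
    (hii : i' ≠ i) (ht : (∏ j, a j) * (b i * b i' * b 2) = q)
    (h0 : detDefect q a b u (b i) (b i') = 0) : detDefect q a b u (b i) w = 0 := by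
  have hb := h.b_ne_zero hq0
  have ht0 : ∏ j, a j ≠ 0 := Finset.prod_ne_zero_iff.2 fun j _ => h.a_ne_zero hq0 j
  have hT := isTheta3_detDefect hq0 hq1 h hu (hb i)
  obtain ⟨k, hk⟩ := exists_eq_mul_qTheta_of_degree_three hq0 hq1 hT.1 ht0 hT.2 hu (hb i)
    (div_ne_zpow_symm (hub i)) (detDefect_self_outer hq1 hu) (detDefect_self_right hq1 (hb i))
  have h1 := hk _ (hb i')
  rw [h0] at h1
  have e : (∏ j, a j) * u * b i * b i' = u / b 2 * q := by
    have := hb 2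
    field_simp
    linear_combination ht
  have n1 := qTheta_ne_zero hq0 hq1 (div_ne_zero (hb i') hu) (div_ne_zpow_symm (hub i'))
  have n2 := qTheta_ne_zero hq0 hq1 (div_ne_zero (hb i') (hb i)) (h.b_div_b i' i hii)
  have n3 : qTheta q ((∏ j, a j) * u * b i * b i') ≠ 0 := by
    rw [e]
    refine qTheta_ne_zero hq0 hq1 (mul_ne_zero (div_ne_zero hu (hb 2)) hq0) fun m hm => ?_
    refine hub 2 (m - 1) ?_
    rw [zpow_sub_one₀ hq0, ← hm]
    field_simp
  have hk0 : k = 0 := by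
    by_contra hk0
    exact (mul_ne_zero (mul_ne_zero (mul_ne_zero hk0 n1) n2) n3) h1.symm
  rw [hk w hw, hk0]
  ring

/-- In the last variable the defect is `k θ(w/u) θ(w/v) θ(tuvw)`, and it also vanishes at `b_0` and
`b_1`. If `k ≠ 0`, the last factor vanishes at both points, so `tuv b_0` and `tuv b_1` are powers of
`q`, contrary to the genericity of `b_0 / b_1`. -/
theorem detDefect_eq_zero (hq0 : q ≠ 0) (hq1 : ‖q‖ < 1) (h : GenericParameters q a b) {u v w : ℂ}
    (hu : u ≠ 0) (hv : v ≠ 0) (hw : w ≠ 0) (hub : ∀ j, ∀ m : ℤ, u / b j ≠ q ^ m)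
    (hvb : ∀ j, ∀ m : ℤ, v / b j ≠ q ^ m) (hvu : ∀ m : ℤ, v / u ≠ q ^ m) :
    detDefect q a b u v w = 0 := by
  have hb := h.b_ne_zero hq0
  have hbal := h.balance
  rw [Fin.prod_univ_three b] at hbal
  have ht0 : ∏ j, a j ≠ 0 := Finset.prod_ne_zero_iff.2 fun j _ => h.a_ne_zero hq0 j
  have hu01 : detDefect q a b u (b 0) (b 1) = 0 := by
    rw [detDefect_swap_left hq0 hq1 (hb 0) hu, detDefect_swap_right hq0 hq1 (hb 1) hu,
      detDefect_b0_b1 hq0 hq1 h hu]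
    simp
  have hv0 : detDefect q a b u v (b 0) = 0 := by
    rw [detDefect_swap_right hq0 hq1 (hb 0) hv, detDefect_b_right hq0 hq1 h hu hv hub
      (i' := 1) (by decide) hbal hu01, neg_zero]
  have hv1 : detDefect q a b u v (b 1) = 0 := by
    rw [detDefect_swap_right hq0 hq1 (hb 1) hv, detDefect_b_right hq0 hq1 h hu hv hub
      (i' := 0) (by decide) (by linear_combination hbal)
      (by rw [detDefect_swap_right hq0 hq1 (hb 0) (hb 1), hu01, neg_zero]), neg_zero]
  have hT := isTheta3_detDefect hq0 hq1 h hu hv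
  obtain ⟨k, hk⟩ := exists_eq_mul_qTheta_of_degree_three hq0 hq1 hT.1 ht0 hT.2 hu hv
    hvu (detDefect_self_outer hq1 hu) (detDefect_self_right hq1 hv)
  by_cases hk0 : k = 0
  · rw [hk w hw, hk0]
    ring
  have key : ∀ i, detDefect q a b u v (b i) = 0 → ∃ m : ℤ, (∏ j, a j) * u * v * b i = q ^ m := by
    intro i hi
    rw [hk _ (hb i)] at hi
    have n1 := qTheta_ne_zero hq0 hq1 (div_ne_zero (hb i) hu) (div_ne_zpow_symm (hub i))
    have n2 := qTheta_ne_zero hq0 hq1 (div_ne_zero (hb i) hv) (div_ne_zpow_symm (hvb i))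
    have h0 := (mul_eq_zero.1 hi).resolve_left (mul_ne_zero (mul_ne_zero hk0 n1) n2)
    exact (qTheta_eq_zero_iff hq0 hq1
      (mul_ne_zero (mul_ne_zero (mul_ne_zero ht0 hu) hv) (hb i))).1 h0
  obtain ⟨m0, hm0⟩ := key 0 hv0
  obtain ⟨m1, hm1⟩ := key 1 hv1
  refine absurd ?_ (h.b_div_b 0 1 (by decide) (m0 - m1))
  rw [zpow_sub₀ hq0, ← hm0, ← hm1, mul_div_mul_left _ _ (mul_ne_zero (mul_ne_zero ht0 hu) hv)]

/-- The infinite products in `X_k` are exactly the factors that regularize the series at `λ_k`. -/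
theorem coeffX_mul_tsum (hq0 : q ≠ 0) (hq1 : ‖q‖ < 1) (h : GenericParameters q a b)
    {lam : Fin 3 → ℂ} (hn : GenericNodes q a b lam) (k : Fin 3) :
    coeffX q a b lam k * ∑' x, sumTerm q a b 1 (lam k) x =
      gSum q a b (lam k) *
        (lam (k + 1) / lam (k + 2) * (thetaA q a (lam (k + 2)) * thetaB q b (lam (k + 1))) -
        lam (k + 2) / lam (k + 1) * (thetaA q a (lam (k + 1)) * thetaB q b (lam (k + 2)))) := by
  unfold coeffX gSum thetaA thetaB
  simp_rw [gTerm_eq_sumTerm hq0 hq1 h (hn.ne_zero k) (fun j => hn.a_mul_lam j k)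
    (fun j => hn.lam_div_b j k)]
  rw [tsum_mul_left, ← Finset.prod_mul_distrib, ← Finset.prod_mul_distrib]
  ring

theorem summable_sumTerm_one (hq0 : q ≠ 0) (hq1 : ‖q‖ < 1) (h : GenericParameters q a b)
    {lam : Fin 3 → ℂ} (hn : GenericNodes q a b lam) (k : Fin 3) :
    Summable (sumTerm q a b 1 (lam k)) := by
  have hs := summable_gTerm hq1 (h.a_ne_zero hq0) (h.b_ne_zero hq0) (hn.ne_zero k)
  have hc : ∏ j, qPochInf q (q / (a j * lam k)) * qPochInf q (q * lam k / b j) ≠ 0 := by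
    refine Finset.prod_ne_zero_iff.2 fun j _ => mul_ne_zero ?_ ?_
    · refine qPochInf_ne_zero' hq1 fun m e => hn.a_mul_lam j k (1 - m) ?_
      rw [zpow_sub₀ hq0, zpow_one, ← e, div_div_cancel₀ hq0]
    · refine qPochInf_ne_zero' hq1 fun m e => hn.lam_div_b j k (m - 1) ?_
      rw [zpow_sub_one₀ hq0, ← e]
      field_simp
  rw [← summable_mul_left_iff hc]
  exact hs.congr fun x => gTerm_eq_sumTerm hq0 hq1 h (hn.ne_zero k) (fun j => hn.a_mul_lam j k)
    (fun j => hn.lam_div_b j k) x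

/-- The bilateral formula for the constant function `1`. -/
theorem coeffC_mul_sum_one (hq0 : q ≠ 0) (hq1 : ‖q‖ < 1) (h : GenericParameters q a b)
    {lam : Fin 3 → ℂ} (hn : GenericNodes q a b lam) :
    coeffC q a b lam * ∑ k, coeffX q a b lam k * ∑' x, sumTerm q a b 1 (lam k) x = 1 := by
  have hdet := detDefect_eq_zero hq0 hq1 h (hn.ne_zero 0) (hn.ne_zero 1) (hn.ne_zero 2)
    (fun j => hn.lam_div_b j 0) (fun j => hn.lam_div_b j 1) (hn.lam_div_lam 1 0 (by decide))
  have n0 := hn.ne_zero 0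
  have n1 := hn.ne_zero 1
  have n2 := hn.ne_zero 2
  have ha := h.a_ne_zero hq0
  have hb := h.b_ne_zero hq0
  have ht0 : ∏ j, a j ≠ 0 := Finset.prod_ne_zero_iff.2 fun j _ => ha j
  -- Cofactor expansion along the row of `z G(z)`; the factor `λ_0 λ_1 λ_2` turns the ratios
  -- `λ_{k+1}/λ_{k+2}` into the weights `z` and `z²` of the rows.
  have hsum : (lam 0 * lam 1 * lam 2) *
      ∑ k, coeffX q a b lam k * ∑' x, sumTerm q a b 1 (lam k) x =
      thetaDet q a b (lam 0) (lam 1) (lam 2) := by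
    simp only [coeffX_mul_tsum hq0 hq1 h hn]
    rw [Fin.sum_univ_three]
    unfold thetaDet
    simp only [Fin.isValue, zero_add, Fin.reduceAdd]
    field_simp
  have hκ : detConst q a b ≠ 0 := by
    refine mul_ne_zero (qPochInf_self_ne_zero hq1) (Finset.prod_ne_zero_iff.2 fun i _ =>
      Finset.prod_ne_zero_iff.2 fun j _ => qPochInf_ne_zero' hq1 fun m e => h.a_mul_b i j (1 - m) ?_)
    rw [zpow_sub₀ hq0, zpow_one, ← e, div_div_cancel₀ hq0]
  have hlam : ∀ i j, i ≠ j → qTheta q (lam i / lam j) ≠ 0 := fun i j hij =>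
    qTheta_ne_zero hq0 hq1 (div_ne_zero (hn.ne_zero i) (hn.ne_zero j)) (hn.lam_div_lam i j hij)
  have hT := qTheta_ne_zero hq0 hq1
    (mul_ne_zero ht0 (Finset.prod_ne_zero_iff.2 fun k _ => hn.ne_zero k)) hn.t_mul_lam
  have hV : qTheta q ((∏ j, a j) * ∏ k, lam k) *
      ∏ i, ∏ j ∈ Finset.Ioi i, lam j * qTheta q (lam i / lam j) =
      thetaVandermonde q (∏ j, a j) (lam 0) (lam 1) (lam 2) := by
    unfold thetaVandermonde
    rw [Fin.prod_univ_three lam, Fin.prod_univ_three fun i =>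
      ∏ j ∈ Finset.Ioi i, lam j * qTheta q (lam i / lam j),
      show Finset.Ioi (0 : Fin 3) = {1, 2} by decide, show Finset.Ioi (1 : Fin 3) = {2} by decide,
      show Finset.Ioi (2 : Fin 3) = ∅ by decide, Finset.prod_pair (by decide), Finset.prod_singleton,
      Finset.prod_empty, ← mul_assoc (∏ j, a j), ← mul_assoc (∏ j, a j)]
    ring
  have hVne : thetaVandermonde q (∏ j, a j) (lam 0) (lam 1) (lam 2) ≠ 0 := by
    rw [← hV]
    refine mul_ne_zero hT (Finset.prod_ne_zero_iff.2 fun i _ => Finset.prod_ne_zero_iff.2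
      fun j hj => mul_ne_zero (hn.ne_zero j) (hlam i j (Finset.mem_Ioi.1 hj).ne))
  have hC : coeffC q a b lam = lam 0 * lam 1 * lam 2 /
      (detConst q a b * thetaVandermonde q (∏ j, a j) (lam 0) (lam 1) (lam 2)) := by
    rw [← hV]
    unfold coeffC detConst
    rw [Fin.prod_univ_three lam]
    congr 1
    ring
  rw [hC, div_mul_eq_mul_div, hsum, sub_eq_zero.1 hdet, div_self (mul_ne_zero hκ hVne)]

end QSeries

namespace QSeries

open Filter Topology Polynomial

/-! ### Evaluation of rational functions -/

/-- The rational function `f` is regular at `z`, with value `v`. -/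
def HasEval (f : RatFunc ℂ) (z v : ℂ) : Prop :=
  ∃ p d : ℂ[X], d.eval z ≠ 0 ∧
    f * algebraMap ℂ[X] (RatFunc ℂ) d = algebraMap ℂ[X] (RatFunc ℂ) p ∧ v = p.eval z / d.eval z

namespace HasEval

variable {f g : RatFunc ℂ} {z v w : ℂ}

/-- The reduced denominator divides any denominator, in particular one not vanishing at `z`. This
gives access to `RatFunc.eval`, which is multiplicative only away from zeros of the reduced
denominators. -/
theorem denom_ne_zero (h : HasEval f z v) : f.denom.eval z ≠ 0 := by
  obtain ⟨p, d, hd, hf, -⟩ := h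
  have hd0 : d ≠ 0 := by rintro rfl; simp at hd
  have hf' : f = algebraMap ℂ[X] (RatFunc ℂ) p / algebraMap ℂ[X] (RatFunc ℂ) d :=
    (eq_div_iff (RatFunc.algebraMap_ne_zero hd0)).2 hf
  have hdvd : f.denom ∣ d := by rw [hf']; exact RatFunc.denom_div_dvd p d
  intro h0
  exact hd (eval_eq_zero_of_dvd_of_eval_eq_zero hdvd h0)

theorem eval_eq (h : HasEval f z v) : f.eval (RingHom.id ℂ) z = v := by
  have h0 := h.denom_ne_zero
  obtain ⟨p, d, hd, hf, rfl⟩ := h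
  have := RatFunc.eval_mul (f := RingHom.id ℂ) (a := z) (x := f)
    (y := algebraMap ℂ[X] (RatFunc ℂ) d) h0 (by simp)
  rw [hf, RatFunc.eval_algebraMap, RatFunc.eval_algebraMap] at this
  rw [eq_div_iff hd]
  exact this.symm

theorem mul (hf : HasEval f z v) (hg : HasEval g z w) : HasEval (f * g) z (v * w) := by
  obtain ⟨p, d, hd, hf, rfl⟩ := hf
  obtain ⟨p', d', hd', hg, rfl⟩ := hg
  refine ⟨p * p', d * d', by simp [hd, hd'], ?_, ?_⟩
  · rw [map_mul, map_mul, ← hf, ← hg]; ring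
  · rw [eval_mul, eval_mul]; field_simp

theorem sub (hf : HasEval f z v) (hg : HasEval g z w) : HasEval (f - g) z (v - w) := by
  obtain ⟨p, d, hd, hf, rfl⟩ := hf
  obtain ⟨p', d', hd', hg, rfl⟩ := hg
  refine ⟨p * d' - p' * d, d * d', by simp [hd, hd'], ?_, ?_⟩
  · rw [map_sub, map_mul, map_mul, map_mul, ← hf, ← hg]; ring
  · rw [eval_mul, eval_sub, eval_mul, eval_mul]; field_simp

theorem inv (hf : HasEval f z v) (hv : v ≠ 0) : HasEval f⁻¹ z v⁻¹ := by
  obtain ⟨p, d, hd, hf, rfl⟩ := hf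
  have hp : p.eval z ≠ 0 := fun h => hv (by simp [h])
  have hp0 : p ≠ 0 := by rintro rfl; simp at hp
  refine ⟨d, p, hp, ?_, by rw [inv_div]⟩
  have hf0 : f ≠ 0 := by
    rintro rfl
    rw [zero_mul] at hf
    exact RatFunc.algebraMap_ne_zero hp0 hf.symm
  rw [← hf, inv_mul_cancel_left₀ hf0]

theorem const (c z : ℂ) : HasEval (RatFunc.C c) z c :=
  ⟨C c, 1, by simp, by simp [RatFunc.algebraMap_C], by simp⟩

theorem one (z : ℂ) : HasEval 1 z 1 := ⟨1, 1, by simp, by simp, by simp⟩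

theorem X (z : ℂ) : HasEval RatFunc.X z z := ⟨Polynomial.X, 1, by simp, by simp, by simp⟩

theorem prod {ι : Type*} (s : Finset ι) {f : ι → RatFunc ℂ} {v : ι → ℂ}
    (h : ∀ i ∈ s, HasEval (f i) z (v i)) : HasEval (∏ i ∈ s, f i) z (∏ i ∈ s, v i) := by
  classical
  induction s using Finset.induction_on with
  | empty => simpa using one z
  | insert i s hi ih =>
    rw [Finset.prod_insert hi, Finset.prod_insert hi]
    exact (h i (Finset.mem_insert_self i s)).mul
      (ih fun j hj => h j (Finset.mem_insert_of_mem hj))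

theorem pow (hf : HasEval f z v) (n : ℕ) : HasEval (f ^ n) z (v ^ n) := by
  simpa using prod (Finset.range n) fun _ _ => hf

theorem zpow (hf : HasEval f z v) (hv : v ≠ 0) (n : ℤ) : HasEval (f ^ n) z (v ^ n) := by
  obtain ⟨n, rfl | rfl⟩ := n.eq_nat_or_neg
  · simpa using hf.pow n
  · simpa using (hf.pow n).inv (pow_ne_zero n hv)

theorem qPoch {q : ℂ} (hq0 : q ≠ 0) (hf : HasEval f z v) (hv : ∀ m : ℤ, v ≠ q ^ m) (k : ℤ) :
    HasEval (QSeries.qPoch (RatFunc.C q) f k) z (QSeries.qPoch q v k) := by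
  obtain ⟨n, rfl | rfl⟩ := k.eq_nat_or_neg
  · rw [qPoch_natCast, qPoch_natCast]
    exact prod _ fun i _ => (one z).sub (hf.mul ((const q z).pow i))
  · rw [qPoch_neg_natCast, qPoch_neg_natCast]
    refine (prod _ fun i _ => (one z).sub (hf.mul (((const q z).pow _).inv (pow_ne_zero _ hq0)))).inv
      (Finset.prod_ne_zero_iff.2 fun i _ => ?_)
    have := one_sub_mul_zpow_ne_zero hv (-((i + 1 : ℕ) : ℤ))
    rwa [zpow_neg, zpow_natCast] at this

end HasEval

variable {q : ℂ} {a b : Fin 3 → ℂ}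

/-- The value of `spanFun q a b k l` at `z`. -/
noncomputable def spanEval (q : ℂ) (a b : Fin 3 → ℂ) (k l : Fin 3 → ℤ) (z : ℂ) : ℂ :=
  z ^ (-∑ j, k j) * ∏ j, qPoch q (a j * z) (k j) * qPoch q (b j / z) (l j)

theorem hasEval_spanFun (hq0 : q ≠ 0) (k l : Fin 3 → ℤ) {z : ℂ} (hz : z ≠ 0)
    (haz : ∀ j, ∀ m : ℤ, a j * z ≠ q ^ m) (hzb : ∀ j, ∀ m : ℤ, z / b j ≠ q ^ m) :
    HasEval (spanFun q a b k l) z (spanEval q a b k l z) := by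
  refine ((HasEval.X z).zpow hz _).mul (HasEval.prod _ fun j _ => HasEval.mul ?_ ?_)
  · exact ((HasEval.const _ z).mul (HasEval.X z)).qPoch hq0 (haz j) _
  · rw [div_eq_mul_inv, div_eq_mul_inv]
    refine ((HasEval.const _ z).mul ((HasEval.X z).inv hz)).qPoch hq0 ?_ _
    rw [← div_eq_mul_inv]
    exact div_ne_zpow_symm (hzb j)

/-! ### Shifting the parameters -/

/-- Reflecting `(c q ^ (-x))_l` and `(c)_l` leads to the same infinite product, and the bases differ
by `(q ^ (-x)) ^ l`. This lets the numerator `(b_j / z)_l` at `z = μ q ^ x` be absorbed into the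
denominator of the series. -/
theorem qPoch_div_shift (hq0 : q ≠ 0) (hq1 : ‖q‖ < 1) {c : ℂ} (hc : c ≠ 0)
    (h : ∀ m : ℤ, c ≠ q ^ m) (l x : ℤ) :
    qPoch q (c * q ^ (-x)) l / qPoch q (q / c) x =
      q ^ (-(x * l)) * (qPoch q c l / qPoch q (q / (c * q ^ l)) x) := by
  have hcx : c * q ^ (-x) ≠ 0 := mul_ne_zero hc (zpow_ne_zero _ hq0)
  have hcl : c * q ^ l ≠ 0 := mul_ne_zero hc (zpow_ne_zero _ hq0)
  have hinv : ∀ y : ℂ, y ≠ 0 → (∀ m : ℤ, y ≠ q ^ m) → ∀ m : ℤ, q / y ≠ q ^ m := by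
    intro y hy h m e
    refine h (1 - m) ?_
    rw [zpow_sub₀ hq0, zpow_one, ← e, div_div_cancel₀ hq0]
  have hx := mul_zpow_ne_zpow hq0 h (-x)
  have hl := mul_zpow_ne_zpow hq0 h l
  have e1 := qPoch_mul_qPochInf_div hq0 hq1 hcx hx l
  have e2 := qPoch_mul_qPochInf_div hq0 hq1 hc h l
  have e3 := qPochInf_eq_qPoch_mul hq0 hq1 (hinv c hc h) x
  have e4 := qPochInf_eq_qPoch_mul hq0 hq1 (hinv _ hcl hl) x
  have n1 := qPoch_ne_zero (hinv c hc h) x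
  have n2 := qPoch_ne_zero (hinv _ hcl hl) x
  have n3 := qPochInf_ne_zero' hq1 (hinv _ hcx hx)
  have f1 : q / (c * q ^ (-x)) = q / c * q ^ x := by rw [zpow_neg]; field_simp
  have f2 : q / (c * q ^ (-x) * q ^ l) = q / (c * q ^ l) * q ^ x := by rw [zpow_neg]; field_simp
  rw [f1, f2] at e1
  rw [f1] at n3
  have e5 : (-(c * q ^ (-x))) ^ l = (-c) ^ l * q ^ (-(x * l)) := by
    rw [← neg_mul, mul_zpow, ← zpow_mul, neg_mul]
  rw [e5] at e1
  rw [e3, e4] at e2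
  rw [div_eq_iff n1]
  refine mul_right_cancel₀ n3 ?_
  rw [e1]
  calc _ = q ^ (-(x * l)) * ((-c) ^ l * q ^ choose2 l * (qPoch q (q / (c * q ^ l)) x *
        qPochInf q (q / (c * q ^ l) * q ^ x))) / qPoch q (q / (c * q ^ l)) x := by field_simp
    _ = _ := by rw [← e2]; field_simp

/-- Both `(a μ)_x (a μ q ^ x)_k` and `(a μ)_k (a q ^ k μ)_x` equal `(a μ)_{x + k}`, and
`qPoch_div_shift` treats the `b_j` likewise. The powers `q ^ (-x l_j)` that appear multiply to `q ^
(x T)`, which the factor `z ^ (-T)` cancels. -/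
theorem sumTerm_spanFun (hq0 : q ≠ 0) (hq1 : ‖q‖ < 1) (h : GenericParameters q a b)
    {k l : Fin 3 → ℤ} (hkl : ∑ j, k j = -∑ j, l j) {μ : ℂ} (hμ : μ ≠ 0)
    (haμ : ∀ j, ∀ m : ℤ, a j * μ ≠ q ^ m) (hμb : ∀ j, ∀ m : ℤ, μ / b j ≠ q ^ m) (x : ℤ) :
    sumTerm q a b (spanFun q a b k l) μ x = spanEval q a b k l μ *
      sumTerm q (fun j => a j * q ^ k j) (fun j => b j * q ^ l j) 1 μ x := by
  have hb := h.b_ne_zero hq0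
  have hqx := zpow_ne_zero x hq0
  have hz : μ * q ^ x ≠ 0 := mul_ne_zero hμ hqx
  have haz : ∀ j, ∀ m : ℤ, a j * (μ * q ^ x) ≠ q ^ m := fun j => by
    rw [← mul_assoc]; exact mul_zpow_ne_zpow hq0 (haμ j) x
  have hzb : ∀ j, ∀ m : ℤ, μ * q ^ x / b j ≠ q ^ m := fun j => by
    rw [mul_div_right_comm]; exact mul_zpow_ne_zpow hq0 (hμb j) x
  rw [sumTerm_one, sumTerm, (hasEval_spanFun hq0 k l hz haz hzb).eval_eq, spanEval, spanEval]
  have key : ∀ j, qPoch q (a j * (μ * q ^ x)) (k j) * qPoch q (b j / (μ * q ^ x)) (l j) *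
      (qPoch q (a j * μ) x / qPoch q (q * μ / b j) x) =
      q ^ (-(x * l j)) * (qPoch q (a j * μ) (k j) * qPoch q (b j / μ) (l j) *
        (qPoch q (a j * q ^ k j * μ) x / qPoch q (q * μ / (b j * q ^ l j)) x)) := by
    intro j
    have := hb j
    have e1 := qPoch_add hq0 (haμ j) x (k j)
    rw [add_comm, qPoch_add hq0 (haμ j) (k j) x] at e1
    have e2 := qPoch_div_shift hq0 hq1 (div_ne_zero (hb j) hμ) (div_ne_zpow_symm (hμb j)) (l j) x
    have f1 : b j / (μ * q ^ x) = b j / μ * q ^ (-x) := by rw [zpow_neg]; field_simp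
    have f2 : q * μ / b j = q / (b j / μ) := by field_simp
    have f3 : q * μ / (b j * q ^ l j) = q / (b j / μ * q ^ l j) := by
      have := zpow_ne_zero (l j) hq0
      field_simp
    rw [f1, f2, f3, ← mul_assoc (a j), mul_right_comm (a j) (q ^ k j) μ]
    calc _ = (qPoch q (a j * μ) x * qPoch q (a j * μ * q ^ x) (k j)) *
          (qPoch q (b j / μ * q ^ (-x)) (l j) / qPoch q (q / (b j / μ)) x) := by ring
      _ = _ := by rw [← e1, e2]; ring
  have hq : ∏ j, q ^ (-(x * l j)) = q ^ (x * ∑ j, k j) := by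
    rw [hkl]
    simp only [Fin.prod_univ_three, Fin.sum_univ_three]
    rw [← zpow_add₀ hq0, ← zpow_add₀ hq0]
    congr 1
    ring
  have hz1 : (μ * q ^ x) ^ (-∑ j, k j) * q ^ (x * ∑ j, k j) = μ ^ (-∑ j, k j) := by
    rw [mul_zpow, mul_assoc, ← zpow_mul, ← zpow_add₀ hq0]
    simp
  calc _ = q ^ x * (μ * q ^ x) ^ (-∑ j, k j) * ∏ j, (qPoch q (a j * (μ * q ^ x)) (k j) *
        qPoch q (b j / (μ * q ^ x)) (l j) * (qPoch q (a j * μ) x / qPoch q (q * μ / b j) x)) := by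
        rw [Finset.prod_mul_distrib
          (f := fun j => qPoch q (a j * (μ * q ^ x)) (k j) * qPoch q (b j / (μ * q ^ x)) (l j))]
        ring
    _ = q ^ x * ((μ * q ^ x) ^ (-∑ j, k j) * q ^ (x * ∑ j, k j)) *
        ((∏ j, qPoch q (a j * μ) (k j) * qPoch q (b j / μ) (l j)) *
        ∏ j, (qPoch q (a j * q ^ k j * μ) x / qPoch q (q * μ / (b j * q ^ l j)) x)) := by
        rw [Finset.prod_congr rfl fun j _ => key j, Finset.prod_mul_distrib, hq,
          Finset.prod_mul_distrib
            (f := fun j => qPoch q (a j * μ) (k j) * qPoch q (b j / μ) (l j))]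
        ring
    _ = _ := by rw [hz1]; ring

/-! ### The coefficients of the bilateral formula under a shift of the parameters -/

theorem prod_zpow_sum {x : ℂ} (hx : x ≠ 0) (f : Fin 3 → ℤ) : ∏ j, x ^ f j = x ^ ∑ j, f j := by
  rw [Fin.prod_univ_three, Fin.sum_univ_three, zpow_add₀ hx, zpow_add₀ hx]

theorem GenericParameters.shift (hq0 : q ≠ 0) (h : GenericParameters q a b) {k l : Fin 3 → ℤ}
    (hkl : ∑ j, k j = -∑ j, l j) :
    GenericParameters q (fun j => a j * q ^ k j) (fun j => b j * q ^ l j) where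
  balance := by
    rw [Finset.prod_mul_distrib, Finset.prod_mul_distrib, prod_zpow_sum hq0, prod_zpow_sum hq0, hkl,
      zpow_neg, mul_mul_mul_comm, h.balance, inv_mul_cancel₀ (zpow_ne_zero _ hq0), mul_one]
  a_div_a i j hij m e := by
    refine mul_zpow_ne_zpow hq0 (h.a_div_a i j hij) (k i - k j) m ?_
    rw [← e, zpow_sub₀ hq0, div_mul_div_comm]
  b_div_b i j hij m e := by
    refine mul_zpow_ne_zpow hq0 (h.b_div_b i j hij) (l i - l j) m ?_
    rw [← e, zpow_sub₀ hq0, div_mul_div_comm]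
  a_mul_b i j m e := by
    refine mul_zpow_ne_zpow hq0 (h.a_mul_b i j) (k i + l j) m ?_
    rw [← e, zpow_add₀ hq0, mul_mul_mul_comm]

theorem GenericNodes.shift (hq0 : q ≠ 0) {lam : Fin 3 → ℂ} (h : GenericNodes q a b lam)
    (k l : Fin 3 → ℤ) :
    GenericNodes q (fun j => a j * q ^ k j) (fun j => b j * q ^ l j) lam where
  ne_zero := h.ne_zero
  lam_div_lam := h.lam_div_lam
  t_mul_lam m e := by
    refine mul_zpow_ne_zpow hq0 h.t_mul_lam (∑ j, k j) m ?_
    rw [← e, Finset.prod_mul_distrib, prod_zpow_sum hq0, mul_right_comm]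
  a_mul_lam j i m e := by
    refine mul_zpow_ne_zpow hq0 (h.a_mul_lam j i) (k j) m ?_
    rw [← e, mul_right_comm]
  lam_div_b j i m e := by
    refine mul_zpow_ne_zpow hq0 (h.lam_div_b j i) (-l j) m ?_
    rw [← e, zpow_neg, div_mul_eq_div_div, div_eq_mul_inv (lam i / b j)]

/-- The factor by which `∏_j θ(c_j z)` changes under `c_j ↦ c_j q ^ k_j`. -/
noncomputable def shiftFactor (q : ℂ) (c : Fin 3 → ℂ) (k : Fin 3 → ℤ) : ℂ :=
  ∏ j, (-c j) ^ k j * q ^ choose2 (k j)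

theorem shiftFactor_ne_zero (hq0 : q ≠ 0) {c : Fin 3 → ℂ} (hc : ∀ j, c j ≠ 0) (k : Fin 3 → ℤ) :
    shiftFactor q c k ≠ 0 :=
  Finset.prod_ne_zero_iff.2 fun j _ =>
    mul_ne_zero (zpow_ne_zero _ (neg_ne_zero.2 (hc j))) (zpow_ne_zero _ hq0)

theorem prod_neg_mul_zpow {c : Fin 3 → ℂ} {z : ℂ} (hz : z ≠ 0) (k : Fin 3 → ℤ) :
    ∏ j, (-(c j * z)) ^ k j * q ^ choose2 (k j) = shiftFactor q c k * z ^ ∑ j, k j := by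
  rw [shiftFactor, ← prod_zpow_sum hz, ← Finset.prod_mul_distrib]
  refine Finset.prod_congr rfl fun j _ => ?_
  rw [← neg_mul, mul_zpow]
  ring

theorem prod_qTheta_shift (hq0 : q ≠ 0) (hq1 : ‖q‖ < 1) {c : Fin 3 → ℂ} (hc : ∀ j, c j ≠ 0)
    (k : Fin 3 → ℤ) {z : ℂ} (hz : z ≠ 0) :
    ∏ j, qTheta q (c j * z) =
      shiftFactor q c k * z ^ (∑ j, k j) * ∏ j, qTheta q (c j * q ^ k j * z) := by
  rw [← prod_neg_mul_zpow hz, ← Finset.prod_mul_distrib]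
  refine Finset.prod_congr rfl fun j _ => ?_
  have hcz := mul_ne_zero (hc j) hz
  rw [mul_right_comm (c j), qTheta_mul_zpow hq0 hq1 hcz, zpow_neg, zpow_neg]
  have := zpow_ne_zero (k j) (neg_ne_zero.2 hcz)
  have := zpow_ne_zero (choose2 (k j)) hq0
  field_simp

theorem thetaA_shift (hq0 : q ≠ 0) (hq1 : ‖q‖ < 1) (ha : ∀ j, a j ≠ 0)
    (k : Fin 3 → ℤ) {z : ℂ} (hz : z ≠ 0) :
    thetaA q a z = shiftFactor q a k * z ^ (∑ j, k j) * thetaA q (fun j => a j * q ^ k j) z :=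
  prod_qTheta_shift hq0 hq1 ha k hz

theorem thetaB_shift (hq0 : q ≠ 0) (hq1 : ‖q‖ < 1) (hb : ∀ j, b j ≠ 0) {k l : Fin 3 → ℤ}
    (hkl : ∑ j, k j = -∑ j, l j) {z : ℂ} (hz : z ≠ 0) :
    thetaB q b z = shiftFactor q b l * z ^ (∑ j, k j) * thetaB q (fun j => b j * q ^ l j) z := by
  have := prod_qTheta_shift hq0 hq1 hb l (inv_ne_zero hz)
  rw [inv_zpow, ← zpow_neg, ← hkl] at this
  simpa only [thetaB, ← div_eq_mul_inv] using this

theorem prod_qPochInf_mul_spanEval (hq0 : q ≠ 0) (hq1 : ‖q‖ < 1) (ha : ∀ j, a j ≠ 0)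
    (hb : ∀ j, b j ≠ 0) {k l : Fin 3 → ℤ} (hkl : ∑ j, k j = -∑ j, l j) {z : ℂ} (hz : z ≠ 0)
    (haz : ∀ j, ∀ m : ℤ, a j * z ≠ q ^ m) (hzb : ∀ j, ∀ m : ℤ, z / b j ≠ q ^ m) :
    (∏ j, qPochInf q (q / (a j * z)) * qPochInf q (q * z / b j)) * spanEval q a b k l z =
      shiftFactor q a k * shiftFactor q b l * z ^ (∑ j, k j) *
        ∏ j, qPochInf q (q / (a j * q ^ k j * z)) * qPochInf q (q * z / (b j * q ^ l j)) := by
  have hA : (∏ j, qPoch q (a j * z) (k j)) * ∏ j, qPochInf q (q / (a j * z)) =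
      shiftFactor q a k * z ^ (∑ j, k j) * ∏ j, qPochInf q (q / (a j * q ^ k j * z)) := by
    rw [← prod_neg_mul_zpow hz, ← Finset.prod_mul_distrib, ← Finset.prod_mul_distrib]
    refine Finset.prod_congr rfl fun j _ => ?_
    rw [qPoch_mul_qPochInf_div hq0 hq1 (mul_ne_zero (ha j) hz) (haz j), mul_right_comm (a j)]
  have hB : (∏ j, qPoch q (b j / z) (l j)) * ∏ j, qPochInf q (q * z / b j) =
      shiftFactor q b l * z ^ (∑ j, k j) * ∏ j, qPochInf q (q * z / (b j * q ^ l j)) := by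
    have e : z ^ (∑ j, k j) = z⁻¹ ^ ∑ j, l j := by rw [inv_zpow, ← zpow_neg, hkl]
    rw [e, ← prod_neg_mul_zpow (inv_ne_zero hz), ← Finset.prod_mul_distrib,
      ← Finset.prod_mul_distrib]
    refine Finset.prod_congr rfl fun j _ => ?_
    have := hb j
    have := zpow_ne_zero (l j) hq0
    have e1 := qPoch_mul_qPochInf_div hq0 hq1 (div_ne_zero (hb j) hz) (div_ne_zpow_symm (hzb j)) (l j)
    rw [show q / (b j / z) = q * z / b j by field_simp,
      show q / (b j / z * q ^ l j) = q * z / (b j * q ^ l j) by field_simp] at e1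
    rw [e1, div_eq_mul_inv]
  have hzT : z ^ (-∑ j, k j) * z ^ (∑ j, k j) = 1 := by
    rw [← zpow_add₀ hz, neg_add_cancel, zpow_zero]
  unfold spanEval
  simp only [Finset.prod_mul_distrib]
  calc _ = z ^ (-∑ j, k j) * ((∏ j, qPoch q (a j * z) (k j)) * ∏ j, qPochInf q (q / (a j * z))) *
        ((∏ j, qPoch q (b j / z) (l j)) * ∏ j, qPochInf q (q * z / b j)) := by ring
    _ = (z ^ (-∑ j, k j) * z ^ (∑ j, k j)) * (shiftFactor q a k * shiftFactor q b l *
        z ^ (∑ j, k j) * ((∏ j, qPochInf q (q / (a j * q ^ k j * z))) *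
          ∏ j, qPochInf q (q * z / (b j * q ^ l j)))) := by rw [hA, hB]; ring
    _ = _ := by rw [hzT]; ring

/-- The infinite products at `λ_i`, together with the value of the function there, contribute both
shift factors and `λ_i ^ T`. Each of the two terms in the braces contains one `A` and one `B` at the
other two nodes, contributing both shift factors again and `(λ_{i+1} λ_{i+2}) ^ T`. Hence the total
factor does not depend on `i`. -/
theorem coeffX_mul_spanEval (hq0 : q ≠ 0) (hq1 : ‖q‖ < 1) (h : GenericParameters q a b)
    {lam : Fin 3 → ℂ} (hn : GenericNodes q a b lam) {k l : Fin 3 → ℤ}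
    (hkl : ∑ j, k j = -∑ j, l j) (i : Fin 3) :
    coeffX q a b lam i * spanEval q a b k l (lam i) =
      (shiftFactor q a k * shiftFactor q b l) ^ 2 * (∏ j, lam j) ^ (∑ j, k j) *
        coeffX q (fun j => a j * q ^ k j) (fun j => b j * q ^ l j) lam i := by
  have ha := h.a_ne_zero hq0
  have hb := h.b_ne_zero hq0
  have e0 := prod_qPochInf_mul_spanEval hq0 hq1 ha hb hkl (hn.ne_zero i)
    (fun j => hn.a_mul_lam j i) (fun j => hn.lam_div_b j i)
  have hX : ∀ a b : Fin 3 → ℂ, coeffX q a b lam i =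
      (∏ j, qPochInf q (q / (a j * lam i)) * qPochInf q (q * lam i / b j)) *
        (lam (i + 1) / lam (i + 2) * (thetaA q a (lam (i + 2)) * thetaB q b (lam (i + 1))) -
        lam (i + 2) / lam (i + 1) * (thetaA q a (lam (i + 1)) * thetaB q b (lam (i + 2)))) := by
    intro a b
    unfold coeffX thetaA thetaB
    rw [← Finset.prod_mul_distrib, ← Finset.prod_mul_distrib]
  have hΛ : (∏ j, lam j) ^ (∑ j, k j) = lam i ^ (∑ j, k j) * lam (i + 1) ^ (∑ j, k j) *
      lam (i + 2) ^ (∑ j, k j) := by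
    rw [← mul_zpow, ← mul_zpow]
    congr 1
    rw [Fin.prod_univ_three]
    fin_cases i <;> simp <;> ring
  rw [hX, hX, thetaA_shift hq0 hq1 ha k (hn.ne_zero (i + 1)),
    thetaA_shift hq0 hq1 ha k (hn.ne_zero (i + 2)), thetaB_shift hq0 hq1 hb hkl (hn.ne_zero (i + 1)),
    thetaB_shift hq0 hq1 hb hkl (hn.ne_zero (i + 2)), hΛ, mul_right_comm, e0]
  ring

/-- Expanding `choose2 (k + l) = choose2 k + choose2 l + k l` gives the cube of the shift factors,
times cross terms `a_i ^ l_j b_j ^ k_i q ^ (k_i l_j)`. As `∑ k = T` and `∑ l = -T`, these multiply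
to `t ^ (-T) (∏ b_j) ^ T q ^ (-T²)`, which the remaining prefactors cancel by balancing. -/
theorem prod_prod_neg_mul_zpow (hq0 : q ≠ 0) (h : GenericParameters q a b) {k l : Fin 3 → ℤ}
    (hkl : ∑ j, k j = -∑ j, l j) :
    (-∏ j, a j) ^ (∑ j, k j) * q ^ choose2 (∑ j, k j) * ((-∏ j, a j) ^ (∑ j, k j) *
      q ^ choose2 (∑ j, k j)) * ∏ i, ∏ j, ((-(a i * b j)) ^ (k i + l j) * q ^ choose2 (k i + l j)) =
      (shiftFactor q a k * shiftFactor q b l) ^ 3 := by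
  have ha := h.a_ne_zero hq0
  have hb := h.b_ne_zero hq0
  set T := ∑ j, k j with hT
  have hl : ∑ j, l j = -T := by rw [hkl, neg_neg]
  have ht0 : ∏ j, a j ≠ 0 := Finset.prod_ne_zero_iff.2 fun j _ => ha j
  have h1 : ∀ i j, (-(a i * b j)) ^ (k i + l j) * q ^ choose2 (k i + l j) =
      ((-a i) ^ k i * q ^ choose2 (k i)) * ((-b j) ^ l j * q ^ choose2 (l j)) *
        (a i ^ l j * b j ^ k i * q ^ (k i * l j)) := by
    intro i j
    rw [zpow_add₀ (neg_ne_zero.2 (mul_ne_zero (ha i) (hb j))), choose2_add, zpow_add₀ hq0,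
      zpow_add₀ hq0, ← neg_mul, mul_zpow (-a i), neg_mul, ← mul_neg, mul_zpow (a i)]
    ring
  have c1 : ∏ i, ∏ j, a i ^ l j = (∏ j, a j) ^ (-T) := by
    rw [← Finset.prod_zpow]
    exact Finset.prod_congr rfl fun i _ => by rw [prod_zpow_sum (ha i), hl]
  have c2 : ∏ i, ∏ j, b j ^ k i = (∏ j, b j) ^ T := by
    rw [Finset.prod_comm, ← Finset.prod_zpow]
    exact Finset.prod_congr rfl fun i _ => by rw [prod_zpow_sum (hb i)]
  have c3 : ∏ i, ∏ j, q ^ (k i * l j) = q ^ (-(T * T)) := by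
    have : ∀ i, ∏ j, q ^ (k i * l j) = q ^ (k i * (-T)) := fun i => by
      rw [prod_zpow_sum hq0, ← Finset.mul_sum, hl]
    rw [Finset.prod_congr rfl fun i _ => this i, prod_zpow_sum hq0, ← Finset.sum_mul, ← hT]
    congr 1
    ring
  have c4 : ∏ i, ∏ j, ((-(a i * b j)) ^ (k i + l j) * q ^ choose2 (k i + l j)) =
      (shiftFactor q a k * shiftFactor q b l) ^ 3 *
        ((∏ j, a j) ^ (-T) * (∏ j, b j) ^ T * q ^ (-(T * T))) := by
    simp only [h1, Finset.prod_mul_distrib (s := Finset.univ), c1, c2, c3]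
    simp only [Finset.prod_const, Finset.card_univ, Fintype.card_fin, shiftFactor,
      Finset.prod_mul_distrib, Finset.prod_pow]
    ring
  have c5 : (-∏ j, a j) ^ T * (-∏ j, a j) ^ T = (∏ j, a j) ^ T * (∏ j, a j) ^ T := by
    rw [← mul_zpow, ← mul_zpow, neg_mul_neg]
  have c6 : q ^ choose2 T * q ^ choose2 T = q ^ (T * T) * q ^ (-T) := by
    rw [← zpow_add₀ hq0, ← zpow_add₀ hq0, ← two_mul, two_mul_choose2]
    congr 1
    ring
  have c7 : (∏ j, a j) ^ T * (∏ j, b j) ^ T = q ^ T := by rw [← mul_zpow, h.balance]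
  have c8 : (∏ j, a j) ^ T * (∏ j, a j) ^ (-T) = 1 := by
    rw [← zpow_add₀ ht0, add_neg_cancel, zpow_zero]
  have c9 : q ^ T * q ^ (-T) = 1 := by rw [← zpow_add₀ hq0, add_neg_cancel, zpow_zero]
  have c10 : q ^ (T * T) * q ^ (-(T * T)) = 1 := by
    rw [← zpow_add₀ hq0, add_neg_cancel, zpow_zero]
  rw [c4]
  calc _ = (shiftFactor q a k * shiftFactor q b l) ^ 3 *
        (((-∏ j, a j) ^ T * (-∏ j, a j) ^ T) * (q ^ choose2 T * q ^ choose2 T) *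
          ((∏ j, a j) ^ (-T) * (∏ j, b j) ^ T * q ^ (-(T * T)))) := by ring
    _ = (shiftFactor q a k * shiftFactor q b l) ^ 3 *
        (((∏ j, a j) ^ T * (∏ j, a j) ^ (-T)) * (((∏ j, a j) ^ T * (∏ j, b j) ^ T) * q ^ (-T)) *
          (q ^ (T * T) * q ^ (-(T * T)))) := by rw [c5, c6]; ring
    _ = _ := by rw [c7, c8, c9, c10]; ring

/-- The product of the shift factors is the denominator of `spanValue`: the signs combine to `(-1) ^
∑ (k_j + l_j) = 1`. -/
theorem spanValue_eq (hq0 : q ≠ 0) (h : GenericParameters q a b) {k l : Fin 3 → ℤ}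
    (hkl : ∑ j, k j = -∑ j, l j) :
    spanValue q a b k l * (shiftFactor q a k * shiftFactor q b l) =
      (-∏ j, a j) ^ (∑ j, k j) * q ^ choose2 (∑ j, k j) *
        ∏ i, ∏ j, qPoch q (a i * b j) (k i + l j) := by
  have ha := h.a_ne_zero hq0
  have hb := h.b_ne_zero hq0
  have hneg : ∀ (x : ℂ) (n : ℤ), (-x) ^ n = (-1) ^ n * x ^ n := fun x n => by
    rw [neg_eq_neg_one_mul, mul_zpow]
  have e : shiftFactor q a k * shiftFactor q b l =
      ∏ j, q ^ (choose2 (k j) + choose2 (l j)) * a j ^ k j * b j ^ l j := by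
    have hs : ∏ j, (-1 : ℂ) ^ (k j + l j) = 1 := by
      rw [prod_zpow_sum (by norm_num), Finset.sum_add_distrib, hkl, neg_add_cancel, zpow_zero]
    rw [shiftFactor, shiftFactor, ← Finset.prod_mul_distrib]
    calc _ = ∏ j, ((-1 : ℂ) ^ (k j + l j) *
          (q ^ (choose2 (k j) + choose2 (l j)) * a j ^ k j * b j ^ l j)) := by
          refine Finset.prod_congr rfl fun j _ => ?_
          rw [hneg (a j), hneg (b j), zpow_add₀ (neg_ne_zero.2 (one_ne_zero (α := ℂ))), zpow_add₀ hq0]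
          ring
      _ = _ := by rw [Finset.prod_mul_distrib, hs, one_mul]
  rw [spanValue, ← e, div_mul_cancel₀]
  exact mul_ne_zero (shiftFactor_ne_zero hq0 ha k) (shiftFactor_ne_zero hq0 hb l)

/-- The theta factor changes by quasi-periodicity, and the products `(q / a_i b_j)_∞` change by
reflection, which produces `∏ (a_i b_j)_{k_i + l_j}`. The remaining monomials are reconciled by
`prod_prod_neg_mul_zpow`. -/
theorem coeffC_mul_shift (hq0 : q ≠ 0) (hq1 : ‖q‖ < 1) (h : GenericParameters q a b)
    {lam : Fin 3 → ℂ} (hn : GenericNodes q a b lam) {k l : Fin 3 → ℤ}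
    (hkl : ∑ j, k j = -∑ j, l j) :
    coeffC q a b lam * ((shiftFactor q a k * shiftFactor q b l) ^ 2 * (∏ j, lam j) ^ (∑ j, k j)) =
      spanValue q a b k l * coeffC q (fun j => a j * q ^ k j) (fun j => b j * q ^ l j) lam := by
  have ha := h.a_ne_zero hq0
  have hb := h.b_ne_zero hq0
  have h' := h.shift hq0 hkl
  have hn' := hn.shift hq0 k l
  set T := ∑ j, k j with hT
  set t := ∏ j, a j with ht
  set Λ := ∏ j, lam j with hΛ
  set M := shiftFactor q a k * shiftFactor q b l with hM
  set P := ∏ i, ∏ j, qPoch q (a i * b j) (k i + l j) with hP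
  set N := ∏ i, ∏ j, ((-(a i * b j)) ^ (k i + l j) * q ^ choose2 (k i + l j)) with hN
  set Q := ∏ i, ∏ j, qPochInf q (q / (a i * b j)) with hQ
  set Q' := ∏ i, ∏ j, qPochInf q (q / (a i * q ^ k i * (b j * q ^ l j))) with hQ'
  have ht0 : t ≠ 0 := Finset.prod_ne_zero_iff.2 fun j _ => ha j
  have hΛ0 : Λ ≠ 0 := Finset.prod_ne_zero_iff.2 fun j _ => hn.ne_zero j
  have hM0 : M ≠ 0 := mul_ne_zero (shiftFactor_ne_zero hq0 ha k) (shiftFactor_ne_zero hq0 hb l)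
  have hinf : ∀ y : ℂ, (∀ m : ℤ, y ≠ q ^ m) → qPochInf q (q / y) ≠ 0 := fun y hy =>
    qPochInf_ne_zero' hq1 fun m e => hy (1 - m) (by
      rw [zpow_sub₀ hq0, zpow_one, ← e, div_div_cancel₀ hq0])
  have hQ0 : Q ≠ 0 := Finset.prod_ne_zero_iff.2 fun i _ => Finset.prod_ne_zero_iff.2
    fun j _ => hinf _ (h.a_mul_b i j)
  have hQ0' : Q' ≠ 0 := Finset.prod_ne_zero_iff.2 fun i _ => Finset.prod_ne_zero_iff.2
    fun j _ => hinf _ (h'.a_mul_b i j)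
  have hθ : qTheta q (t * Λ) ≠ 0 := qTheta_ne_zero hq0 hq1 (mul_ne_zero ht0 hΛ0) hn.t_mul_lam
  have hPQ : P * Q = N * Q' := by
    simp only [hP, hQ, hN, hQ', ← Finset.prod_mul_distrib]
    refine Finset.prod_congr rfl fun i _ => Finset.prod_congr rfl fun j _ => ?_
    rw [qPoch_mul_qPochInf_div hq0 hq1 (mul_ne_zero (ha i) (hb j)) (h.a_mul_b i j),
      zpow_add₀ hq0 (k i) (l j), mul_mul_mul_comm]
  have hN1 := prod_prod_neg_mul_zpow hq0 h hkl
  have hS := spanValue_eq hq0 h hkl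
  have ht' : (∏ j, a j * q ^ k j) = t * q ^ T := by
    rw [Finset.prod_mul_distrib, prod_zpow_sum hq0]
  have hθ' : qTheta q (t * q ^ T * Λ) * ((-t) ^ T * Λ ^ T * q ^ choose2 T) = qTheta q (t * Λ) := by
    have n1 := zpow_ne_zero T (neg_ne_zero.2 (mul_ne_zero ht0 hΛ0))
    have n2 := zpow_ne_zero (choose2 T) hq0
    rw [mul_right_comm, qTheta_mul_zpow hq0 hq1 (mul_ne_zero ht0 hΛ0), ← mul_zpow, neg_mul,
      zpow_neg, zpow_neg]
    field_simp
  have hθ0' : qTheta q (t * q ^ T * Λ) ≠ 0 := fun e => hθ (by rw [← hθ', e, zero_mul])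
  have hqq := qPochInf_self_ne_zero hq1
  unfold coeffC
  rw [ht']
  change Λ / (qPochInf q q * qTheta q (t * Λ) * Q * _) * _ =
    _ * (Λ / (qPochInf q q * qTheta q (t * q ^ T * Λ) * Q' * _))
  set V := ∏ i, ∏ j ∈ Finset.Ioi i, lam j * qTheta q (lam i / lam j) with hV
  have hV0 : V ≠ 0 := Finset.prod_ne_zero_iff.2 fun i _ => Finset.prod_ne_zero_iff.2
    fun j hj => mul_ne_zero (hn.ne_zero j) (qTheta_ne_zero hq0 hq1
      (div_ne_zero (hn.ne_zero i) (hn.ne_zero j)) (hn.lam_div_lam i j (Finset.mem_Ioi.1 hj).ne))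
  rw [← hM] at hN1 hS
  rw [div_mul_eq_mul_div, mul_div_assoc', div_eq_div_iff
    (mul_ne_zero (mul_ne_zero (mul_ne_zero hqq hθ) hQ0) hV0)
    (mul_ne_zero (mul_ne_zero (mul_ne_zero hqq hθ0') hQ0') hV0)]
  -- The additional factor `M` completes `M ^ 2` to the cube that `hN1` rewrites, and on the other
  -- side clears the denominator of `spanValue`.
  refine mul_left_cancel₀ hM0 ?_
  rw [← hθ']
  calc _ = Λ * Λ ^ T * (qPochInf q q * qTheta q (t * q ^ T * Λ) * V) * (M ^ 3 * Q') := by ring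
    _ = Λ * Λ ^ T * (qPochInf q q * qTheta q (t * q ^ T * Λ) * V) *
        ((-t) ^ T * q ^ choose2 T * ((-t) ^ T * q ^ choose2 T)) * (N * Q') := by
        rw [← hN1]; ring
    _ = Λ * Λ ^ T * (qPochInf q q * qTheta q (t * q ^ T * Λ) * V) *
        ((-t) ^ T * q ^ choose2 T) * Q * ((-t) ^ T * q ^ choose2 T * P) := by
        rw [← hPQ]; ring
    _ = _ := by rw [← hS]; ring

/-- The bilateral formula on the spanning functions. -/
theorem coeffC_mul_sum_spanFun (hq0 : q ≠ 0) (hq1 : ‖q‖ < 1) (h : GenericParameters q a b)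
    {lam : Fin 3 → ℂ} (hn : GenericNodes q a b lam) {k l : Fin 3 → ℤ}
    (hkl : ∑ j, k j = -∑ j, l j) :
    coeffC q a b lam * ∑ i, coeffX q a b lam i *
      ∑' x, sumTerm q a b (spanFun q a b k l) (lam i) x = spanValue q a b k l := by
  have h1 := coeffC_mul_sum_one hq0 hq1 (h.shift hq0 hkl) (hn.shift hq0 k l)
  have h2 : ∀ i, ∑' x, sumTerm q a b (spanFun q a b k l) (lam i) x = spanEval q a b k l (lam i) *
      ∑' x, sumTerm q (fun j => a j * q ^ k j) (fun j => b j * q ^ l j) 1 (lam i) x := by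
    intro i
    rw [← tsum_mul_left]
    exact tsum_congr (sumTerm_spanFun hq0 hq1 h hkl (hn.ne_zero i) (fun j => hn.a_mul_lam j i)
      fun j => hn.lam_div_b j i)
  simp_rw [h2, ← mul_assoc (coeffX q a b lam _), coeffX_mul_spanEval hq0 hq1 h hn hkl,
    mul_assoc _ (coeffX q _ _ lam _)]
  rw [← Finset.mul_sum, ← mul_assoc, coeffC_mul_shift hq0 hq1 h hn hkl, mul_assoc, h1, mul_one]

theorem summable_sumTerm_spanFun (hq0 : q ≠ 0) (hq1 : ‖q‖ < 1) (h : GenericParameters q a b)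
    {lam : Fin 3 → ℂ} (hn : GenericNodes q a b lam) {k l : Fin 3 → ℤ}
    (hkl : ∑ j, k j = -∑ j, l j) (i : Fin 3) :
    Summable (sumTerm q a b (spanFun q a b k l) (lam i)) :=
  ((summable_sumTerm_one hq0 hq1 (h.shift hq0 hkl) (hn.shift hq0 k l) i).mul_left _).congr
    fun x => (sumTerm_spanFun hq0 hq1 h hkl (hn.ne_zero i) (fun j => hn.a_mul_lam j i)
      (fun j => hn.lam_div_b j i) x).symm

end QSeries

namespace QSeries

open Filter Topology Polynomial

/-! ### The spanning functions -/

variable {q : ℂ} {a b : Fin 3 → ℂ}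

theorem pow_injective_of_norm_lt_one (hq0 : q ≠ 0) (hq1 : ‖q‖ < 1) :
    Function.Injective fun n : ℕ => q ^ n := fun m n h => by
  have h' : ‖q‖ ^ m = ‖q‖ ^ n := by rw [← norm_pow, ← norm_pow]; exact congrArg _ h
  exact (pow_right_strictAnti₀ (norm_pos_iff.2 hq0) hq1).injective h'

/-- The points `c⁻¹ q, …, c⁻¹ q ^ n`. -/
noncomputable def upPoles (q c : ℂ) (n : ℕ) : Finset ℂ :=
  (Finset.range n).image fun i => c⁻¹ * q ^ (i + 1)

/-- The points `c q⁻¹, …, c q ^ (-n)`. -/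
noncomputable def downPoles (q c : ℂ) (n : ℕ) : Finset ℂ :=
  (Finset.range n).image fun i => c * (q ^ (i + 1))⁻¹

theorem mem_upPoles {c z : ℂ} {n : ℕ} :
    z ∈ upPoles q c n ↔ ∃ m : ℕ, 0 < m ∧ m ≤ n ∧ z = c⁻¹ * q ^ m := by
  simp only [upPoles, Finset.mem_image, Finset.mem_range]
  constructor
  · rintro ⟨i, hi, rfl⟩
    exact ⟨i + 1, i.succ_pos, hi, rfl⟩
  · rintro ⟨m, hm, hmn, rfl⟩
    exact ⟨m - 1, by omega, by rw [Nat.sub_add_cancel hm]⟩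

theorem mem_downPoles {c z : ℂ} {n : ℕ} :
    z ∈ downPoles q c n ↔ ∃ m : ℕ, 0 < m ∧ m ≤ n ∧ z = c * (q ^ m)⁻¹ := by
  simp only [downPoles, Finset.mem_image, Finset.mem_range]
  constructor
  · rintro ⟨i, hi, rfl⟩
    exact ⟨i + 1, i.succ_pos, hi, rfl⟩
  · rintro ⟨m, hm, hmn, rfl⟩
    exact ⟨m - 1, by omega, by rw [Nat.sub_add_cancel hm]⟩

theorem upPoles_injective (hq0 : q ≠ 0) (hq1 : ‖q‖ < 1) {c : ℂ} (hc : c ≠ 0) :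
    Function.Injective fun i : ℕ => c⁻¹ * q ^ (i + 1) := fun i j h => by
  have := pow_injective_of_norm_lt_one hq0 hq1 (mul_left_cancel₀ (inv_ne_zero hc) h)
  omega

theorem downPoles_injective (hq0 : q ≠ 0) (hq1 : ‖q‖ < 1) {c : ℂ} (hc : c ≠ 0) :
    Function.Injective fun i : ℕ => c * (q ^ (i + 1))⁻¹ := fun i j h => by
  have := pow_injective_of_norm_lt_one hq0 hq1 (inv_injective (mul_left_cancel₀ hc h))
  omega

theorem natDegree_prod_le_card {ι : Type*} (s : Finset ι) (f : ι → ℂ[X])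
    (h : ∀ i ∈ s, (f i).natDegree ≤ 1) : (∏ i ∈ s, f i).natDegree ≤ s.card :=
  (natDegree_prod_le s f).trans ((Finset.sum_le_sum h).trans (by simp))

/-- The degree bound records growth like `z ^ k` at infinity, in a form that can be summed over the
factors. The last clause ensures that no pole of `spanFun` is cancelled by its numerator. -/
theorem exists_polynomial_up (hq0 : q ≠ 0) (hq1 : ‖q‖ < 1) {c : ℂ} (hc : c ≠ 0) (k : ℤ) :
    ∃ p : ℂ[X], (p.natDegree : ℤ) ≤ k + (upPoles q c (-k).toNat).card ∧
      qPoch (RatFunc.C q) (RatFunc.C c * RatFunc.X) k *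
        algebraMap ℂ[X] (RatFunc ℂ) (∏ s ∈ upPoles q c (-k).toNat, (X - C s)) =
        algebraMap ℂ[X] (RatFunc ℂ) p ∧
      ∀ z, (∀ m : ℕ, c * z * q ^ m ≠ 1) → p.eval z ≠ 0 := by
  obtain ⟨n, rfl | rfl⟩ := k.eq_nat_or_neg
  · refine ⟨∏ i ∈ Finset.range n, (1 - C c * X * C q ^ i), ?_, ?_, ?_⟩
    · have h0 : (-(n : ℤ)).toNat = 0 := by omega
      have := natDegree_prod_le_card (Finset.range n) (fun i => (1 - C c * X * C q ^ i : ℂ[X]))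
        fun i _ => by compute_degree
      rw [Finset.card_range] at this
      rw [h0]
      simp only [upPoles, Finset.range_zero, Finset.image_empty, Finset.card_empty]
      push_cast
      linarith [(Nat.cast_le (α := ℤ)).2 this]
    · have h0 : (-(n : ℤ)).toNat = 0 := by omega
      rw [h0, qPoch_natCast]
      simp [upPoles, RatFunc.algebraMap_C, RatFunc.algebraMap_X]
    · intro z hz
      rw [eval_prod, Finset.prod_ne_zero_iff]
      intro i _ h
      refine hz i ?_
      simp only [eval_sub, eval_one, eval_mul, eval_C, eval_X, eval_pow] at h
      exact (sub_eq_zero.1 h).symm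
  · have h0 : (-(-(n : ℤ))).toNat = n := by omega
    rw [h0]
    refine ⟨C (∏ i ∈ Finset.range n, (-(c * (q ^ (i + 1))⁻¹))⁻¹), ?_, ?_, ?_⟩
    · rw [natDegree_C, upPoles, Finset.card_image_of_injective _ (upPoles_injective hq0 hq1 hc)]
      simp
    · rw [upPoles, Finset.prod_image (upPoles_injective hq0 hq1 hc).injOn, qPoch_neg_natCast,
        ← Finset.prod_inv_distrib, map_prod, map_prod, map_prod, ← Finset.prod_mul_distrib]
      refine Finset.prod_congr rfl fun i _ => ?_
      have hx : (X - C (c⁻¹ * q ^ (i + 1)) : ℂ[X]) ≠ 0 := X_sub_C_ne_zero _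
      have hx' := RatFunc.algebraMap_ne_zero hx
      have hqi := pow_ne_zero (i + 1) hq0
      have e : (1 - RatFunc.C c * RatFunc.X * (RatFunc.C q ^ (i + 1))⁻¹ : RatFunc ℂ) =
          RatFunc.C (-(c * (q ^ (i + 1))⁻¹)) *
            algebraMap ℂ[X] (RatFunc ℂ) (X - C (c⁻¹ * q ^ (i + 1))) := by
        have hc' : (RatFunc.C c : RatFunc ℂ) ≠ 0 := by simpa using hc
        have hq' : (RatFunc.C q : RatFunc ℂ) ≠ 0 := by simpa using hq0
        simp only [map_sub, RatFunc.algebraMap_X, RatFunc.algebraMap_C, map_neg, map_mul, map_inv₀,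
          map_pow]
        field_simp
        ring
      rw [e, mul_inv, mul_assoc, inv_mul_cancel₀ hx', mul_one, RatFunc.algebraMap_C, map_inv₀]
    · intro z _
      rw [eval_C, Finset.prod_ne_zero_iff]
      exact fun i _ => inv_ne_zero (neg_ne_zero.2 (mul_ne_zero hc (inv_ne_zero (pow_ne_zero _ hq0))))

/-- The factor `X ^ k` compensates the behaviour of `(c / X)_k` at the origin and gives growth of
order `k` at infinity. -/
theorem exists_polynomial_down (hq0 : q ≠ 0) (hq1 : ‖q‖ < 1) {c : ℂ} (hc : c ≠ 0) (k : ℤ) :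
    ∃ p : ℂ[X], (p.natDegree : ℤ) ≤ k + (downPoles q c (-k).toNat).card ∧
      RatFunc.X ^ k * qPoch (RatFunc.C q) (RatFunc.C c / RatFunc.X) k *
        algebraMap ℂ[X] (RatFunc ℂ) (∏ s ∈ downPoles q c (-k).toNat, (X - C s)) =
        algebraMap ℂ[X] (RatFunc ℂ) p ∧
      ∀ z, (∀ m : ℕ, z ≠ c * q ^ m) → p.eval z ≠ 0 := by
  have hX : (RatFunc.X : RatFunc ℂ) ≠ 0 := RatFunc.X_ne_zero
  obtain ⟨n, rfl | rfl⟩ := k.eq_nat_or_neg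
  · refine ⟨∏ i ∈ Finset.range n, (X - C (c * q ^ i)), ?_, ?_, ?_⟩
    · have h0 : (-(n : ℤ)).toNat = 0 := by omega
      have := natDegree_prod_le_card (Finset.range n) (fun i => (X - C (c * q ^ i) : ℂ[X]))
        fun i _ => natDegree_X_sub_C_le _
      rw [Finset.card_range] at this
      rw [h0]
      simp only [downPoles, Finset.range_zero, Finset.image_empty, Finset.card_empty]
      push_cast
      linarith [(Nat.cast_le (α := ℤ)).2 this]
    · have h0 : (-(n : ℤ)).toNat = 0 := by omega
      rw [h0, qPoch_natCast, downPoles, Finset.range_zero, Finset.image_empty, Finset.prod_empty,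
        map_one, mul_one, map_prod, zpow_natCast, ← Finset.card_range n, ← Finset.prod_const,
        Finset.card_range, ← Finset.prod_mul_distrib]
      refine Finset.prod_congr rfl fun i _ => ?_
      simp only [map_sub, RatFunc.algebraMap_X, RatFunc.algebraMap_C, map_mul, map_pow]
      field_simp
    · intro z hz
      rw [eval_prod, Finset.prod_ne_zero_iff]
      intro i _ h
      refine hz i ?_
      simp only [eval_sub, eval_C, eval_X] at h
      exact sub_eq_zero.1 h
  · have h0 : (-(-(n : ℤ))).toNat = n := by omega
    rw [h0]
    refine ⟨1, ?_, ?_, by simp⟩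
    · rw [natDegree_one, downPoles, Finset.card_image_of_injective _ (downPoles_injective hq0 hq1 hc)]
      simp
    · rw [downPoles, Finset.prod_image (downPoles_injective hq0 hq1 hc).injOn, qPoch_neg_natCast,
        ← Finset.prod_inv_distrib, map_prod, map_one, zpow_neg, zpow_natCast, ← inv_pow,
        ← Finset.card_range n, ← Finset.prod_const, Finset.card_range, ← Finset.prod_mul_distrib,
        ← Finset.prod_mul_distrib]
      refine Finset.prod_eq_one fun i _ => ?_
      have hx : (X - C (c * (q ^ (i + 1))⁻¹) : ℂ[X]) ≠ 0 := X_sub_C_ne_zero _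
      have hx' := RatFunc.algebraMap_ne_zero hx
      have e : (RatFunc.X * (1 - RatFunc.C c / RatFunc.X * (RatFunc.C q ^ (i + 1))⁻¹) : RatFunc ℂ) =
          algebraMap ℂ[X] (RatFunc ℂ) (X - C (c * (q ^ (i + 1))⁻¹)) := by
        simp only [map_sub, RatFunc.algebraMap_X, RatFunc.algebraMap_C, map_mul, map_inv₀, map_pow]
        field_simp
      rw [← mul_inv, e, inv_mul_cancel₀ hx']

/-- The poles of `spanFun q a b k l`. -/
noncomputable def spanPoles (q : ℂ) (a b : Fin 3 → ℂ) (k l : Fin 3 → ℤ) : Finset ℂ :=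
  Finset.univ.biUnion fun j => upPoles q (a j) (-k j).toNat ∪ downPoles q (b j) (-l j).toNat

/-- As `-∑ k_j = ∑ l_j`, the power of `X` distributes as one `X ^ l_j` to each factor `(b_j /
X)_{l_j}`. Genericity makes the six families of poles disjoint, hence all poles are simple. The
degree excess `∑ (k_j + l_j)` is zero, which is regularity at infinity. -/
theorem exists_polynomial_spanFun (hq0 : q ≠ 0) (hq1 : ‖q‖ < 1) (h : GenericParameters q a b)
    {k l : Fin 3 → ℤ} (hkl : ∑ j, k j = -∑ j, l j) :
    ∃ p : ℂ[X], p.natDegree ≤ (spanPoles q a b k l).card ∧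
      spanFun q a b k l * algebraMap ℂ[X] (RatFunc ℂ) (∏ s ∈ spanPoles q a b k l, (X - C s)) =
        algebraMap ℂ[X] (RatFunc ℂ) p ∧ ∀ z ∈ poleSet q a b, p.eval z ≠ 0 := by
  have ha := h.a_ne_zero hq0
  have hb := h.b_ne_zero hq0
  have hX : (RatFunc.X : RatFunc ℂ) ≠ 0 := RatFunc.X_ne_zero
  choose u hu1 hu2 hu3 using fun j => exists_polynomial_up hq0 hq1 (ha j) (k j)
  choose v hv1 hv2 hv3 using fun j => exists_polynomial_down hq0 hq1 (hb j) (l j)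
  have hud : ∀ i j n m z, z ∈ upPoles q (a i) n → z ∈ downPoles q (b j) m → False := by
    intro i j n m z hz hz'
    obtain ⟨n', -, -, rfl⟩ := mem_upPoles.1 hz
    obtain ⟨m', -, -, e⟩ := mem_downPoles.1 hz'
    refine h.a_mul_b i j (n' + m') ?_
    have := ha i
    rw [zpow_add₀ hq0, zpow_natCast, zpow_natCast]
    field_simp at e
    linear_combination -e
  have huu : ∀ i j n m z, i ≠ j → z ∈ upPoles q (a i) n → z ∈ upPoles q (a j) m → False := by
    intro i j n m z hij hz hz'
    obtain ⟨n', -, -, rfl⟩ := mem_upPoles.1 hz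
    obtain ⟨m', -, -, e⟩ := mem_upPoles.1 hz'
    refine h.a_div_a i j hij (n' - m') ?_
    have h1 := ha i
    have h2 := ha j
    rw [zpow_sub₀ hq0, zpow_natCast, zpow_natCast]
    field_simp at e ⊢
    linear_combination -e
  have hdd : ∀ i j n m z, i ≠ j → z ∈ downPoles q (b i) n → z ∈ downPoles q (b j) m → False := by
    intro i j n m z hij hz hz'
    obtain ⟨n', -, -, rfl⟩ := mem_downPoles.1 hz
    obtain ⟨m', -, -, e⟩ := mem_downPoles.1 hz'
    refine h.b_div_b i j hij (n' - m') ?_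
    have h2 := hb j
    rw [zpow_sub₀ hq0, zpow_natCast, zpow_natCast]
    field_simp at e ⊢
    linear_combination e
  have hd1 : ∀ j, Disjoint (upPoles q (a j) (-k j).toNat) (downPoles q (b j) (-l j).toNat) :=
    fun j => Finset.disjoint_left.2 fun z hz hz' => hud _ _ _ _ z hz hz'
  have hd2 : Set.PairwiseDisjoint (↑(Finset.univ : Finset (Fin 3)))
      fun j => upPoles q (a j) (-k j).toNat ∪ downPoles q (b j) (-l j).toNat := by
    intro i _ j _ hij
    refine Finset.disjoint_left.2 fun z hz hz' => ?_
    rcases Finset.mem_union.1 hz with hz | hz <;> rcases Finset.mem_union.1 hz' with hz' | hz'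
    · exact huu _ _ _ _ z hij hz hz'
    · exact hud _ _ _ _ z hz hz'
    · exact hud _ _ _ _ z hz' hz
    · exact hdd _ _ _ _ z hij hz hz'
  refine ⟨∏ j, u j * v j, ?_, ?_, ?_⟩
  · have e1 : ((∏ j, u j * v j).natDegree : ℤ) ≤ ∑ j, (((u j).natDegree : ℤ) + (v j).natDegree) := by
      have := (natDegree_prod_le Finset.univ fun j => u j * v j).trans
        (Finset.sum_le_sum fun j _ => natDegree_mul_le (p := u j) (q := v j))
      exact_mod_cast this
    have e2 : ((spanPoles q a b k l).card : ℤ) =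
        ∑ j, (((upPoles q (a j) (-k j).toNat).card : ℤ) + (downPoles q (b j) (-l j).toNat).card) := by
      rw [spanPoles, Finset.card_biUnion fun i hi j hj hij => hd2 hi hj hij]
      push_cast
      refine Finset.sum_congr rfl fun j _ => ?_
      rw [Finset.card_union_of_disjoint (hd1 j)]
      push_cast
      rfl
    have e3 : ∑ j, (((u j).natDegree : ℤ) + (v j).natDegree) ≤ ∑ j, ((k j + l j) +
        (((upPoles q (a j) (-k j).toNat).card : ℤ) + (downPoles q (b j) (-l j).toNat).card)) :=
      Finset.sum_le_sum fun j _ => by linarith [hu1 j, hv1 j]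
    have e4 : ∑ j, ((k j + l j) + (((upPoles q (a j) (-k j).toNat).card : ℤ) +
        (downPoles q (b j) (-l j).toNat).card)) = (spanPoles q a b k l).card := by
      rw [e2, Finset.sum_add_distrib (f := fun j => k j + l j), Finset.sum_add_distrib (f := k),
        hkl, neg_add_cancel, zero_add]
    exact_mod_cast e1.trans (e3.trans e4.le)
  · have e : spanFun q a b k l = ∏ j, (qPoch (RatFunc.C q) (RatFunc.C (a j) * RatFunc.X) (k j) *
        (RatFunc.X ^ l j * qPoch (RatFunc.C q) (RatFunc.C (b j) / RatFunc.X) (l j))) := by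
      have hx : (RatFunc.X : RatFunc ℂ) ^ (-∑ j, k j) = ∏ j, RatFunc.X ^ l j := by
        rw [hkl, neg_neg, Fin.sum_univ_three, Fin.prod_univ_three, zpow_add₀ hX, zpow_add₀ hX]
      rw [spanFun, hx, ← Finset.prod_mul_distrib]
      exact Finset.prod_congr rfl fun j _ => by ring
    rw [e, spanPoles, Finset.prod_biUnion hd2, map_prod, map_prod, ← Finset.prod_mul_distrib]
    refine Finset.prod_congr rfl fun j _ => ?_
    rw [Finset.prod_union (hd1 j), map_mul, map_mul, ← hu2 j, ← hv2 j]
    ring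
  · rintro z ⟨i, m, hm, hz⟩
    rw [eval_prod, Finset.prod_ne_zero_iff]
    intro j _
    rw [eval_mul]
    have hqm : ∀ n : ℕ, 0 < n → q ^ n ≠ 1 := fun n hn e => hn.ne'
      (pow_injective_of_norm_lt_one hq0 hq1 (by simpa using e : q ^ n = q ^ 0))
    have hm0 := pow_ne_zero m hq0
    rcases hz with rfl | rfl
    · refine mul_ne_zero (hu3 j _ fun n e => ?_) (hv3 j _ fun n e => ?_)
      · by_cases hij : j = i
        · subst hij
          refine hqm (m + n) (by omega) ?_
          rw [← e, pow_add]
          have := ha j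
          field_simp
        · refine h.a_div_a j i hij (-(m + n : ℕ)) ?_
          rw [zpow_neg, zpow_natCast]
          refine eq_inv_of_mul_eq_one_left ?_
          rw [← e, pow_add]
          ring
      · refine h.a_mul_b i j (m - n) ?_
        have := ha i
        rw [zpow_sub₀ hq0, zpow_natCast, zpow_natCast]
        have := pow_ne_zero n hq0
        field_simp at e ⊢
        linear_combination -e
    · refine mul_ne_zero (hu3 j _ fun n e => ?_) (hv3 j _ fun n e => ?_)
      · refine h.a_mul_b j i (m - n) ?_
        rw [zpow_sub₀ hq0, zpow_natCast, zpow_natCast]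
        have := pow_ne_zero n hq0
        field_simp at e ⊢
        linear_combination e
      · by_cases hij : i = j
        · subst hij
          refine hqm (m + n) (by omega) ?_
          have := hb i
          rw [pow_add]
          field_simp at e
          linear_combination -e
        · refine h.b_div_b i j hij (m + n) ?_
          have := hb j
          rw [zpow_add₀ hq0, zpow_natCast, zpow_natCast]
          field_simp at e ⊢
          linear_combination e

theorem coe_spanPoles_subset (k l : Fin 3 → ℤ) :
    (↑(spanPoles q a b k l) : Set ℂ) ⊆ poleSet q a b := by
  intro z hz
  obtain ⟨j, -, hj⟩ := Finset.mem_biUnion.1 (Finset.mem_coe.1 hz)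
  rcases Finset.mem_union.1 hj with hj | hj
  · obtain ⟨m, hm, -, rfl⟩ := mem_upPoles.1 hj
    exact ⟨j, m, hm, Or.inl rfl⟩
  · obtain ⟨m, hm, -, rfl⟩ := mem_downPoles.1 hj
    exact ⟨j, m, hm, Or.inr rfl⟩

theorem spanFun_mem_W (hq0 : q ≠ 0) (hq1 : ‖q‖ < 1) (h : GenericParameters q a b)
    {k l : Fin 3 → ℤ} (hkl : ∑ j, k j = -∑ j, l j) : spanFun q a b k l ∈ W q a b := by
  obtain ⟨p, hp1, hp2, -⟩ := exists_polynomial_spanFun hq0 hq1 h hkl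
  exact (hasOnlySimplePolesIn_iff _ _).2 ⟨_, coe_spanPoles_subset k l, p, hp1, hp2⟩

/-- Partial fractions. -/
theorem exists_partialFractions (S : Finset ℂ) (f : RatFunc ℂ) (p : ℂ[X]) (hp : p.natDegree ≤ S.card)
    (hf : f * algebraMap ℂ[X] (RatFunc ℂ) (∏ s ∈ S, (X - C s)) = algebraMap ℂ[X] (RatFunc ℂ) p) :
    ∃ (c0 : ℂ) (c : ℂ → ℂ), f = c0 • 1 + ∑ s ∈ S, c s • (RatFunc.X - RatFunc.C s)⁻¹ ∧
      ∀ s ∈ S, p.eval s ≠ 0 → c s ≠ 0 := by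
  classical
  induction S using Finset.induction_on generalizing f p with
  | empty =>
    rw [Finset.card_empty, Nat.le_zero] at hp
    rw [Finset.prod_empty, map_one, mul_one] at hf
    refine ⟨p.coeff 0, 0, ?_, by simp⟩
    rw [hf, eq_C_of_natDegree_eq_zero hp, RatFunc.algebraMap_C, RatFunc.smul_eq_C_mul]
    simp
  | insert s S hs ih =>
    set D : ℂ[X] := ∏ s ∈ S, (X - C s) with hD
    have hDs : D.eval s ≠ 0 := by
      rw [hD, eval_prod, Finset.prod_ne_zero_iff]
      intro t ht e
      rw [eval_sub, eval_X, eval_C, sub_eq_zero] at e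
      exact hs (e ▸ ht)
    -- The residue of `f` at `s`; subtracting the corresponding simple fraction removes this pole,
    -- and the induction continues with `S`.
    set r : ℂ := p.eval s / D.eval s with hr
    have hroot : (p - C r * D).IsRoot s := by
      rw [IsRoot, eval_sub, eval_mul, eval_C, hr, div_mul_cancel₀ _ hDs, sub_self]
    obtain ⟨p', hp'⟩ := dvd_iff_isRoot.2 hroot
    have hDdeg : D.natDegree = S.card := by
      rw [hD, natDegree_prod_of_monic _ _ fun s _ => monic_X_sub_C s]
      simp
    have hdeg : p'.natDegree ≤ S.card := by
      by_cases h0 : p' = 0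
      · simp [h0]
      have h1 := congrArg natDegree hp'
      rw [natDegree_mul (X_sub_C_ne_zero s) h0, natDegree_X_sub_C] at h1
      have h2 : (p - C r * D).natDegree ≤ S.card + 1 := by
        refine (natDegree_sub_le _ _).trans (max_le ?_ ?_)
        · rwa [Finset.card_insert_of_notMem hs] at hp
        · exact (natDegree_C_mul_le _ _).trans (by omega)
      omega
    have hXs : (RatFunc.X - RatFunc.C s : RatFunc ℂ) ≠ 0 := by
      have := RatFunc.algebraMap_ne_zero (X_sub_C_ne_zero s)
      rwa [map_sub, RatFunc.algebraMap_X, RatFunc.algebraMap_C] at this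
    have hf' : (f - r • (RatFunc.X - RatFunc.C s)⁻¹) * algebraMap ℂ[X] (RatFunc ℂ) D =
        algebraMap ℂ[X] (RatFunc ℂ) p' := by
      have h1 := congrArg (algebraMap ℂ[X] (RatFunc ℂ)) hp'
      rw [Finset.prod_insert hs, ← hD, map_mul] at hf
      simp only [map_sub, map_mul, RatFunc.algebraMap_X, RatFunc.algebraMap_C] at h1 hf
      refine mul_left_cancel₀ hXs ?_
      rw [← h1, ← hf, RatFunc.smul_eq_C_mul]
      field_simp
    obtain ⟨c0, c, hc, hcne⟩ := ih _ p' hdeg hf'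
    refine ⟨c0, Function.update c s r, ?_, ?_⟩
    · rw [Finset.sum_insert hs, Function.update_self, add_left_comm, ← sub_eq_iff_eq_add', hc]
      congr 1
      refine Finset.sum_congr rfl fun t ht => ?_
      rw [Function.update_of_ne (by rintro rfl; exact hs ht)]
    · intro t ht hpt
      rcases Finset.mem_insert.1 ht with rfl | ht'
      · rw [Function.update_self]
        exact div_ne_zero hpt hDs
      · rw [Function.update_of_ne (by rintro rfl; exact hs ht')]
        -- At another pole `t` the product `D` vanishes, so `p(t) = (t - s) p'(t)`, and nonvanishing
        -- passes from `p` to `p'`.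
        refine hcne t ht' fun h0 => hpt ?_
        have h1 := congrArg (eval t) hp'
        rw [eval_sub, eval_mul, eval_mul, h0, mul_zero, hD, eval_prod,
          Finset.prod_eq_zero ht' (by simp), mul_zero, sub_zero] at h1
        exact h1

/-- The span of the functions `spanFun q a b k l`. -/
noncomputable def spanW (q : ℂ) (a b : Fin 3 → ℂ) : Submodule ℂ (RatFunc ℂ) :=
  Submodule.span ℂ {f | ∃ k l : Fin 3 → ℤ, ∑ j, k j = -∑ j, l j ∧ f = spanFun q a b k l}

theorem one_mem_spanW (q : ℂ) (a b : Fin 3 → ℂ) : (1 : RatFunc ℂ) ∈ spanW q a b :=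
  Submodule.subset_span ⟨0, 0, by simp, by simp [spanFun]⟩

/-- The coefficient at `z` in the partial fraction expansion of `spanFun` is nonzero because its
poles are genuine, so the expansion can be solved for `1/(X - z)`. -/
theorem inv_mem_spanW_of_lower (hq0 : q ≠ 0) (hq1 : ‖q‖ < 1) (h : GenericParameters q a b)
    {k l : Fin 3 → ℤ} (hkl : ∑ j, k j = -∑ j, l j) {z : ℂ} (hz : z ∈ spanPoles q a b k l)
    (hlow : ∀ s ∈ spanPoles q a b k l, s ≠ z → (RatFunc.X - RatFunc.C s)⁻¹ ∈ spanW q a b) :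
    (RatFunc.X - RatFunc.C z)⁻¹ ∈ spanW q a b := by
  obtain ⟨p, hp1, hp2, hp3⟩ := exists_polynomial_spanFun hq0 hq1 h hkl
  obtain ⟨c0, c, hc, hcne⟩ := exists_partialFractions _ _ p hp1 hp2
  have hcz := hcne z hz (hp3 z (coe_spanPoles_subset k l hz))
  rw [← Finset.add_sum_erase _ _ hz] at hc
  have hmem : c z • (RatFunc.X - RatFunc.C z)⁻¹ ∈ spanW q a b := by
    have e : c z • (RatFunc.X - RatFunc.C z)⁻¹ = spanFun q a b k l - c0 • 1 -
        ∑ s ∈ (spanPoles q a b k l).erase z, c s • (RatFunc.X - RatFunc.C s)⁻¹ := by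
      rw [hc]; abel
    rw [e]
    refine Submodule.sub_mem _ (Submodule.sub_mem _ (Submodule.subset_span ⟨k, l, hkl, rfl⟩)
      (Submodule.smul_mem _ _ (one_mem_spanW q a b))) (Submodule.sum_mem _ fun s hs => ?_)
    exact Submodule.smul_mem _ _ (hlow s (Finset.mem_of_mem_erase hs) (Finset.ne_of_mem_erase hs))
  have := Submodule.smul_mem _ (c z)⁻¹ hmem
  rwa [smul_smul, inv_mul_cancel₀ hcz, one_smul] at this

theorem up_inv_mem_spanW (hq0 : q ≠ 0) (hq1 : ‖q‖ < 1) (h : GenericParameters q a b) (j : Fin 3)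
    (m : ℕ) (hm : 0 < m) : (RatFunc.X - RatFunc.C ((a j)⁻¹ * q ^ m))⁻¹ ∈ spanW q a b := by
  induction m using Nat.strong_induction_on with
  | _ m ih =>
    have hj : j ≠ j + 1 := by fin_cases j <;> decide
    -- With `l = 0`, lowering `a_j` by `m` and raising one neighbour by `m` keeps `∑ k_j = 0`. The
    -- only poles are then `a_j⁻¹ q ^ n` with `1 ≤ n ≤ m`, and those with `n < m` are covered by the
    -- induction.
    set k : Fin 3 → ℤ := Pi.single j (-(m : ℤ)) + Pi.single (j + 1) (m : ℤ) with hk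
    have hkl : ∑ j, k j = -∑ j, (0 : Fin 3 → ℤ) j := by
      simp [hk, Finset.sum_add_distrib]
    have hkj : (-k j).toNat = m := by
      simp [hk, hj]
    have hki : ∀ i, i ≠ j → (-k i).toNat = 0 := by
      intro i hi
      rw [Int.toNat_eq_zero]
      simp only [hk, Pi.add_apply, Pi.single_apply, hi, if_false, zero_add]
      split_ifs <;> omega
    refine inv_mem_spanW_of_lower hq0 hq1 h hkl ?_ fun s hs hne => ?_
    · refine Finset.mem_biUnion.2 ⟨j, Finset.mem_univ j, Finset.mem_union_left _ ?_⟩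
      rw [hkj]
      exact mem_upPoles.2 ⟨m, hm, le_rfl, rfl⟩
    · obtain ⟨i, -, hi⟩ := Finset.mem_biUnion.1 hs
      rcases Finset.mem_union.1 hi with hi | hi
      · obtain ⟨n, hn0, hn, rfl⟩ := mem_upPoles.1 hi
        by_cases hij : i = j
        · subst hij
          rw [hkj] at hn
          exact ih n (lt_of_le_of_ne hn (by rintro rfl; exact hne rfl)) hn0
        · rw [hki i hij] at hn
          omega
      · obtain ⟨n, hn0, hn, rfl⟩ := mem_downPoles.1 hi
        simp at hn
        omega

theorem down_inv_mem_spanW (hq0 : q ≠ 0) (hq1 : ‖q‖ < 1) (h : GenericParameters q a b) (j : Fin 3)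
    (m : ℕ) (hm : 0 < m) : (RatFunc.X - RatFunc.C (b j * (q ^ m)⁻¹))⁻¹ ∈ spanW q a b := by
  induction m using Nat.strong_induction_on with
  | _ m ih =>
    have hj : j ≠ j + 1 := by fin_cases j <;> decide
    -- The same triangular choice, now for the exponents of the `b_j`, with those of the `a_j` equal
    -- to zero.
    set k : Fin 3 → ℤ := Pi.single j (-(m : ℤ)) + Pi.single (j + 1) (m : ℤ) with hk
    have hkl : ∑ j, (0 : Fin 3 → ℤ) j = -∑ j, k j := by
      simp [hk, Finset.sum_add_distrib]
    have hkj : (-k j).toNat = m := by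
      simp [hk, hj]
    have hki : ∀ i, i ≠ j → (-k i).toNat = 0 := by
      intro i hi
      rw [Int.toNat_eq_zero]
      simp only [hk, Pi.add_apply, Pi.single_apply, hi, if_false, zero_add]
      split_ifs <;> omega
    refine inv_mem_spanW_of_lower hq0 hq1 h hkl ?_ fun s hs hne => ?_
    · refine Finset.mem_biUnion.2 ⟨j, Finset.mem_univ j, Finset.mem_union_right _ ?_⟩
      rw [hkj]
      exact mem_downPoles.2 ⟨m, hm, le_rfl, rfl⟩
    · obtain ⟨i, -, hi⟩ := Finset.mem_biUnion.1 hs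
      rcases Finset.mem_union.1 hi with hi | hi
      · obtain ⟨n, hn0, hn, rfl⟩ := mem_upPoles.1 hi
        simp at hn
        omega
      · obtain ⟨n, hn0, hn, rfl⟩ := mem_downPoles.1 hi
        by_cases hij : i = j
        · subst hij
          rw [hkj] at hn
          exact ih n (lt_of_le_of_ne hn (by rintro rfl; exact hne rfl)) hn0
        · rw [hki i hij] at hn
          omega

/-- The functions `spanFun q a b k l` span `W q a b`. -/
theorem W_le_spanW (hq0 : q ≠ 0) (hq1 : ‖q‖ < 1) (h : GenericParameters q a b) :
    W q a b ≤ spanW q a b := by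
  intro f hf
  obtain ⟨S, hS, p, hp, hfp⟩ := (hasOnlySimplePolesIn_iff _ _).1 hf
  obtain ⟨c0, c, rfl, -⟩ := exists_partialFractions S f p hp hfp
  refine Submodule.add_mem _ (Submodule.smul_mem _ _ (one_mem_spanW q a b))
    (Submodule.sum_mem _ fun s hs => Submodule.smul_mem _ _ ?_)
  obtain ⟨j, m, hm, rfl | rfl⟩ := hS hs
  · exact up_inv_mem_spanW hq0 hq1 h j m hm
  · exact down_inv_mem_spanW hq0 hq1 h j m hm

end QSeries

namespace QSeries

open Filter Topology Polynomial

/-! ### The functional on `W` -/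

variable {q : ℂ} {a b : Fin 3 → ℂ}

theorem eval_denom_ne_zero {f : RatFunc ℂ} (hf : f ∈ W q a b) {z : ℂ} (hz : z ∉ poleSet q a b) :
    f.denom.eval₂ (RingHom.id ℂ) z ≠ 0 := fun h0 => by
  have h1 : f.denom.rootMultiplicity z = 0 := hf.2.1 z hz
  rw [rootMultiplicity_eq_zero_iff] at h1
  exact f.denom_ne_zero (h1 h0)

theorem GenericNodes.notMem_poleSet (hq0 : q ≠ 0) (h : GenericParameters q a b) {lam : Fin 3 → ℂ}
    (hn : GenericNodes q a b lam) (i : Fin 3) (x : ℤ) : lam i * q ^ x ∉ poleSet q a b := by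
  have hx := zpow_ne_zero x hq0
  rintro ⟨j, m, -, e | e⟩
  · have := h.a_ne_zero hq0 j
    refine hn.a_mul_lam j i (m - x) ?_
    rw [zpow_sub₀ hq0, zpow_natCast]
    field_simp at e ⊢
    linear_combination e
  · have := h.b_ne_zero hq0 j
    refine hn.lam_div_b j i (-m - x) ?_
    rw [zpow_sub₀ hq0, zpow_neg, zpow_natCast]
    field_simp at e ⊢
    linear_combination e

theorem sumTerm_add (hq0 : q ≠ 0) (h : GenericParameters q a b) {lam : Fin 3 → ℂ}
    (hn : GenericNodes q a b lam) {f g : RatFunc ℂ} (hf : f ∈ W q a b) (hg : g ∈ W q a b)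
    (i : Fin 3) (x : ℤ) : sumTerm q a b (f + g) (lam i) x =
      sumTerm q a b f (lam i) x + sumTerm q a b g (lam i) x := by
  have hz := hn.notMem_poleSet hq0 h i x
  rw [sumTerm, RatFunc.eval_add _ _ (eval_denom_ne_zero hf hz) (eval_denom_ne_zero hg hz), sumTerm,
    sumTerm]
  ring

theorem sumTerm_smul (hq0 : q ≠ 0) (h : GenericParameters q a b) {lam : Fin 3 → ℂ}
    (hn : GenericNodes q a b lam) {f : RatFunc ℂ} (hf : f ∈ W q a b) (c : ℂ) (i : Fin 3) (x : ℤ) :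
    sumTerm q a b (c • f) (lam i) x = c * sumTerm q a b f (lam i) x := by
  have hz := hn.notMem_poleSet hq0 h i x
  rw [sumTerm, RatFunc.smul_eq_C_mul, RatFunc.eval_mul _ _ (by simp) (eval_denom_ne_zero hf hz),
    sumTerm, RatFunc.eval_C, RingHom.id_apply]
  ring

/-- A property of elements of `W q a b` that is linear and holds for the functions `spanFun q a b k l`
holds everywhere. -/
theorem W_induction (hq0 : q ≠ 0) (hq1 : ‖q‖ < 1) (h : GenericParameters q a b)
    {p : W q a b → Prop}
    (mem : ∀ (k l : Fin 3 → ℤ) (hkl : ∑ j, k j = -∑ j, l j),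
      p ⟨spanFun q a b k l, spanFun_mem_W hq0 hq1 h hkl⟩)
    (zero : p 0) (add : ∀ f g, p f → p g → p (f + g)) (smul : ∀ (c : ℂ) f, p f → p (c • f))
    (f : W q a b) : p f := by
  -- The induction over the span takes place among all rational functions, so membership in `W` is
  -- carried along in the predicate.
  have key : ∃ hf : (f : RatFunc ℂ) ∈ W q a b, p ⟨f, hf⟩ := by
    refine Submodule.span_induction (p := fun x _ => ∃ hx : x ∈ W q a b, p ⟨x, hx⟩) ?_ ?_ ?_ ?_
      (W_le_spanW hq0 hq1 h f.2)
    · rintro _ ⟨k, l, hkl, rfl⟩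
      exact ⟨_, mem k l hkl⟩
    · exact ⟨_, zero⟩
    · rintro x y - - ⟨hx, hpx⟩ ⟨hy, hpy⟩
      exact ⟨_, add _ _ hpx hpy⟩
    · rintro c x - ⟨hx, hpx⟩
      exact ⟨_, smul c _ hpx⟩
  exact key.2

theorem summable_sumTerm (hq0 : q ≠ 0) (hq1 : ‖q‖ < 1) (h : GenericParameters q a b)
    {lam : Fin 3 → ℂ} (hn : GenericNodes q a b lam) (g : W q a b) (i : Fin 3) :
    Summable (sumTerm q a b g (lam i)) := by
  refine W_induction (p := fun g => Summable (sumTerm q a b g (lam i))) hq0 hq1 h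
    (fun k l hkl => summable_sumTerm_spanFun hq0 hq1 h hn hkl i) ?_ (fun f g hf hg => ?_)
    (fun c f hf => ?_) g
  · exact summable_zero.congr fun x => by simp [sumTerm]
  · exact (hf.add hg).congr fun x => (sumTerm_add hq0 h hn f.2 g.2 i x).symm
  · exact (hf.mul_left c).congr fun x => (sumTerm_smul hq0 h hn f.2 c i x).symm

/-- The combination of bilateral series at the nodes `lam`, as a linear functional on `W q a b`. -/
noncomputable def seriesFunctional (hq0 : q ≠ 0) (hq1 : ‖q‖ < 1) (h : GenericParameters q a b)
    {lam : Fin 3 → ℂ} (hn : GenericNodes q a b lam) : W q a b →ₗ[ℂ] ℂ where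
  toFun g := coeffC q a b lam * ∑ i, coeffX q a b lam i * ∑' x : ℤ, sumTerm q a b g (lam i) x
  map_add' f g := by
    have e : ∀ i, ∑' x : ℤ, sumTerm q a b ((f + g : W q a b) : RatFunc ℂ) (lam i) x =
        ∑' x : ℤ, sumTerm q a b f (lam i) x + ∑' x : ℤ, sumTerm q a b g (lam i) x := fun i => by
      rw [← (summable_sumTerm hq0 hq1 h hn f i).tsum_add (summable_sumTerm hq0 hq1 h hn g i)]
      exact tsum_congr fun x => sumTerm_add hq0 h hn f.2 g.2 i x
    simp only [e, mul_add, Finset.sum_add_distrib]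
  map_smul' c f := by
    have e : ∀ i, ∑' x : ℤ, sumTerm q a b ((c • f : W q a b) : RatFunc ℂ) (lam i) x =
        c * ∑' x : ℤ, sumTerm q a b f (lam i) x := fun i => by
      rw [← tsum_mul_left]
      exact tsum_congr fun x => sumTerm_smul hq0 h hn f.2 c i x
    simp only [e, RingHom.id_apply, smul_eq_mul, Finset.mul_sum]
    exact Finset.sum_congr rfl fun i _ => by ring

theorem isAlSalamIsmailFunctional_seriesFunctional (hq0 : q ≠ 0) (hq1 : ‖q‖ < 1)
    (h : GenericParameters q a b) {lam : Fin 3 → ℂ} (hn : GenericNodes q a b lam) :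
    IsAlSalamIsmailFunctional q a b (seriesFunctional hq0 hq1 h hn) := fun _ _ hkl =>
  ⟨spanFun_mem_W hq0 hq1 h hkl, coeffC_mul_sum_spanFun hq0 hq1 h hn hkl⟩

theorem IsAlSalamIsmailFunctional.unique (hq0 : q ≠ 0) (hq1 : ‖q‖ < 1)
    (h : GenericParameters q a b) {K K' : W q a b →ₗ[ℂ] ℂ}
    (hK : IsAlSalamIsmailFunctional q a b K) (hK' : IsAlSalamIsmailFunctional q a b K') :
    K = K' := by
  refine LinearMap.ext (W_induction hq0 hq1 h (fun k l hkl => ?_) (by simp) (fun f g hf hg => ?_)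
    fun c f hf => ?_)
  · obtain ⟨_, e⟩ := hK k l hkl
    obtain ⟨_, e'⟩ := hK' k l hkl
    exact e.trans e'.symm
  · rw [map_add, map_add, hf, hg]
  · rw [map_smul, map_smul, hf]

/-! ### Existence of generic nodes -/

/-- Each condition excludes at most one `z`, so only countably many points of the uncountable `ℂ`
are excluded. For `c i = 0` the condition holds trivially, since `q ^ m ≠ 0`. -/
theorem exists_forall_mul_ne_zpow {ι : Type*} [Countable ι] (hq0 : q ≠ 0) (c : ι → ℂ) :
    ∃ z : ℂ, z ≠ 0 ∧ ∀ i, ∀ m : ℤ, c i * z ≠ q ^ m := by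
  have hS : (insert 0 (Set.range fun p : ι × ℤ => (c p.1)⁻¹ * q ^ p.2) : Set ℂ).Countable :=
    (Set.countable_range _).insert _
  obtain ⟨z, hz⟩ : ∃ z, z ∉ insert 0 (Set.range fun p : ι × ℤ => (c p.1)⁻¹ * q ^ p.2) := by
    by_contra! hall
    exact not_countable_complex (hS.mono fun z _ => hall z)
  refine ⟨z, fun h0 => hz (Or.inl h0), fun i m e => hz (Or.inr ⟨(i, m), ?_⟩)⟩
  have hc : c i ≠ 0 := by
    intro h0
    rw [h0, zero_mul] at e
    exact zpow_ne_zero m hq0 e.symm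
  simp only [← e]
  rw [inv_mul_cancel_left₀ hc]

theorem exists_genericNodes (hq0 : q ≠ 0) (a b : Fin 3 → ℂ) :
    ∃ lam : Fin 3 → ℂ, GenericNodes q a b lam := by
  have key : ∀ c : Fin 3 → ℂ, ∃ z : ℂ, z ≠ 0 ∧ (∀ j, ∀ m : ℤ, a j * z ≠ q ^ m) ∧
      (∀ j, ∀ m : ℤ, z / b j ≠ q ^ m) ∧ ∀ j, ∀ m : ℤ, c j * z ≠ q ^ m := fun c => by
    obtain ⟨z, hz, h⟩ := exists_forall_mul_ne_zpow hq0
      (Sum.elim a (Sum.elim (fun j => (b j)⁻¹) c))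
    refine ⟨z, hz, fun j => h (Sum.inl j), fun j m e => h (Sum.inr (Sum.inl j)) m ?_,
      fun j => h (Sum.inr (Sum.inr j))⟩
    rw [← e, div_eq_inv_mul]
    rfl
  have hinv : ∀ {u v : ℂ}, (∀ m : ℤ, u⁻¹ * v ≠ q ^ m) →
      (∀ m : ℤ, u / v ≠ q ^ m) ∧ ∀ m : ℤ, v / u ≠ q ^ m := fun h => by
    refine ⟨fun m e => h (-m) ?_, fun m e => h m ?_⟩
    · rw [zpow_neg, ← e, inv_div, div_eq_inv_mul]
    · rw [← e, div_eq_inv_mul]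
  -- The nodes are chosen one after another, each avoiding the orbits of the earlier ones; zero
  -- entries of `c` impose no condition. The last entry for `w` enforces the condition on `t u v w`.
  obtain ⟨u, hu0, hua, hub, -⟩ := key 0
  obtain ⟨v, hv0, hva, hvb, hvc⟩ := key ![u⁻¹, 0, 0]
  obtain ⟨w, hw0, hwa, hwb, hwc⟩ := key ![u⁻¹, v⁻¹, (∏ j, a j) * (u * v)]
  have huv := hinv (hvc 0)
  have huw := hinv (hwc 0)
  have hvw := hinv (hwc 1)
  refine ⟨![u, v, w], ?_, ?_, fun m e => hwc 2 m ?_, ?_, ?_⟩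
  · intro k
    fin_cases k
    exacts [hu0, hv0, hw0]
  · intro i j hij
    fin_cases i <;> fin_cases j
    exacts [absurd rfl hij, huv.1, huw.1, huv.2, absurd rfl hij, hvw.1, huw.2, hvw.2,
      absurd rfl hij]
  · rw [← e, Fin.prod_univ_three (f := ![u, v, w])]
    exact mul_assoc _ _ _
  · intro j k
    fin_cases k
    exacts [hua j, hva j, hwa j]
  · intro j k
    fin_cases k
    exacts [hub j, hvb j, hwb j]

end QSeries

theorem mainTheorem11 (q : ℂ) (hq0 : q ≠ 0) (hq1 : ‖q‖ < 1) (a b : Fin 3 → ℂ)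
    (hab : QSeries.GenericParameters q a b) :
    ∃ K : QSeries.W q a b →ₗ[ℂ] ℂ,
      QSeries.IsAlSalamIsmailFunctional q a b K ∧
      (∀ K' : QSeries.W q a b →ₗ[ℂ] ℂ, QSeries.IsAlSalamIsmailFunctional q a b K' → K' = K) ∧
      ∀ lam : Fin 3 → ℂ, QSeries.GenericNodes q a b lam → ∀ g : QSeries.W q a b,
        (∀ k, Summable fun x : ℤ => QSeries.sumTerm q a b g (lam k) x) ∧
        K g = QSeries.coeffC q a b lam *
          ∑ k, QSeries.coeffX q a b lam k *
            ∑' x : ℤ, QSeries.sumTerm q a b g (lam k) x := by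
  -- An auxiliary choice of nodes, used only to define the functional; uniqueness then identifies it
  -- with the series at any other generic nodes.
  obtain ⟨lam₀, h₀⟩ := QSeries.exists_genericNodes hq0 a b
  refine ⟨QSeries.seriesFunctional hq0 hq1 hab h₀,
    QSeries.isAlSalamIsmailFunctional_seriesFunctional hq0 hq1 hab h₀, fun K' hK' =>
      hK'.unique hq0 hq1 hab
        (QSeries.isAlSalamIsmailFunctional_seriesFunctional hq0 hq1 hab h₀),
    fun lam hn g => ⟨QSeries.summable_sumTerm hq0 hq1 hab hn g, ?_⟩⟩
  rw [(QSeries.isAlSalamIsmailFunctional_seriesFunctional hq0 hq1 hab h₀).unique hq0 hq1 hab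
    (QSeries.isAlSalamIsmailFunctional_seriesFunctional hq0 hq1 hab hn)]
  rfl
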